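/- Let $\Sigma$ be a finite ordered alphabet of size $\sigma$, and let $T[1,n]\in\Sigma^n$, $n\ge 2$, $\sigma\le n$, be a text, i.e. $T[n]=\$$ is the smallest letter of $\Sigma$ and does not occur in $T[1,n-1]$. A string $\alpha$ is *right-maximal* in $T$ if it is a suffix of $T$ or if $\alpha a,\alpha b$ are substrings of $T$ for two distinct letters $a,b$. A set $S\subseteq\{1,\dots,n\}$ is *suffixient* for $T$ if for every right-maximal $\alpha$ and every letter $c$ such that $\alpha c$ is a substring of $T$ there is $x\in S$ such that $\alpha c$ is a suffix of $T[1,x]$. Let $\overline T=T[n-1]\cdots T[1]\$$, and let $\mathrm{SA}[1,n]$, $\mathrm{LCP}[2,n]$, $\mathrm{BWT}[1,n]$ be the suffix array, longest common prefix array and Burrows–Wheeler transform of $\overline T$. For $2\le i\le n$ let $\mathrm{PSV}[i]=\max(\{j : 2\le j<i,\ \mathrm{LCP}[j]<\mathrm{LCP}[i]\}\cup\{0\})$ and $\mathrm{NSV}[i]=\min(\{j : i<j\le n,\ \mathrm{LCP}[j]<\mathrm{LCP}[i]\}\cup\{n+1\})$. Consider the following algorithm. 1. Compute $\mathrm{SA},\mathrm{LCP},\mathrm{BWT},\mathrm{PSV},\mathrm{NSV}$;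 set $\mathcal S\gets\emptyset$ and, for every $c\in\Sigma$, $R[c]=(sa\_pos,text\_pos,active,nsv)\gets(0,0,false,n+1)$. 2. For $i=2,\dots,n$, if $\mathrm{BWT}[i]\ne\mathrm{BWT}[i-1]$, do the following for $i'=i-1$ and then for $i'=i$, with $c=\mathrm{BWT}[i']$: if $R[c].sa\_pos\le\mathrm{PSV}[i]$, then first, if $R[c].nsv<i$, add $R[c].text\_pos$ to $\mathcal S$, and then set $R[c]\gets(i,\ n-\mathrm{SA}[i']+1,\ true,\ \mathrm{NSV}[i])$. 3. For every $c\in\Sigma$ with $R[c].active=true$ add $R[c].text\_pos$ to $\mathcal S$. Return $\mathcal S$. **Lemma.** With a suitable subroutine for the computation of the five arrays in step 1, on a word RAM with words of $O(\log n)$ bits whose input consists of $n$, $\sigma$ and the ranks in $\Sigma$ of the letters of $T$, this algorithm computes a suffixient set $\mathcal S$ of smallest cardinality for $T$ in $O(n)$ time and $O(n)$ words of space (including the computation of the arrays), with absolute constants. Moreover, call $i\in[2,n]$ a *$c$-run break* if $\mathrm{BWT}[i-1]\ne\mathrm{BWT}[i]$ and $c\in\{\mathrm{BWT}[i-1],\mathrm{BWT}[i]\}$;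 let $box(i)=[l_i,r_i]$ be the maximal interval in $[2,n]$ that contains $i$ and on which $\mathrm{LCP}\ge\mathrm{LCP}[i]$, and let $B_{i,c}$ be the set of $c$-run breaks in $box(i)$. Call a $c$-run break $i$ *first $c$-maximum* if (a) it is the first $c$-run break or the preceding $c$-run break $j$ satisfies $j\le l_i-1$, and (b) for every $c$-run break $j>i$, if $i\le l_j-1$ then $r_i+1<j$. Then $\mathcal S$ is exactly the set of all positions $n-\mathrm{SA}[i']+1$ such that, for some $c$ and some first $c$-maximum $i$, $i'\in\{i-1,i\}$ and $\mathrm{BWT}[i']=c$; and a $c$-run break $i$ is first $c$-maximum if and only if $i=\min\{j\in B_{i,c} : \mathrm{LCP}[j]=\max \mathrm{LCP}[B_{i,c}]\}$. -/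

import Mathlib

namespace Suffixient

section Strings

variable {A : Type*}

/-- The end marker is the smallest letter of the alphabet; it is the last letter of the text and
occurs nowhere else in it. -/
def IsText [LinearOrder A] (T : List A) : Prop :=
  ∃ d : A, (∀ a, a ≠ d → d < a) ∧ T.getLast? = some d ∧ d ∉ T.dropLast

/-- `T[n-1] T[n-2] ⋯ T[1] $` for `T = T[1] ⋯ T[n-1] $`. -/
def revText (T : List A) : List A :=
  T.dropLast.reverse ++ T.getLast?.toList

/-- A string that is a suffix of `T` or has two distinct one-letter right-extensions in `T`. -/
def RightMaximal (T α : List A) : Prop :=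
  α <:+ T ∨ ∃ a b : A, a ≠ b ∧ α ++ [a] <:+: T ∧ α ++ [b] <:+: T

/-- Positions are counted from `1`, and `T.take x` is the prefix `T[1,x]`. -/
def IsSuffixient (T : List A) (S : Finset ℕ) : Prop :=
  S ⊆ Finset.Icc 1 T.length ∧
    ∀ (α : List A) (c : A), RightMaximal T α → α ++ [c] <:+: T → ∃ x ∈ S, α ++ [c] <:+ T.take x

def IsSmallestSuffixient (T : List A) (S : Finset ℕ) : Prop :=
  IsSuffixient T S ∧ ∀ S' : Finset ℕ, IsSuffixient T S' → S.card ≤ S'.card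

/-- `U[p]` for `1 ≤ p ≤ |U|`, and `U[0] = U[|U|]`. -/
def charAt (U : List A) (p : ℕ) : Option A :=
  if p = 0 then U.getLast? else U[p - 1]?

/-- The suffix `U[p,|U|]`, for `1 ≤ p`. -/
def suffixAt (U : List A) (p : ℕ) : List A := U.drop (p - 1)

def lcpLength [DecidableEq A] : List A → List A → ℕ
  | a :: x, b :: y => if a = b then lcpLength x y + 1 else 0
  | _, _ => 0

variable [LinearOrder A]

/-- The positions `1, …, |U|`, sorted by the lexicographic order of the suffixes starting there. -/
def suffixArray (U : List A) : List ℕ :=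
  (List.range' 1 U.length).mergeSort fun p q => decide (suffixAt U p ≤ suffixAt U q)

/-- `SA[i]`, for `1 ≤ i ≤ |U|`. -/
def SA (U : List A) (i : ℕ) : ℕ := (suffixArray U).getD (i - 1) 0

/-- `LCP[i]`, for `2 ≤ i ≤ |U|`. -/
def LCP (U : List A) (i : ℕ) : ℕ :=
  lcpLength (suffixAt U (SA U (i - 1))) (suffixAt U (SA U i))

/-- `BWT[i]`, for `1 ≤ i ≤ |U|`. -/
def BWT (U : List A) (i : ℕ) : Option A := charAt U (SA U i - 1)

/-- Previous smaller value in an integer array with index range `[2,n]`. -/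
def PSV (L : ℕ → ℕ) (i : ℕ) : ℕ :=
  (insert 0 ((Finset.Ico 2 i).filter fun j => L j < L i)).max' (Finset.insert_nonempty _ _)

/-- Next smaller value in an integer array with index range `[2,n]`. -/
def NSV (n : ℕ) (L : ℕ → ℕ) (i : ℕ) : ℕ :=
  (insert (n + 1) ((Finset.Ioc i n).filter fun j => L j < L i)).min' (Finset.insert_nonempty _ _)

/-- `i` is a `c`-run break of the BWT of `U`. -/
def IsRunBreak (U : List A) (c : A) (i : ℕ) : Prop :=
  2 ≤ i ∧ i ≤ U.length ∧ BWT U (i - 1) ≠ BWT U i ∧ (BWT U (i - 1) = some c ∨ BWT U i = some c)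

/-- The maximal interval of `[2,|U|]` around `i` on which the LCP values are at least `LCP[i]`. -/
def box (U : List A) (i : ℕ) : Finset ℕ :=
  (Finset.Icc 2 U.length).filter fun j => ∀ k ∈ Finset.uIcc i j, LCP U i ≤ LCP U k

noncomputable def boxLeft (U : List A) (i : ℕ) : ℕ := sInf (box U i : Set ℕ)

noncomputable def boxRight (U : List A) (i : ℕ) : ℕ := sSup (box U i : Set ℕ)

/-- The `c`-run breaks in `box(i)`. -/
def boxBreaks (U : List A) (i : ℕ) (c : A) : Set ℕ := {j | IsRunBreak U c j ∧ j ∈ box U i}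

/-- `i = min {j ∈ B_{i,c} : LCP[j] = max LCP[B_{i,c}]}`. -/
def IsLeftmostMaximum (U : List A) (c : A) (i : ℕ) : Prop :=
  IsLeast {j | j ∈ boxBreaks U i c ∧ IsGreatest (LCP U '' boxBreaks U i c) (LCP U j)} i

/-- The `c`-run break `i` is the first one, or the preceding one lies to the left of `box(i)`. -/
def IsFirstCandidate (U : List A) (c : A) (i : ℕ) : Prop :=
  IsRunBreak U c i ∧
    ∀ j, IsGreatest {k | IsRunBreak U c k ∧ k < i} j → j ≤ boxLeft U i - 1

def IsFirstMaximum (U : List A) (c : A) (i : ℕ) : Prop :=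
  IsFirstCandidate U c i ∧
    ∀ j, IsRunBreak U c j → i < j → i ≤ boxLeft U j - 1 → boxRight U i + 1 < j

/-- The positions `n - SA[i'] + 1` of `T`, where `i` is first `c`-maximum in the BWT of the reversed
text, `i' ∈ {i-1, i}` and `BWT[i'] = c`. -/
def firstMaximumPositions (T : List A) : Set ℕ :=
  {x | ∃ (c : A) (i i' : ℕ), IsFirstMaximum (revText T) c i ∧ (i' = i - 1 ∨ i' = i) ∧
    BWT (revText T) i' = some c ∧ x = T.length - SA (revText T) i' + 1}

end Strings

section WordRAM

/-! A word RAM, programmed in a small structured language. Variables and arrays are named by natural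
numbers. A variable and an array cell hold one word each. -/

inductive Op
  | add | sub | mul | div | mod | lt | le | eq

/-- Subtraction is truncated at `0`; comparisons give `1` or `0`. -/
def Op.apply : Op → ℕ → ℕ → ℕ
  | .add, a, b => a + b
  | .sub, a, b => a - b
  | .mul, a, b => a * b
  | .div, a, b => a / b
  | .mod, a, b => a % b
  | .lt, a, b => if a < b then 1 else 0
  | .le, a, b => if a ≤ b then 1 else 0
  | .eq, a, b => if a = b then 1 else 0

inductive Expr
  | lit (k : ℕ)
  | var (x : ℕ)
  | get (a : ℕ) (e : Expr)
  | bin (o : Op) (e₁ e₂ : Expr)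

inductive Prog
  | skip
  | assign (x : ℕ) (e : Expr)
  | store (a : ℕ) (i e : Expr)
  | seq (p q : Prog)
  | ite (e : Expr) (p q : Prog)
  | while (e : Expr) (p : Prog)

structure State where
  vars : ℕ → ℕ
  arr : ℕ → ℕ → ℕ

/-- Words hold the values `0, …, cap - 1`, and every array has the cells `0, …, len - 1`. -/
structure Machine where
  cap : ℕ
  len : ℕ

/-- The value of an expression; there is none if an array is accessed out of bounds or if some
intermediate result does not fit into a word. -/
def Expr.eval (M : Machine) (s : State) : Expr → Option ℕ
  | .lit k => if k < M.cap then some k else none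
  | .var x => some (s.vars x)
  | .get a e => (e.eval M s).bind fun i => if i < M.len then some (s.arr a i) else none
  | .bin o e₁ e₂ => (e₁.eval M s).bind fun v₁ => (e₂.eval M s).bind fun v₂ =>
      if o.apply v₁ v₂ < M.cap then some (o.apply v₁ v₂) else none

/-- The number of unit-cost operations that the evaluation of an expression takes. -/
def Expr.cost : Expr → ℕ
  | .lit _ => 1
  | .var _ => 1
  | .get _ e => e.cost + 1
  | .bin _ e₁ e₂ => e₁.cost + e₂.cost + 1

/-- `Exec M p s t s'`: started in the state `s`, the program `p` halts in the state `s'` after `t`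
steps, without an overflow or an access out of bounds. -/
inductive Exec (M : Machine) : Prog → State → ℕ → State → Prop
  | skip (s : State) : Exec M .skip s 1 s
  | assign (s : State) (x : ℕ) (e : Expr) (v : ℕ) (hv : e.eval M s = some v) :
      Exec M (.assign x e) s (e.cost + 1) { s with vars := Function.update s.vars x v }
  | store (s : State) (a : ℕ) (i e : Expr) (j v : ℕ) (hj : i.eval M s = some j)
      (hlen : j < M.len) (hv : e.eval M s = some v) :
      Exec M (.store a i e) s (i.cost + e.cost + 1)
        { s with arr := Function.update s.arr a (Function.update (s.arr a) j v) }
  | seq (p q : Prog) (s s₁ s₂ : State) (t₁ t₂ : ℕ) (hp : Exec M p s t₁ s₁)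
      (hq : Exec M q s₁ t₂ s₂) : Exec M (.seq p q) s (t₁ + t₂) s₂
  | iteTrue (e : Expr) (p q : Prog) (s s₁ : State) (v t : ℕ) (he : e.eval M s = some v)
      (hv : v ≠ 0) (hp : Exec M p s t s₁) : Exec M (.ite e p q) s (e.cost + 1 + t) s₁
  | iteFalse (e : Expr) (p q : Prog) (s s₁ : State) (t : ℕ) (he : e.eval M s = some 0)
      (hq : Exec M q s t s₁) : Exec M (.ite e p q) s (e.cost + 1 + t) s₁
  | whileTrue (e : Expr) (p : Prog) (s s₁ s₂ : State) (v t₁ t₂ : ℕ) (he : e.eval M s = some v)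
      (hv : v ≠ 0) (hp : Exec M p s t₁ s₁) (hw : Exec M (.while e p) s₁ t₂ s₂) :
      Exec M (.while e p) s (e.cost + 1 + t₁ + t₂) s₂
  | whileFalse (e : Expr) (p : Prog) (s : State) (he : e.eval M s = some 0) :
      Exec M (.while e p) s (e.cost + 1) s

def Expr.varNames : Expr → Finset ℕ
  | .lit _ => ∅
  | .var x => {x}
  | .get _ e => e.varNames
  | .bin _ e₁ e₂ => e₁.varNames ∪ e₂.varNames

def Expr.arrNames : Expr → Finset ℕ
  | .lit _ => ∅
  | .var _ => ∅
  | .get a e => insert a e.arrNames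
  | .bin _ e₁ e₂ => e₁.arrNames ∪ e₂.arrNames

def Prog.varNames : Prog → Finset ℕ
  | .skip => ∅
  | .assign x e => insert x e.varNames
  | .store _ i e => i.varNames ∪ e.varNames
  | .seq p q => p.varNames ∪ q.varNames
  | .ite e p q => e.varNames ∪ p.varNames ∪ q.varNames
  | .while e p => e.varNames ∪ p.varNames

def Prog.arrNames : Prog → Finset ℕ
  | .skip => ∅
  | .assign _ e => e.arrNames
  | .store a i e => insert a (i.arrNames ∪ e.arrNames)
  | .seq p q => p.arrNames ∪ q.arrNames
  | .ite e p q => e.arrNames ∪ p.arrNames ∪ q.arrNames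
  | .while e p => e.arrNames ∪ p.arrNames

/-- The number of words of memory that a program occupies if its arrays have `len` cells each. -/
def Prog.words (p : Prog) (len : ℕ) : ℕ := p.varNames.card + p.arrNames.card * len

/-- On a machine whose words hold values below `cap`, the program `p` leads from `s` to `s'` in at
most `time` steps and within `space` words of memory. -/
def RunsWithin (p : Prog) (cap time space : ℕ) (s s' : State) : Prop :=
  ∃ len t : ℕ, p.words len ≤ space ∧ t ≤ time ∧ Exec ⟨cap, len⟩ p s t s'

def Prog.block : List Prog → Prog
  | [] => .skip
  | [p] => p
  | p :: ps => .seq p (Prog.block ps)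

/-- `for x = lo, …, hi do p`. -/
def Prog.for (x : ℕ) (lo hi : Expr) (p : Prog) : Prog :=
  .seq (.assign x lo)
    (.while (.bin .le (.var x) hi) (.seq p (.assign x (.bin .add (.var x) (.lit 1)))))

end WordRAM

section Algorithm

/-! Names of the variables and arrays. The array `aS` holds the set that is computed: its cell `x` is
`1` if `x` belongs to the set and `0` otherwise. The arrays `aRsa`, `aRtext`, `aRact`, `aRnsv` hold the
four components of the records `R[c]`. -/

abbrev vN : ℕ := 0
abbrev vSigma : ℕ := 1
abbrev vI : ℕ := 2
abbrev vI' : ℕ := 3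
abbrev vC : ℕ := 4

abbrev aT : ℕ := 0
abbrev aSA : ℕ := 1
abbrev aLCP : ℕ := 2
abbrev aBWT : ℕ := 3
abbrev aPSV : ℕ := 4
abbrev aNSV : ℕ := 5
abbrev aS : ℕ := 6
abbrev aRsa : ℕ := 7
abbrev aRtext : ℕ := 8
abbrev aRact : ℕ := 9
abbrev aRnsv : ℕ := 10

/-- `S ← ∅`. -/
def clearS : Prog := .for vI (.lit 1) (.var vN) (.store aS (.var vI) (.lit 0))

/-- `R[c] ← (0, 0, false, n+1)` for all letters `c`. -/
def initR : Prog :=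
  .for vC (.lit 1) (.var vSigma) (.block [
    .store aRsa (.var vC) (.lit 0),
    .store aRtext (.var vC) (.lit 0),
    .store aRact (.var vC) (.lit 0),
    .store aRnsv (.var vC) (.bin .add (.var vN) (.lit 1))])

/-- The treatment of one `i' ∈ {i-1, i}` at the run break `i`:
with `c = BWT[i']`, if `R[c].sa_pos ≤ PSV[i]` then report `R[c].text_pos` in case `R[c].nsv < i`, and
set `R[c] ← (i, n - SA[i'] + 1, true, NSV[i])`. -/
def processBreak : Prog :=
  .block [
    .assign vC (.get aBWT (.var vI')),
    .ite (.bin .le (.get aRsa (.var vC)) (.get aPSV (.var vI)))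
      (.block [
        .ite (.bin .lt (.get aRnsv (.var vC)) (.var vI))
          (.store aS (.get aRtext (.var vC)) (.lit 1))
          .skip,
        .store aRsa (.var vC) (.var vI),
        .store aRtext (.var vC)
          (.bin .add (.bin .sub (.var vN) (.get aSA (.var vI'))) (.lit 1)),
        .store aRact (.var vC) (.lit 1),
        .store aRnsv (.var vC) (.get aNSV (.var vI))])
      .skip]

/-- The scan `for i = 2, …, n`. -/
def scanBWT : Prog :=
  .for vI (.lit 2) (.var vN)
    (.ite (.bin .eq (.get aBWT (.var vI)) (.get aBWT (.bin .sub (.var vI) (.lit 1))))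
      .skip
      (.block [
        .assign vI' (.bin .sub (.var vI) (.lit 1)),
        processBreak,
        .assign vI' (.var vI),
        processBreak]))

/-- For every letter `c` with `R[c].active`, report `R[c].text_pos`. -/
def reportActive : Prog :=
  .for vC (.lit 1) (.var vSigma)
    (.ite (.bin .eq (.get aRact (.var vC)) (.lit 1))
      (.store aS (.get aRtext (.var vC)) (.lit 1))
      .skip)

/-- The whole algorithm; `arrays` is the subprogram that computes the arrays SA, LCP, BWT, PSV and
NSV of the reversed text. -/
def fmAlgorithm (arrays : Prog) : Prog :=
  .block [arrays, clearS, initR, scanBWT, reportActive]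

variable {A : Type*} [LinearOrder A] [Fintype A]

/-- The rank of a letter in the ordered alphabet, a number in `{1, …, σ}`. -/
def code (c : A) : ℕ := (Finset.univ.filter fun a => a ≤ c).card

/-- The memory at the beginning: `n`, `σ` and the text `T[1,n]`, letters being represented by their
ranks; all other words are `0`. -/
def inputState (T : List A) : State where
  vars x := if x = vN then T.length else if x = vSigma then Fintype.card A else 0
  arr a p := if a = aT ∧ 1 ≤ p then (T[p - 1]?).elim 0 code else 0

/-- The arrays of the reversed text are in place, and `n` and `σ` are intact. -/
def ArraysComputed (T : List A) (s : State) : Prop :=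
  s.vars vN = T.length ∧ s.vars vSigma = Fintype.card A ∧
  (∀ i ∈ Finset.Icc 1 T.length,
    s.arr aSA i = SA (revText T) i ∧ some (s.arr aBWT i) = (BWT (revText T) i).map code) ∧
  ∀ i ∈ Finset.Icc 2 T.length,
    s.arr aLCP i = LCP (revText T) i ∧
    s.arr aPSV i = PSV (LCP (revText T)) i ∧
    s.arr aNSV i = NSV T.length (LCP (revText T)) i

/-- The set that is represented by the array `aS`. -/
def outputSet (n : ℕ) (s : State) : Finset ℕ := (Finset.Icc 1 n).filter fun x => s.arr aS x = 1

end Algorithm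

end Suffixient

namespace Suffixient

/-! ### A program logic for the word RAM -/

/-! Combinatorics. An occurrence of `αc` ending in the text corresponds to a suffix of the reversed
text that begins with the reversal of `α` and is preceded by `c` (`concat_suffix_take_SA_iff`). The
suffixes beginning with a given string form an interval of the suffix array, inside which all LCP
values are at least the length of that string (`agree_SA_iff`). If `α` is right-maximal and `αc`
occurs, then some `αb` with `b ≠ c` occurs too, so the BWT contains both `c` and another letter on
this interval. Hence the interval contains a `c`-run break `k` with `LCP[k] ≥ |α|`.

Among the `c`-run breaks whose suffixes share that prefix, take one of largest LCP value and, among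
these, the leftmost. It is a first `c`-maximum `m` (`exists_isFirstMaximum`), and both suffixes `m -
1` and `m` begin with the reversal of `α`, so the text position belonging to `m` covers `αc`. This
gives `isSuffixient_of_coe_eq`.

For minimality, let `i` be a first `c`-maximum and `β` the common prefix of the suffixes `i - 1` and
`i`. The reversal of `β` is right-maximal, because the two preceding letters differ. So every
suffixient set contains a position whose suffix is preceded by `c` and agrees with suffix `i` on
`LCP[i]` letters (`IsFirstMaximum.exists_mem`). One position cannot serve two first maxima `i`, `j`
of the same letter: the one with the larger LCP value would lie in the box of the other, so the LCP
values are equal, each lies in the box of the other, and both are leftmost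
(`IsFirstMaximum.eq_of_agree`). Counting gives the lower bound.

The scan. Condition (a) of a first maximum looks only to the left; call a run break with (a) a
candidate. For each letter the record holds the last candidate `a`, and every later break `j` seen
so far has `PSV[j] < a`. A new break `k` is a candidate exactly if `a ≤ PSV[k]`, and then `a` is a
first maximum exactly if `NSV[a] < k` (`ScanData.cand_step`, `ScanData.max_iff_of_next`). A
candidate that is never superseded is a first maximum. The description by leftmost maxima in boxes
is `ScanData.max_iff`.

The arrays. Suffixes are ranked by the difference cover algorithm: the suffixes at positions not
divisible by `3` are ranked through a reduced string of names of triples, the remaining ones are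
sorted by one letter and a sample rank, and the two lists are merged. The language has no
procedures, so the recursion is unrolled with a stack of strings. The LCP array uses that passing
from a suffix to the next one in the text loses at most one matching letter
(`IsRank.agree_succ_pred`); PSV and NSV follow chains of smaller values. The running times of these
three loops are amortized by potentials (`RunT.loop`). -/

def State.set (s : State) (x v : ℕ) : State := { s with vars := Function.update s.vars x v }

def State.put (s : State) (a j v : ℕ) : State :=
  { s with arr := Function.update s.arr a (Function.update (s.arr a) j v) }

@[simp] theorem State.set_vars (s : State) (x v y : ℕ) :
    (s.set x v).vars y = if y = x then v else s.vars y := by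
  simp [State.set, Function.update_apply]

@[simp] theorem State.set_arr (s : State) (x v : ℕ) : (s.set x v).arr = s.arr := rfl

@[simp] theorem State.put_vars (s : State) (a j v : ℕ) : (s.put a j v).vars = s.vars := rfl

@[simp] theorem State.put_arr (s : State) (a j v b i : ℕ) :
    (s.put a j v).arr b i = if b = a ∧ i = j then v else s.arr b i := by
  simp only [State.put, Function.update_apply]
  by_cases h : b = a
  · subst h; simp [Function.update_apply]
  · simp [h]

/-- The value of an expression, regardless of overflows and bounds. -/
def Expr.val (s : State) : Expr → ℕ
  | .lit k => k
  | .var x => s.vars x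
  | .get a e => s.arr a (e.val s)
  | .bin o e₁ e₂ => o.apply (e₁.val s) (e₂.val s)

/-- A sufficient condition for the result of an operation to fit into a word. -/
def Op.Fits (cap : ℕ) : Op → ℕ → ℕ → Prop
  | .add, a, b => a + b < cap
  | .sub, a, _ => a < cap
  | .mul, a, b => a * b < cap
  | .div, a, _ => a < cap
  | .mod, a, _ => a < cap
  | .lt, _, _ => 1 < cap
  | .le, _, _ => 1 < cap
  | .eq, _, _ => 1 < cap

/-- A sufficient condition for an expression to have a value. -/
def Expr.Safe (M : Machine) (s : State) : Expr → Prop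
  | .lit k => k < M.cap
  | .var _ => True
  | .get _ e => e.Safe M s ∧ e.val s < M.len
  | .bin o e₁ e₂ => e₁.Safe M s ∧ e₂.Safe M s ∧ o.Fits M.cap (e₁.val s) (e₂.val s)

theorem Op.Fits.apply_lt {cap : ℕ} {o : Op} {a b : ℕ} (h : o.Fits cap a b) :
    o.apply a b < cap := by
  cases o <;> simp only [Op.Fits, Op.apply] at *
  · exact h
  · omega
  · exact h
  · exact lt_of_le_of_lt (Nat.div_le_self _ _) h
  · exact lt_of_le_of_lt (Nat.mod_le _ _) h
  all_goals split_ifs <;> omega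

theorem Expr.Safe.eval_eq {M : Machine} {s : State} {e : Expr} (h : e.Safe M s) :
    e.eval M s = some (e.val s) := by
  induction e with
  | lit k => simpa [Expr.eval, Expr.val, Expr.Safe] using h
  | var x => rfl
  | get a e ih => simp [Expr.eval, Expr.val, ih h.1, h.2]
  | bin o e₁ e₂ ih₁ ih₂ => simp [Expr.eval, Expr.val, ih₁ h.1, ih₂ h.2.1, h.2.2.apply_lt]

/-- Started in `s`, the program `p` halts after at most `t` steps in a state with the property
`Q`. -/
def Run (M : Machine) (p : Prog) (s : State) (t : ℕ) (Q : State → Prop) : Prop :=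
  ∃ t' s', Exec M p s t' s' ∧ t' ≤ t ∧ Q s'

theorem Run.imp {M : Machine} {p : Prog} {s : State} {t t' : ℕ} {Q Q' : State → Prop}
    (h : Run M p s t Q) (ht : t ≤ t') (hQ : ∀ s', Q s' → Q' s') : Run M p s t' Q' := by
  obtain ⟨u, s', he, hu, hq⟩ := h
  exact ⟨u, s', he, hu.trans ht, hQ _ hq⟩

theorem Run.seq {M : Machine} {p q : Prog} {s : State} {t₁ t₂ t : ℕ} {Q : State → Prop}
    (h : Run M p s t₁ fun s₁ => Run M q s₁ t₂ Q) (ht : t₁ + t₂ ≤ t) :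
    Run M (.seq p q) s t Q := by
  obtain ⟨u, s', he, hu, u', s'', he', hu', hq⟩ := h
  exact ⟨u + u', s'', .seq _ _ _ _ _ _ _ he he', by omega, hq⟩

theorem Run.assign {M : Machine} {x : ℕ} {e : Expr} {s : State} {t : ℕ} {Q : State → Prop}
    (he : e.Safe M s) (h : Q (s.set x (e.val s))) (ht : e.cost + 1 ≤ t) :
    Run M (.assign x e) s t Q :=
  ⟨_, _, .assign s x e _ he.eval_eq, ht, h⟩

/-- Weakest preconditions of loop-free programs. -/
def Prog.wp (M : Machine) : Prog → (State → Prop) → State → Prop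
  | .skip, Q, s => Q s
  | .assign x e, Q, s => e.Safe M s ∧ Q (s.set x (e.val s))
  | .store a i e, Q, s => i.Safe M s ∧ i.val s < M.len ∧ e.Safe M s ∧
      Q (s.put a (i.val s) (e.val s))
  | .seq p q, Q, s => p.wp M (q.wp M Q) s
  | .ite e p q, Q, s => e.Safe M s ∧ (e.val s ≠ 0 → p.wp M Q s) ∧ (e.val s = 0 → q.wp M Q s)
  | .while _ _, _, _ => False

/-- An upper bound on the running time of loop-free programs. -/
def Prog.cost : Prog → ℕ
  | .skip => 1
  | .assign _ e => e.cost + 1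
  | .store _ i e => i.cost + e.cost + 1
  | .seq p q => p.cost + q.cost
  | .ite e p q => e.cost + 1 + (p.cost + q.cost)
  | .while _ _ => 0

theorem Prog.wp.run {M : Machine} {p : Prog} {Q : State → Prop} {s : State} (h : p.wp M Q s) :
    Run M p s p.cost Q := by
  induction p generalizing Q s with
  | skip => exact ⟨_, _, .skip s, le_rfl, h⟩
  | assign x e => exact ⟨_, _, .assign s x e _ h.1.eval_eq, le_rfl, h.2⟩
  | store a i e =>
    exact ⟨_, _, .store s a i e _ _ h.1.eval_eq h.2.1 h.2.2.1.eval_eq, le_rfl, h.2.2.2⟩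
  | seq p q ihp ihq => exact Run.seq ((ihp h).imp le_rfl fun s' h' => ihq h') le_rfl
  | ite e p q ihp ihq =>
    obtain ⟨h₀, h₁, h₂⟩ := h
    by_cases hv : e.val s = 0
    · obtain ⟨u, s', he, hu, hq⟩ := ihq (h₂ hv)
      exact ⟨_, _, .iteFalse e p q s s' u (hv ▸ h₀.eval_eq) he, by simp only [Prog.cost]; omega, hq⟩
    · obtain ⟨u, s', he, hu, hq⟩ := ihp (h₁ hv)
      exact ⟨_, _, .iteTrue e p q s s' _ u h₀.eval_eq hv he, by simp only [Prog.cost]; omega, hq⟩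
  | _ => exact h.elim

/-! ### Frames -/

/-- Boolean-valued, so that for a concrete program the condition of not writing a name is closed by
`rfl`. -/
def Prog.writesVar : Prog → ℕ → Bool
  | .assign x _, y => x == y
  | .seq p q, y => p.writesVar y || q.writesVar y
  | .ite _ p q, y => p.writesVar y || q.writesVar y
  | .while _ p, y => p.writesVar y
  | _, _ => false

def Prog.writesArr : Prog → ℕ → Bool
  | .store a _ _, b => a == b
  | .seq p q, y => p.writesArr y || q.writesArr y
  | .ite _ p q, y => p.writesArr y || q.writesArr y
  | .while _ p, y => p.writesArr y
  | _, _ => false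

/-- `s'` agrees with `s` on everything that `p` does not write. -/
structure Frame (p : Prog) (s s' : State) : Prop where
  vars : ∀ x, p.writesVar x = false → s'.vars x = s.vars x
  arr : ∀ a, p.writesArr a = false → s'.arr a = s.arr a

theorem Frame.refl (p : Prog) (s : State) : Frame p s s := ⟨fun _ _ => rfl, fun _ _ => rfl⟩

theorem Frame.trans {p : Prog} {s s' s'' : State} (h : Frame p s s') (h' : Frame p s' s'') :
    Frame p s s'' :=
  ⟨fun x hx => (h'.vars x hx).trans (h.vars x hx), fun a ha => (h'.arr a ha).trans (h.arr a ha)⟩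

theorem Frame.mono {p q : Prog} {s s' : State} (h : Frame p s s')
    (hv : ∀ x, q.writesVar x = false → p.writesVar x = false)
    (ha : ∀ a, q.writesArr a = false → p.writesArr a = false) : Frame q s s' :=
  ⟨fun x hx => h.vars x (hv x hx), fun a hx => h.arr a (ha a hx)⟩

theorem Exec.frame {M : Machine} {p : Prog} {s s' : State} {t : ℕ} (h : Exec M p s t s') :
    Frame p s s' := by
  induction h with
  | skip s => exact Frame.refl _ _
  | assign s x e v hv =>
    refine ⟨fun y hy => ?_, fun _ _ => rfl⟩
    simp only [Prog.writesVar, beq_eq_false_iff_ne] at hy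
    simp [Ne.symm hy]
  | store s a i e j v hj hlen hv =>
    refine ⟨fun _ _ => rfl, fun y hy => ?_⟩
    simp only [Prog.writesArr, beq_eq_false_iff_ne] at hy
    simp [Ne.symm hy]
  | seq p q s s₁ s₂ t₁ t₂ hp hq ihp ihq =>
    refine Frame.trans (ihp.mono ?_ ?_) (ihq.mono ?_ ?_) <;>
      simp +contextual [Prog.writesVar, Prog.writesArr]
  | iteTrue e p q s s₁ v t he hv hp ih =>
    refine ih.mono ?_ ?_ <;> simp +contextual [Prog.writesVar, Prog.writesArr]
  | iteFalse e p q s s₁ t he hq ih =>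
    refine ih.mono ?_ ?_ <;> simp +contextual [Prog.writesVar, Prog.writesArr]
  | whileTrue e p s s₁ s₂ v t₁ t₂ he hv hp hw ihp ihw =>
    exact Frame.trans (ihp.mono (fun x hx => hx) fun x hx => hx) ihw
  | whileFalse e p s he => exact Frame.refl _ _

theorem Run.frame {M : Machine} {p : Prog} {s : State} {t : ℕ} {Q : State → Prop}
    (h : Run M p s t Q) : Run M p s t fun s' => Q s' ∧ Frame p s s' := by
  obtain ⟨u, s', he, hu, hq⟩ := h
  exact ⟨u, s', he, hu, hq, he.frame⟩

/-- Sequential composition, remembering what the first program does not change. -/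
theorem Run.seqFrame {M : Machine} {p q : Prog} {s : State} {t₁ t : ℕ} {P Q : State → Prop}
    (t₂ : ℕ) (h : Run M p s t₁ P)
    (h' : ∀ s₁, P s₁ → Frame p s s₁ → Run M q s₁ t₂ Q) (ht : t₁ + t₂ ≤ t) :
    Run M (.seq p q) s t Q :=
  Run.seq (h.frame.imp le_rfl fun s₁ hs => h' s₁ hs.1 hs.2) ht

/-! ### Loops -/

/-- Started in `s`, the program `p` halts after `t` steps in a state `s'` with `Q t s'`. -/
def RunT (M : Machine) (p : Prog) (s : State) (Q : ℕ → State → Prop) : Prop :=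
  ∃ t s', Exec M p s t s' ∧ Q t s'

theorem Run.toRunT {M : Machine} {p : Prog} {s : State} {t : ℕ} {P : State → Prop}
    {Q : ℕ → State → Prop} (h : Run M p s t P)
    (hQ : ∀ u s', u ≤ t → P s' → Frame p s s' → Q u s') : RunT M p s Q := by
  obtain ⟨u, s', he, hu, hp⟩ := h
  exact ⟨u, s', he, hQ u s' hu hp he.frame⟩

theorem RunT.seq {M : Machine} {p q : Prog} {s : State} {Q : ℕ → State → Prop}
    (h : RunT M p s fun t₁ s₁ => RunT M q s₁ fun t₂ s₂ => Q (t₁ + t₂) s₂) :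
    RunT M (.seq p q) s Q := by
  obtain ⟨u, s', he, u', s'', he', hq⟩ := h
  exact ⟨u + u', s'', .seq _ _ _ _ _ _ _ he he', hq⟩

theorem RunT.ite {M : Machine} {e : Expr} {p q : Prog} {s : State} {Q : ℕ → State → Prop}
    (he : e.Safe M s)
    (hp : e.val s ≠ 0 → RunT M p s fun t s' => Q (e.cost + 1 + t) s')
    (hq : e.val s = 0 → RunT M q s fun t s' => Q (e.cost + 1 + t) s') :
    RunT M (.ite e p q) s Q := by
  by_cases hv : e.val s = 0
  · obtain ⟨u, s', hx, h⟩ := hq hv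
    exact ⟨_, s', .iteFalse e p q s s' u (hv ▸ he.eval_eq) hx, h⟩
  · obtain ⟨u, s', hx, h⟩ := hp hv
    exact ⟨_, s', .iteTrue e p q s s' _ u he.eval_eq hv hx, h⟩

theorem RunT.frame {M : Machine} {p : Prog} {s : State} {Q : ℕ → State → Prop}
    (h : RunT M p s Q) : RunT M p s fun t s' => Q t s' ∧ Frame p s s' := by
  obtain ⟨u, s', he, hq⟩ := h
  exact ⟨u, s', he, hq, he.frame⟩

theorem RunT.imp {M : Machine} {p : Prog} {s : State} {Q Q' : ℕ → State → Prop}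
    (h : RunT M p s Q) (hQ : ∀ t s', Q t s' → Q' t s') : RunT M p s Q' := by
  obtain ⟨u, s', he, hq⟩ := h
  exact ⟨u, s', he, hQ _ _ hq⟩

/-- A loop whose running time is paid for by the potential `μ`. -/
theorem RunT.loop {M : Machine} {e : Expr} {p : Prog} (I : State → Prop) (μ : State → ℕ)
    {s₀ : State} (hI : I s₀)
    (he : ∀ s, I s → Frame p s₀ s → e.Safe M s)
    (hp : ∀ s, I s → Frame p s₀ s → e.val s ≠ 0 →
      RunT M p s fun t s' => I s' ∧ t + (e.cost + 1) + μ s' ≤ μ s) :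
    RunT M (.while e p) s₀ fun t s' => (I s' ∧ e.val s' = 0) ∧
      t + μ s' ≤ μ s₀ + (e.cost + 1) := by
  suffices H : ∀ k s, I s → Frame p s₀ s → μ s ≤ k →
      RunT M (.while e p) s fun t s' => (I s' ∧ e.val s' = 0) ∧
        t + μ s' ≤ μ s + (e.cost + 1) from
    H _ s₀ hI (Frame.refl _ _) le_rfl
  intro k
  induction k with
  | zero =>
    intro s hs hF hμ
    by_cases hv : e.val s = 0
    · exact ⟨_, _, .whileFalse e p s (hv ▸ (he s hs hF).eval_eq), ⟨hs, hv⟩, by omega⟩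
    -- Every round costs at least one step, so a potential of `0` leaves no room for a round.
    · obtain ⟨t, s', -, -, h⟩ := hp s hs hF hv
      omega
  | succ k ih =>
    intro s hs hF hμ
    by_cases hv : e.val s = 0
    · exact ⟨_, _, .whileFalse e p s (hv ▸ (he s hs hF).eval_eq), ⟨hs, hv⟩, by omega⟩
    · obtain ⟨t, s', hx, hI', h⟩ := hp s hs hF hv
      obtain ⟨u', s'', hx', hq, hu'⟩ := ih s' hI' (hF.trans hx.frame) (by omega)
      exact ⟨_, _, .whileTrue e p s s' s'' _ t u' (he s hs hF).eval_eq hv hx hx', hq, by omega⟩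

theorem Run.loop {M : Machine} {e : Expr} {p : Prog} (I : State → Prop) (μ : State → ℕ)
    {s₀ : State} (hI : I s₀)
    (he : ∀ s, I s → Frame p s₀ s → e.Safe M s)
    (hp : ∀ s, I s → Frame p s₀ s → e.val s ≠ 0 →
      ∃ t, Run M p s t fun s' => I s' ∧ t + (e.cost + 1) + μ s' ≤ μ s) :
    Run M (.while e p) s₀ (μ s₀ + (e.cost + 1)) fun s' => I s' ∧ e.val s' = 0 := by
  obtain ⟨t, s', hx, hq, ht⟩ := RunT.loop I μ hI he fun s hs hF hv => by
    obtain ⟨t, u, s', hx, hu, hI', h⟩ := hp s hs hF hv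
    exact ⟨u, s', hx, hI', by omega⟩
  exact ⟨t, s', hx, by omega, hq⟩

/-- A counting loop with a potential. -/
theorem RunT.count {M : Machine} {p : Prog} {x y : ℕ} (a b : ℕ) (I : ℕ → State → Prop)
    (μ : State → ℕ) {s₀ : State} (hx : s₀.vars x = a) (hy : s₀.vars y = b) (hab : a ≤ b)
    (hI : I a s₀) (hw : p.writesVar x = false) (hw' : p.writesVar y = false) (hxy : x ≠ y)
    (hcap : b < M.cap) (hcap1 : 1 < M.cap)
    (hp : ∀ k s, a ≤ k → k < b → I k s → s.vars x = k →
      Frame (.seq p (.assign x (.bin .add (.var x) (.lit 1)))) s₀ s →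
      RunT M p s fun t s' => I (k + 1) (s'.set x (k + 1)) ∧ t + 8 + μ (s'.set x (k + 1)) ≤ μ s) :
    Run M (.while (.bin .lt (.var x) (.var y))
      (.seq p (.assign x (.bin .add (.var x) (.lit 1))))) s₀ (μ s₀ + 4) (I b) := by
  have hyF : ∀ s, Frame (.seq p (.assign x (.bin .add (.var x) (.lit 1)))) s₀ s →
      s.vars y = b := fun s hF => by
    rw [hF.vars y (by simp [Prog.writesVar, hw', hxy]), hy]
  obtain ⟨t, s', hex, ⟨⟨h1, h2, h3⟩, h4⟩, ht⟩ := RunT.loop (M := M)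
    (e := .bin .lt (.var x) (.var y)) (p := .seq p (.assign x (.bin .add (.var x) (.lit 1))))
    (fun s => I (s.vars x) s ∧ a ≤ s.vars x ∧ s.vars x ≤ b) μ (s₀ := s₀)
    ⟨hx ▸ hI, by omega, by omega⟩
    (fun s hs hF => ⟨trivial, trivial, hcap1⟩) (by
      rintro s ⟨h1, h2, h3⟩ hF hv
      have hlt : s.vars x < b := by
        simpa [Expr.val, Op.apply, hyF s hF] using hv
      -- The surcharge of `8` per round is `4` for the loop test and `4` for the increment.
      refine RunT.seq ((hp _ s h2 hlt h1 rfl hF).frame.imp ?_)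
      rintro t s₁ ⟨⟨hI₁, ht⟩, hF₁⟩
      have e₁ : s₁.vars x = s.vars x := hF₁.vars x hw
      refine ⟨_, _, .assign s₁ x _ (s.vars x + 1) ?_, ?_⟩
      · have hS : (Expr.bin .add (.var x) (.lit 1)).Safe M s₁ := by
          simp only [Expr.Safe, Op.Fits, Expr.val, e₁]
          exact ⟨trivial, hcap1, by omega⟩
        rw [hS.eval_eq]; simp [Expr.val, Op.apply, e₁]
      · refine ⟨⟨?_, ?_, ?_⟩, ?_⟩
        · simpa [State.set] using hI₁
        · simp; omega
        · simp; omega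
        · simp only [Expr.cost]; simp only [State.set] at ht; omega)
  have hF := hex.frame
  have : s'.vars x = b := by
    have h5 : b ≤ s'.vars x := by
      simpa [Expr.val, Op.apply, hyF s' ⟨hF.vars, hF.arr⟩] using h4
    omega
  exact ⟨t, s', hex, by simp only [Expr.cost] at ht; omega, this ▸ h1⟩

/-- The loop `while e do { p; x ← x + 1 }`, with `x` running from `a` to `b - 1`. -/
theorem Run.count {M : Machine} {e : Expr} {p : Prog} {x : ℕ} (a b c : ℕ)
    (I : ℕ → State → Prop) {s₀ : State} (hx : s₀.vars x = a) (hab : a ≤ b) (hI : I a s₀)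
    (hw : p.writesVar x = false) (hcap : b < M.cap) (hcap1 : 1 < M.cap)
    (he : ∀ k s, a ≤ k → k ≤ b → I k s → s.vars x = k →
      Frame (.seq p (.assign x (.bin .add (.var x) (.lit 1)))) s₀ s →
      e.Safe M s ∧ (e.val s ≠ 0 ↔ k < b))
    (hp : ∀ k s, a ≤ k → k < b → I k s → s.vars x = k →
      Frame (.seq p (.assign x (.bin .add (.var x) (.lit 1)))) s₀ s →
      Run M p s c fun s' => I (k + 1) (s'.set x (k + 1))) :
    Run M (.while e (.seq p (.assign x (.bin .add (.var x) (.lit 1))))) s₀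
      ((b - a) * (c + e.cost + 5) + (e.cost + 1)) fun s' => I b s' ∧ s'.vars x = b := by
  have key := Run.loop (M := M) (e := e)
    (p := .seq p (.assign x (.bin .add (.var x) (.lit 1))))
    (fun s => I (s.vars x) s ∧ a ≤ s.vars x ∧ s.vars x ≤ b)
    (fun s => (b - s.vars x) * (c + e.cost + 5)) (s₀ := s₀)
    ⟨hx ▸ hI, by omega, by omega⟩
    (fun s hs hF => (he _ s hs.2.1 hs.2.2 hs.1 rfl hF).1) ?_
  · rw [hx] at key
    refine key.frame.imp le_rfl ?_
    rintro s' ⟨⟨⟨h1, h2, h3⟩, h4⟩, hF⟩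
    have : s'.vars x = b := by
      by_contra hne
      exact ((he _ s' h2 h3 h1 rfl ⟨hF.vars, hF.arr⟩).2.2 (by omega)) h4
    exact ⟨this ▸ h1, this⟩
  · rintro s ⟨h1, h2, h3⟩ hF hv
    have hlt := (he _ s h2 h3 h1 rfl hF).2.1 hv
    refine ⟨c + 4, Run.seqFrame 4 (hp _ s h2 hlt h1 rfl hF) (fun s₁ h₁ hF₁ => ?_) le_rfl⟩
    have e₁ : s₁.vars x = s.vars x := hF₁.vars x hw
    refine Run.assign ?_ ?_ (by simp [Expr.cost])
    · simp only [Expr.Safe, Op.Fits, Expr.val, e₁]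
      exact ⟨trivial, hcap1, by omega⟩
    · have hz : (Expr.bin .add (.var x) (.lit 1)).val s₁ = s.vars x + 1 := by
        simp [Expr.val, Op.apply, e₁]
      rw [hz]
      refine ⟨⟨by simpa using h₁, by simp; omega, by simp; omega⟩, ?_⟩
      simp only [State.set_vars, if_true]
      have : b - s.vars x = (b - (s.vars x + 1)) + 1 := by omega
      rw [this, add_mul]; omega

/-- `for x = lo, …, hi - 1 do p`. -/
def Prog.forLt (x : ℕ) (lo : Expr) (hi : ℕ) (p : Prog) : Prog :=
  .seq (.assign x lo)
    (.while (.bin .lt (.var x) (.var hi)) (.seq p (.assign x (.bin .add (.var x) (.lit 1)))))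

/-- The loop `for x = 0, …, b - 1 do p`, where `b` is the value of the variable `y`. -/
theorem Run.forLt {M : Machine} {p : Prog} {x y : ℕ} (b c : ℕ) (I : ℕ → State → Prop)
    {s₀ : State} (hI : I 0 (s₀.set x 0)) (hb : s₀.vars y = b)
    (hw : p.writesVar x = false) (hy : p.writesVar y = false) (hxy : x ≠ y)
    (hcap : b < M.cap) (hcap1 : 1 < M.cap)
    (hp : ∀ k s, k < b → I k s → s.vars x = k →
      Frame (.forLt x (.lit 0) y p) s₀ s →
      Run M p s c fun s' => I (k + 1) (s'.set x (k + 1))) :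
    Run M (.forLt x (.lit 0) y p) s₀ (b * (c + 8) + 6) fun s' => I b s' := by
  refine Run.seq (t₁ := 2) (t₂ := b * (c + 8) + 4) ?_ (by omega)
  refine Run.assign (by simp only [Expr.Safe]; omega) ?_ (by simp [Expr.cost])
  refine (Run.count 0 b c I (by simp [Expr.val]) (Nat.zero_le _) (by simpa [Expr.val] using hI)
    hw hcap hcap1 ?_ ?_).imp ?_ fun s h => h.1
  · intro k s _ hk hIk hxk hF
    have h1 : s.vars y = b := by
      rw [hF.vars y (by simp [Prog.writesVar, hy, hxy]), State.set_vars, if_neg hxy.symm, hb]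
    simp [Expr.Safe, Expr.val, Op.Fits, Op.apply, hxk, h1, hcap1]
  · intro k s _ hk hIk hxk hF
    refine hp k s hk hIk hxk ⟨fun z hz => ?_, fun z hz => ?_⟩
    · simp only [Prog.forLt, Prog.writesVar, Bool.or_eq_false_iff, beq_eq_false_iff_ne] at hz
      rw [hF.vars z (by simp [Prog.writesVar, hz]), State.set_vars, if_neg (Ne.symm hz.1)]
    · simp only [Prog.forLt, Prog.writesArr, Bool.or_eq_false_iff] at hz
      rw [hF.arr z (by simp [Prog.writesArr, hz])]; rfl
  · simp only [Expr.cost, Nat.sub_zero, add_assoc]; norm_num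

end Suffixient

namespace Suffixient

/-! ### Suffixes of integer strings

A string of length `m` is represented by a function `X : ℕ → ℕ` with positive values below `m` and
value `0` from `m` on. Its suffixes start at `0, …, m`. -/

/-- The bound `m + 1` on the letters leaves room for reduced strings, whose names may exceed the
number of sample positions by one. -/
structure IsStr (m : ℕ) (X : ℕ → ℕ) : Prop where
  pos : ∀ p < m, 1 ≤ X p
  le : ∀ p, X p ≤ m + 1
  zero : ∀ p, m ≤ p → X p = 0

/-- The suffixes at `p` and `q` have the same first `k` letters. -/
def Agree (X : ℕ → ℕ) (k p q : ℕ) : Prop := ∀ j < k, X (p + j) = X (q + j)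

/-- The suffix at `p` is lexicographically smaller than the suffix at `q`. -/
def SLt (X : ℕ → ℕ) (p q : ℕ) : Prop := ∃ k, Agree X k p q ∧ X (p + k) < X (q + k)

theorem Agree.symm {X : ℕ → ℕ} {k p q : ℕ} (h : Agree X k p q) : Agree X k q p :=
  fun j hj => (h j hj).symm

theorem Agree.trans {X : ℕ → ℕ} {k p q r : ℕ} (h : Agree X k p q) (h' : Agree X k q r) :
    Agree X k p r :=
  fun j hj => (h j hj).trans (h' j hj)

theorem Agree.mono {X : ℕ → ℕ} {k l p q : ℕ} (h : Agree X k p q) (hl : l ≤ k) : Agree X l p q :=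
  fun j hj => h j (hj.trans_le hl)

theorem agree_succ {X : ℕ → ℕ} {k p q : ℕ} :
    Agree X (k + 1) p q ↔ X p = X q ∧ Agree X k (p + 1) (q + 1) := by
  constructor
  · intro h
    refine ⟨by simpa using h 0 (by omega), fun j hj => ?_⟩
    have := h (j + 1) (by omega)
    rwa [show p + (j + 1) = p + 1 + j by omega, show q + (j + 1) = q + 1 + j by omega] at this
  · rintro ⟨h0, h⟩ j hj
    rcases j with _ | j
    · simpa using h0
    · have := h j (by omega)
      rwa [show p + (j + 1) = p + 1 + j by omega, show q + (j + 1) = q + 1 + j by omega]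

theorem agree_zero {X : ℕ → ℕ} {p q : ℕ} : Agree X 0 p q := fun _ hj => absurd hj (by omega)

theorem sLt_cons {X : ℕ → ℕ} {p q : ℕ} :
    SLt X p q ↔ X p < X q ∨ X p = X q ∧ SLt X (p + 1) (q + 1) := by
  constructor
  · rintro ⟨k, h, hk⟩
    rcases k with _ | k
    · exact Or.inl (by simpa using hk)
    · obtain ⟨h0, h⟩ := agree_succ.1 h
      refine Or.inr ⟨h0, k, h, ?_⟩
      rwa [show p + 1 + k = p + (k + 1) by omega, show q + 1 + k = q + (k + 1) by omega]
  · rintro (h | ⟨h0, k, h, hk⟩)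
    · exact ⟨0, agree_zero, by simpa using h⟩
    · refine ⟨k + 1, agree_succ.2 ⟨h0, h⟩, ?_⟩
      rwa [show p + (k + 1) = p + 1 + k by omega, show q + (k + 1) = q + 1 + k by omega]

theorem sLt_irrefl {X : ℕ → ℕ} {p : ℕ} : ¬ SLt X p p := by
  rintro ⟨k, _, h⟩; exact lt_irrefl _ h

theorem SLt.trans {X : ℕ → ℕ} {p q r : ℕ} (h : SLt X p q) (h' : SLt X q r) : SLt X p r := by
  obtain ⟨k, hk, hk'⟩ := h
  obtain ⟨l, hl, hl'⟩ := h'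
  rcases lt_trichotomy k l with h | h | h
  · exact ⟨k, hk.trans (hl.mono h.le), (hl k h) ▸ hk'⟩
  · subst h; exact ⟨k, hk.trans hl, hk'.trans hl'⟩
  · exact ⟨l, (hk.mono h.le).trans hl, (hk l h).symm ▸ hl'⟩

theorem SLt.asymm {X : ℕ → ℕ} {p q : ℕ} (h : SLt X p q) : ¬ SLt X q p :=
  fun h' => sLt_irrefl (h.trans h')

/-- A suffix between two others cannot leave their common prefix: at the first deviation it would be
above `a` and below `c`, where `a` and `c` have the same letter. -/
theorem Agree.of_sLt_of_sLt {X : ℕ → ℕ} {k a b c : ℕ} (h : Agree X k a c) (hab : SLt X a b)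
    (hbc : SLt X b c) : Agree X k a b := by
  obtain ⟨l, hl, hl'⟩ := hab
  obtain ⟨l', hm, hm'⟩ := hbc
  by_cases hk : k ≤ l
  · exact hl.mono hk
  · exfalso
    have e := h l (by omega)
    rcases lt_trichotomy l l' with h1 | h1 | h1
    · have := hm l h1; omega
    · subst h1; omega
    · have := hl l' h1
      have := h l' (by omega)
      omega

/-- The `0` at the end acts as a terminator: where the shorter suffix ends, the longer one still has
a positive letter. -/
theorem IsStr.agree_le {m : ℕ} {X : ℕ → ℕ} (hX : IsStr m X) {k p q : ℕ} (hp : p ≤ m) (hq : q ≤ m)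
    (hpq : p ≠ q) (h : Agree X k p q) : p + k ≤ m ∧ q + k ≤ m := by
  rcases lt_or_gt_of_ne hpq with hlt | hlt
  · by_cases hk : m - q < k
    · have := h _ hk
      have h1 := hX.pos (p + (m - q)) (by omega)
      have h2 := hX.zero (q + (m - q)) (by omega)
      omega
    · omega
  · by_cases hk : m - p < k
    · have := h _ hk
      have h1 := hX.pos (q + (m - p)) (by omega)
      have h2 := hX.zero (p + (m - p)) (by omega)
      omega
    · omega

theorem IsStr.exists_mismatch {m : ℕ} {X : ℕ → ℕ} (hX : IsStr m X) {p q : ℕ} (hp : p ≤ m)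
    (hq : q ≤ m) (hpq : p ≠ q) : ∃ k, Agree X k p q ∧ X (p + k) ≠ X (q + k) := by
  by_contra hcon
  push Not at hcon
  have : ∀ k, Agree X k p q := by
    intro k
    induction k with
    | zero => exact agree_zero
    | succ k ih =>
      intro j hj
      rcases Nat.lt_succ_iff_lt_or_eq.1 hj with h | h
      · exact ih j h
      · exact h ▸ hcon k ih
  have := (hX.agree_le hp hq hpq (this (m + 1))).1
  omega

theorem IsStr.sLt_or {m : ℕ} {X : ℕ → ℕ} (hX : IsStr m X) {p q : ℕ} (hp : p ≤ m)
    (hq : q ≤ m) (hpq : p ≠ q) : SLt X p q ∨ SLt X q p := by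
  obtain ⟨k, h, hk⟩ := hX.exists_mismatch hp hq hpq
  rcases lt_or_gt_of_ne hk with h' | h'
  · exact Or.inl ⟨k, h, h'⟩
  · exact Or.inr ⟨k, h.symm, h'⟩

theorem IsStr.sLt_length {m : ℕ} {X : ℕ → ℕ} (hX : IsStr m X) {p : ℕ} (hp : p < m) :
    SLt X m p :=
  ⟨0, agree_zero, by have := hX.pos p hp; have := hX.zero m le_rfl; simp; omega⟩

/-- `R` ranks the suffixes of `X`, the empty one included. -/
structure IsRank (m : ℕ) (X R : ℕ → ℕ) : Prop where
  le : ∀ p ≤ m, R p ≤ m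
  lt_iff : ∀ p ≤ m, ∀ q ≤ m, (R p < R q ↔ SLt X p q)

theorem IsRank.inj {m : ℕ} {X R : ℕ → ℕ} (hX : IsStr m X) (hR : IsRank m X R) {p q : ℕ}
    (hp : p ≤ m) (hq : q ≤ m) (h : R p = R q) : p = q := by
  by_contra hne
  rcases hX.sLt_or hp hq hne with h' | h'
  · have := (hR.lt_iff p hp q hq).2 h'; omega
  · have := (hR.lt_iff q hq p hp).2 h'; omega

/-- An injective map of `{0, …, k - 1}` into itself is surjective. -/
theorem exists_eq_of_injOn_lt {k : ℕ} {f : ℕ → ℕ} (hf : ∀ i < k, f i < k)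
    (hinj : ∀ i < k, ∀ j < k, f i = f j → i = j) {r : ℕ} (hr : r < k) : ∃ i < k, f i = r := by
  have h := Finset.surjOn_of_injOn_of_card_le (s := Finset.range k) (t := Finset.range k) f
    (fun i hi => by simpa using hf i (by simpa using hi))
    (fun i hi j hj h => hinj i (by simpa using hi) j (by simpa using hj) h) le_rfl
  obtain ⟨i, hi, e⟩ := h (show r ∈ (Finset.range k : Set ℕ) by simpa using hr)
  exact ⟨i, by simpa using hi, e⟩

theorem IsRank.surj {m : ℕ} {X R : ℕ → ℕ} (hX : IsStr m X) (hR : IsRank m X R) {r : ℕ}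
    (hr : r ≤ m) : ∃ p ≤ m, R p = r := by
  obtain ⟨i, hi, e⟩ := exists_eq_of_injOn_lt (k := m + 1) (f := R)
    (fun i hi => by have := hR.le i (by omega); omega)
    (fun i hi j hj h => hR.inj hX (by omega) (by omega) h) (show r < m + 1 by omega)
  exact ⟨i, by omega, e⟩

/-- The empty suffix takes rank `0`, so the nonempty suffixes have the ranks `1, …, m`, the indices
of a suffix array counted from `1`. -/
theorem IsRank.length {m : ℕ} {X R : ℕ → ℕ} (hX : IsStr m X) (hR : IsRank m X R) : R m = 0 := by
  obtain ⟨p, hp, e⟩ := hR.surj hX (Nat.zero_le m)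
  rcases hp.lt_or_eq with h | h
  · have := (hR.lt_iff m le_rfl p hp).2 (hX.sLt_length h); omega
  · exact h ▸ e

theorem IsRank.pos {m : ℕ} {X R : ℕ → ℕ} (hX : IsStr m X) (hR : IsRank m X R) {p : ℕ}
    (hp : p < m) : 1 ≤ R p := by
  have := (hR.lt_iff m le_rfl p hp.le).2 (hX.sLt_length hp); omega

/-! ### The reduction of the difference cover algorithm -/

/-- The index of the sample position `p` in the reduced string. -/
def sampleIdx (m p : ℕ) : ℕ := if p % 3 = 1 then p / 3 else (m + 2) / 3 + p / 3

/-- The sample position with index `j` in the reduced string. -/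
def samplePos (m j : ℕ) : ℕ := if j < (m + 2) / 3 then 3 * j + 1 else 3 * (j - (m + 2) / 3) + 2

/-- The empty suffix at `m` is admitted. A mismatch of two suffixes lies at places at most `m`, so
every triple up to and including the one with the mismatch then starts at a sample position. -/
def IsSample (m p : ℕ) : Prop := p ≤ m ∧ p % 3 ≠ 0

theorem samplePos_sampleIdx {m p : ℕ} (h : IsSample m p) : samplePos m (sampleIdx m p) = p := by
  obtain ⟨h1, h2⟩ := h
  unfold samplePos sampleIdx; split_ifs <;> omega

theorem sampleIdx_samplePos {m j : ℕ} : sampleIdx m (samplePos m j) = j := by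
  unfold samplePos sampleIdx; split_ifs <;> omega

theorem sampleIdx_lt {m p : ℕ} (h : IsSample m p) : sampleIdx m p < m - m / 3 := by
  obtain ⟨h1, h2⟩ := h
  unfold sampleIdx; split_ifs <;> omega

theorem isSample_samplePos {m j : ℕ} (h : j < m - m / 3) : IsSample m (samplePos m j) := by
  unfold samplePos IsSample; split_ifs <;> omega

theorem sampleIdx_add {m p i : ℕ} : sampleIdx m (p + 3 * i) = sampleIdx m p + i := by
  unfold sampleIdx; split_ifs <;> omega

def triple (X : ℕ → ℕ) (p : ℕ) : ℕ ×ₗ ℕ ×ₗ ℕ := toLex (X p, toLex (X (p + 1), X (p + 2)))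

theorem triple_lt {X : ℕ → ℕ} {p q : ℕ} : triple X p < triple X q ↔
    X p < X q ∨ X p = X q ∧ (X (p + 1) < X (q + 1) ∨
      X (p + 1) = X (q + 1) ∧ X (p + 2) < X (q + 2)) := by
  simp [triple, Prod.Lex.toLex_lt_toLex]

theorem triple_eq {X : ℕ → ℕ} {p q : ℕ} : triple X p = triple X q ↔
    X p = X q ∧ X (p + 1) = X (q + 1) ∧ X (p + 2) = X (q + 2) := by
  simp [triple]

/-- The letters of `Y` are names of the triples at the sample positions of `X`. -/
def IsNaming (m : ℕ) (X Y : ℕ → ℕ) : Prop :=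
  ∀ p q, IsSample m p → IsSample m q →
    (Y (sampleIdx m p) < Y (sampleIdx m q) ↔ triple X p < triple X q)

theorem IsNaming.eq_iff {m : ℕ} {X Y : ℕ → ℕ} (hY : IsNaming m X Y) {p q : ℕ}
    (hp : IsSample m p) (hq : IsSample m q) :
    Y (sampleIdx m p) = Y (sampleIdx m q) ↔ triple X p = triple X q := by
  have h1 := hY p q hp hq
  have h2 := hY q p hq hp
  constructor
  · intro h
    rcases lt_trichotomy (triple X p) (triple X q) with h' | h' | h'
    · have := h1.2 h'; omega
    · exact h'
    · have := h2.2 h'; omega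
  · intro h
    rw [h] at h1 h2
    have := mt h1.1 (lt_irrefl _)
    have := mt h2.1 (lt_irrefl _)
    omega

/-- Cut the common prefix into triples. Complete triples have equal names, the triple with the
mismatch has the smaller name, and the positions `p, p + 3, …` have consecutive indices in the
reduced string. Since the mismatch is at a place at most `m`, the comparison never runs into the
block of the other residue class. -/
theorem IsNaming.sLt {m : ℕ} {X Y : ℕ → ℕ} (hX : IsStr m X) (hY : IsNaming m X Y) {p q : ℕ}
    (hp : IsSample m p) (hq : IsSample m q) (h : SLt X p q) :
    SLt Y (sampleIdx m p) (sampleIdx m q) := by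
  have hpq : p ≠ q := by rintro rfl; exact sLt_irrefl h
  obtain ⟨k, hk, hlt⟩ := h
  obtain ⟨b1, b2⟩ := hX.agree_le hp.1 hq.1 hpq hk
  have hs : ∀ i ≤ k / 3, IsSample m (p + 3 * i) ∧ IsSample m (q + 3 * i) := by
    intro i hi
    have := hp.2; have := hq.2
    refine ⟨⟨by omega, by omega⟩, ⟨by omega, by omega⟩⟩
  refine ⟨k / 3, fun i hi => ?_, ?_⟩
  · rw [← sampleIdx_add, ← sampleIdx_add,
      hY.eq_iff (hs i hi.le).1 (hs i hi.le).2, triple_eq]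
    exact ⟨hk (3 * i) (by omega), hk (3 * i + 1) (by omega), hk (3 * i + 2) (by omega)⟩
  · rw [← sampleIdx_add, ← sampleIdx_add, hY _ _ (hs _ le_rfl).1 (hs _ le_rfl).2, triple_lt]
    obtain h | h | h : k = 3 * (k / 3) ∨ k = 3 * (k / 3) + 1 ∨ k = 3 * (k / 3) + 2 := by omega
    · rw [h] at hlt; exact Or.inl hlt
    · have e0 := hk (3 * (k / 3)) (by omega)
      rw [h] at hlt
      exact Or.inr ⟨e0, Or.inl hlt⟩
    · have e0 := hk (3 * (k / 3)) (by omega)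
      have e1 := hk (3 * (k / 3) + 1) (by omega)
      rw [h] at hlt
      exact Or.inr ⟨e0, Or.inr ⟨e1, hlt⟩⟩

/-- `Y` is a reduced string of `X`. -/
structure IsReduced (m : ℕ) (X Y : ℕ → ℕ) : Prop where
  str : IsStr (m - m / 3) Y
  sLt : ∀ p q, IsSample m p → IsSample m q → SLt X p q →
    SLt Y (sampleIdx m p) (sampleIdx m q)

/-- `S` orders the sample suffixes of `X`. -/
def IsSampleRank (m : ℕ) (X S : ℕ → ℕ) : Prop :=
  ∀ p q, IsSample m p → IsSample m q → (S p < S q ↔ SLt X p q)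

/-- Preservation of the order in one direction suffices, because distinct suffixes of `X` are always
comparable. -/
theorem IsReduced.isSampleRank {m : ℕ} {X Y R S : ℕ → ℕ} (hX : IsStr m X) (hY : IsReduced m X Y)
    (hR : IsRank (m - m / 3) Y R) (hS : ∀ p, IsSample m p → S p = R (sampleIdx m p)) :
    IsSampleRank m X S := by
  have key : ∀ p q, IsSample m p → IsSample m q → SLt X p q → S p < S q := by
    intro p q hp hq h
    rw [hS p hp, hS q hq, hR.lt_iff _ (sampleIdx_lt hp).le _ (sampleIdx_lt hq).le]
    exact hY.sLt p q hp hq h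
  intro p q hp hq
  refine ⟨fun h => ?_, key p q hp hq⟩
  by_cases hpq : p = q
  · subst hpq; omega
  rcases hX.sLt_or hp.1 hq.1 hpq with h' | h'
  · exact h'
  · have := key q p hq hp h'; omega

/-- From residue `0` or `1`, one step leads to a residue of the sample, and equal first letters keep
both successors within the string. -/
theorem IsSampleRank.sLt_one {m : ℕ} {X S : ℕ → ℕ} (hX : IsStr m X) (hS : IsSampleRank m X S)
    {p q : ℕ} (hp : p ≤ m) (hq : q ≤ m) (hpq : p ≠ q) (hp3 : p % 3 ≠ 2) (hq3 : q % 3 ≠ 2) :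
    SLt X p q ↔ X p < X q ∨ X p = X q ∧ S (p + 1) < S (q + 1) := by
  rw [sLt_cons]
  refine or_congr Iff.rfl (and_congr_right fun h => ?_)
  obtain ⟨h1, h2⟩ := hX.agree_le hp hq hpq (agree_succ.2 ⟨h, agree_zero⟩)
  rw [hS _ _ ⟨h1, by omega⟩ ⟨h2, by omega⟩]

/-- From residue `0` or `2`, two steps lead to a residue of the sample; one step need not. -/
theorem IsSampleRank.sLt_two {m : ℕ} {X S : ℕ → ℕ} (hX : IsStr m X) (hS : IsSampleRank m X S)
    {p q : ℕ} (hp : p ≤ m) (hq : q ≤ m) (hpq : p ≠ q) (hp3 : p % 3 ≠ 1) (hq3 : q % 3 ≠ 1) :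
    SLt X p q ↔ X p < X q ∨ X p = X q ∧ (X (p + 1) < X (q + 1) ∨
      X (p + 1) = X (q + 1) ∧ S (p + 2) < S (q + 2)) := by
  rw [sLt_cons]
  refine or_congr Iff.rfl (and_congr_right fun h => ?_)
  rw [sLt_cons]
  refine or_congr Iff.rfl (and_congr_right fun h' => ?_)
  obtain ⟨h1, h2⟩ := hX.agree_le hp hq hpq (agree_succ.2 ⟨h, agree_succ.2 ⟨h', agree_zero⟩⟩)
  rw [hS _ _ ⟨h1, by omega⟩ ⟨h2, by omega⟩]

end Suffixient

namespace Suffixient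

/-! ### Stable counting sort -/

theorem Run.forLtWp {M : Machine} {p : Prog} {x y : ℕ} (b c : ℕ) (I : ℕ → State → Prop)
    {s₀ : State} (hI : I 0 (s₀.set x 0)) (hb : s₀.vars y = b)
    (hw : p.writesVar x = false) (hy : p.writesVar y = false) (hxy : x ≠ y)
    (hcap : b < M.cap) (hcap1 : 1 < M.cap) (hc : p.cost ≤ c)
    (hp : ∀ k s, k < b → I k s → s.vars x = k →
      Frame (.forLt x (.lit 0) y p) s₀ s →
      p.wp M (fun s' => I (k + 1) (s'.set x (k + 1))) s) :
    Run M (.forLt x (.lit 0) y p) s₀ (b * (c + 8) + 6) fun s' => I b s' :=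
  Run.forLt b c I hI hb hw hy hxy hcap hcap1 fun k s hk h1 h2 h3 =>
    (hp k s hk h1 h2 h3).run.imp hc fun _ h => h

theorem count_lt_succ (g : ℕ → ℕ) (b k : ℕ) :
    Nat.count (fun j => g j < b + 1) k
      = Nat.count (fun j => g j < b) k + Nat.count (fun j => g j = b) k := by
  induction k with
  | zero => simp
  | succ k ih => simp only [Nat.count_succ, ih]; split_ifs <;> omega

theorem count_lt_mono (g : ℕ → ℕ) {b b' : ℕ} (h : b ≤ b') (k : ℕ) :
    Nat.count (fun j => g j < b) k ≤ Nat.count (fun j => g j < b') k :=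
  Nat.count_mono_left (by intro j hj; omega)

theorem count_eq_lt (g : ℕ → ℕ) {i k : ℕ} (h : i < k) :
    Nat.count (fun j => g j = g i) i < Nat.count (fun j => g j = g i) k :=
  Nat.count_strict_mono (p := fun j => g j = g i) rfl h

/-- The place of the `i`-th of `k` items with keys `g` when they are sorted stably. -/
def sortPos (g : ℕ → ℕ) (k i : ℕ) : ℕ :=
  Nat.count (fun j => g j < g i) k + Nat.count (fun j => g j = g i) i

/-- The items with key `g i` fill the places from the number of smaller keys up to the number of
keys at most `g i`. -/
theorem sortPos_lt_of_lt {g : ℕ → ℕ} {k i j : ℕ} (hi : i < k) (h : g i < g j) :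
    sortPos g k i < sortPos g k j := by
  have h1 := count_lt_succ g (g i) k
  have h2 := count_lt_mono g (show g i + 1 ≤ g j from h) k
  have h3 := count_eq_lt g hi
  unfold sortPos; omega

theorem sortPos_lt_of_eq {g : ℕ → ℕ} {k i j : ℕ} (h : g i = g j) (hij : i < j) :
    sortPos g k i < sortPos g k j := by
  have h3 := count_eq_lt g hij
  unfold sortPos
  simp only [← h]; omega

theorem sortPos_lt {g : ℕ → ℕ} {k i : ℕ} (hi : i < k) : sortPos g k i < k := by
  have h1 := count_lt_succ g (g i) k
  have h3 := count_eq_lt g hi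
  have h4 := Nat.count_le (p := fun j => g j < g i + 1) (n := k)
  unfold sortPos; omega

theorem sortPos_inj {g : ℕ → ℕ} {k i j : ℕ} (hi : i < k) (hj : j < k)
    (h : sortPos g k i = sortPos g k j) : i = j := by
  rcases lt_trichotomy (g i) (g j) with h1 | h1 | h1
  · have := sortPos_lt_of_lt hi h1; omega
  · rcases lt_trichotomy i j with h2 | h2 | h2
    · have := sortPos_lt_of_eq (k := k) h1 h2; omega
    · exact h2
    · have := sortPos_lt_of_eq (k := k) h1.symm h2; omega
  · have := sortPos_lt_of_lt hj h1; omega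

/-- `f` enumerates the numbers with the property `P` in `k` steps. -/
structure Enumerates (P : ℕ → Prop) (k : ℕ) (f : ℕ → ℕ) : Prop where
  mem : ∀ i < k, P (f i)
  surj : ∀ p, P p → ∃ i < k, f i = p
  inj : ∀ i < k, ∀ j < k, f i = f j → i = j

def SortedBy {α : Type} [LE α] (key : ℕ → α) (k : ℕ) (f : ℕ → ℕ) : Prop :=
  ∀ i j, i < j → j < k → key (f i) ≤ key (f j)

theorem Enumerates.sort {P : ℕ → Prop} {k : ℕ} {f f' g : ℕ → ℕ} (h : Enumerates P k f)
    (hf : ∀ i < k, f' (sortPos g k i) = f i) : Enumerates P k f' := by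
  have hs : ∀ r < k, ∃ i < k, sortPos g k i = r := fun r hr =>
    exists_eq_of_injOn_lt (fun i hi => sortPos_lt hi) (fun i hi j hj h => sortPos_inj hi hj h) hr
  refine ⟨fun r hr => ?_, fun p hp => ?_, fun r hr r' hr' e => ?_⟩
  · obtain ⟨i, hi, rfl⟩ := hs r hr
    exact hf i hi ▸ h.mem i hi
  · obtain ⟨i, hi, rfl⟩ := h.surj p hp
    exact ⟨_, sortPos_lt hi, hf i hi⟩
  · obtain ⟨i, hi, rfl⟩ := hs r hr
    obtain ⟨j, hj, rfl⟩ := hs r' hr'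
    rw [hf i hi, hf j hj] at e
    rw [h.inj i hi j hj e]

/-- Stability: ties of the new key keep the old order. Sorting by the last letter first therefore
ends in lexicographic order. -/
theorem SortedBy.sort {α : Type} [LinearOrder α] {key : ℕ → α} {κ : ℕ → ℕ} {k : ℕ}
    {f f' g : ℕ → ℕ} (h : SortedBy key k f) (hg : ∀ i < k, g i = κ (f i))
    (hf : ∀ i < k, f' (sortPos g k i) = f i) :
    SortedBy (fun p => toLex (κ p, key p)) k f' := by
  have hs : ∀ r < k, ∃ i < k, sortPos g k i = r := fun r hr =>
    exists_eq_of_injOn_lt (fun i hi => sortPos_lt hi) (fun i hi j hj h => sortPos_inj hi hj h) hr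
  intro r r' hrr hr'
  obtain ⟨i, hi, rfl⟩ := hs r (by omega)
  obtain ⟨j, hj, rfl⟩ := hs r' hr'
  rw [hf i hi, hf j hj, Prod.Lex.toLex_le_toLex]
  simp only [← hg i hi, ← hg j hj]
  rcases lt_trichotomy (g i) (g j) with h1 | h1 | h1
  · exact Or.inl h1
  · refine Or.inr ⟨h1, ?_⟩
    rcases lt_trichotomy i j with h2 | h2 | h2
    · exact h i j h2 hj
    · rw [h2]
    · have := sortPos_lt_of_eq (k := k) h1.symm h2; omega
  · have := sortPos_lt_of_lt hj h1; omega

/-! Variables and arrays of the subprograms. -/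

notation "xI" => (10 : ℕ)
notation "xT" => (11 : ℕ)
notation "xU" => (12 : ℕ)
notation "xAcc" => (13 : ℕ)
notation "xK" => (14 : ℕ)
notation "xB" => (15 : ℕ)
notation "aCnt" => (11 : ℕ)

/-- Sort the `xK` items in the array `src` stably by the keys `ka[src[i] + d] < xB`. -/
def countingSort (ka d src dst : ℕ) : Prog :=
  .seq (.forLt xI (.lit 0) xB (.store aCnt (.var xI) (.lit 0)))
  (.seq (.forLt xI (.lit 0) xK
    (.seq (.assign xT (.get ka (.bin .add (.get src (.var xI)) (.lit d))))
      (.store aCnt (.var xT) (.bin .add (.get aCnt (.var xT)) (.lit 1)))))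
  (.seq (.assign xAcc (.lit 0))
  (.seq (.forLt xI (.lit 0) xB
    (.seq (.assign xT (.get aCnt (.var xI)))
    (.seq (.store aCnt (.var xI) (.var xAcc))
      (.assign xAcc (.bin .add (.var xAcc) (.var xT))))))
  (.forLt xI (.lit 0) xK
    (.seq (.assign xT (.get ka (.bin .add (.get src (.var xI)) (.lit d))))
    (.seq (.assign xU (.get aCnt (.var xT)))
    (.seq (.store dst (.var xU) (.get src (.var xI)))
      (.store aCnt (.var xT) (.bin .add (.var xU) (.lit 1))))))))))

theorem countingSort_run {M : Machine} {ka d src dst : ℕ} (h1 : ka ≠ aCnt) (h2 : src ≠ aCnt)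
    (h3 : dst ≠ aCnt) (h4 : ka ≠ dst) (h5 : src ≠ dst) {s₀ : State} {k B : ℕ} {f g : ℕ → ℕ}
    (hk : s₀.vars xK = k) (hB : s₀.vars xB = B) (hd : d < M.cap) (hcap : k + B + 10 < M.cap)
    (hkl : k ≤ M.len) (hBl : B ≤ M.len) (hf : ∀ i < k, s₀.arr src i = f i)
    (hg : ∀ i < k, s₀.arr ka (f i + d) = g i)
    (hfl : ∀ i < k, f i + d < M.len ∧ f i + d < M.cap) (hgB : ∀ i < k, g i < B) :
    Run M (countingSort ka d src dst) s₀ (60 * (k + B) + 40) fun s' =>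
      ∀ i < k, s'.arr dst (sortPos g k i) = f i := by
  have hcap1 : 1 < M.cap := by omega
  refine Run.seqFrame (60 * k + 40 * B + 34) (Run.forLtWp B 3 (fun j s => ∀ b < j, s.arr aCnt b = 0)
    (by simp) hB rfl rfl (by decide) (by omega) hcap1 (by decide) ?_) ?_ (by omega)
  · intro j s hj hI hx hF
    simp only [Prog.wp, Expr.Safe, Expr.val, hx]
    refine ⟨trivial, by omega, by omega, ?_⟩
    intro b hb
    simp only [State.set_arr, State.put_arr, true_and]
    split_ifs with h
    · rfl
    · exact hI b (by omega)
  intro s₁ hs₁ hF₁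
  have src₁ : ∀ i < k, s₁.arr src i = f i := by
    intro i hi
    rw [hF₁.arr src (by simp [Prog.forLt, Prog.writesArr, h2.symm]), hf i hi]
  have ka₁ : ∀ i < k, s₁.arr ka (f i + d) = g i := by
    intro i hi
    rw [hF₁.arr ka (by simp [Prog.forLt, Prog.writesArr, h1.symm]), hg i hi]
  have k₁ : s₁.vars xK = k := by rw [hF₁.vars xK rfl, hk]
  have B₁ : s₁.vars xB = B := by rw [hF₁.vars xB rfl, hB]
  refine Run.seqFrame (30 * k + 40 * B + 28) (Run.forLtWp k 20
    (fun i s => ∀ b < B, s.arr aCnt b = Nat.count (fun j => g j = b) i)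
    (by simpa using hs₁) k₁ rfl rfl (by decide) (by omega) hcap1
    (by simp [Prog.cost, Expr.cost]) ?_) ?_ (by omega)
  · intro i s hi hI hx hF
    have e1 : s.arr src i = f i := by
      rw [hF.arr src (by simp [Prog.forLt, Prog.writesArr, h2.symm]), src₁ i hi]
    have e2 : s.arr ka (f i + d) = g i := by
      rw [hF.arr ka (by simp [Prog.forLt, Prog.writesArr, h1.symm]), ka₁ i hi]
    have e3 := hI (g i) (hgB i hi)
    have e4 : Nat.count (fun j => g j = g i) i ≤ i := Nat.count_le _
    have e5 := hfl i hi
    have e6 := hgB i hi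
    simp only [Prog.wp, Expr.Safe, Expr.val, Op.Fits, Op.apply, hx, State.set_vars, State.set_arr,
      e1, e2, e3, if_true, hd, State.put_arr, true_and]
    refine ⟨⟨⟨by omega, by omega⟩, by omega⟩, by omega, ⟨by omega, by omega, by omega⟩, ?_⟩
    intro b hb
    rw [Nat.count_succ]
    split_ifs with h h' h'
    · rw [h]
    · exact absurd h.symm h'
    · exact absurd h'.symm h
    · exact hI b hb
  intro s₂ hs₂ hF₂
  have src₂ : ∀ i < k, s₂.arr src i = f i := by
    intro i hi
    rw [hF₂.arr src (by simp [Prog.forLt, Prog.writesArr, h2.symm]), src₁ i hi]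
  have ka₂ : ∀ i < k, s₂.arr ka (f i + d) = g i := by
    intro i hi
    rw [hF₂.arr ka (by simp [Prog.forLt, Prog.writesArr, h1.symm]), ka₁ i hi]
  have k₂ : s₂.vars xK = k := by rw [hF₂.vars xK rfl, k₁]
  have B₂ : s₂.vars xB = B := by rw [hF₂.vars xB rfl, B₁]
  refine Run.seq (t₁ := 2) (t₂ := 30 * k + 40 * B + 20) ?_ (by omega)
  refine Run.assign (by simp only [Expr.Safe]; omega) ?_ (by simp [Expr.cost])
  simp only [Expr.val]
  -- Counters are turned into prefix sums one by one: those below `b` already give the first place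
  -- of their bucket, the others still hold bucket sizes.
  refine Run.seqFrame (30 * k + 6) (Run.forLtWp B 30
    (fun b s => s.vars xAcc = Nat.count (fun j => g j < b) k ∧ ∀ j < B, s.arr aCnt j =
      if j < b then Nat.count (fun i => g i < j) k else Nat.count (fun i => g i = j) k)
    (by simpa using hs₂) (by simpa using B₂) rfl rfl (by decide) (by omega) hcap1
    (by decide) ?_) ?_ (by omega)
  · rintro b s hb ⟨hacc, hI⟩ hx hF
    have e3 := hI b hb
    rw [if_neg (lt_irrefl b)] at e3
    have e4 := count_lt_succ g b k
    have e5 : Nat.count (fun j => g j < b + 1) k ≤ k := Nat.count_le _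
    simp only [Prog.wp, Expr.Safe, Expr.val, Op.Fits, Op.apply, hx, State.set_vars, State.set_arr,
      e3, if_true, State.put_arr, State.put_vars, true_and, Nat.reduceEqDiff,
      if_false, hacc]
    refine ⟨by omega, by omega, by omega, e4.symm, ?_⟩
    intro j hj
    have := hI j hj
    split_ifs with h h' h'
    · rw [h]
    · omega
    · rw [this, if_pos (by omega)]
    · rw [this, if_neg (by omega)]
  rintro s₃ ⟨-, hs₃⟩ hF₃
  have src₃ : ∀ i < k, s₃.arr src i = f i := by
    intro i hi
    rw [hF₃.arr src (by simp [Prog.forLt, Prog.writesArr, h2.symm])]; exact src₂ i hi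
  have ka₃ : ∀ i < k, s₃.arr ka (f i + d) = g i := by
    intro i hi
    rw [hF₃.arr ka (by simp [Prog.forLt, Prog.writesArr, h1.symm])]; exact ka₂ i hi
  have k₃ : s₃.vars xK = k := by rw [hF₃.vars xK rfl]; simpa using k₂
  -- The counter of `b` is the next free place of its bucket, which is `sortPos` for the next item
  -- with key `b`.
  refine (Run.forLtWp k 22
    (fun i s => (∀ b < B, s.arr aCnt b =
      Nat.count (fun j => g j < b) k + Nat.count (fun j => g j = b) i) ∧
      ∀ j < i, s.arr dst (sortPos g k j) = f j)
    ?_ k₃ rfl rfl (by decide) (by omega) hcap1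
    (by simp [Prog.cost, Expr.cost]) ?_).imp (by omega) fun s h => h.2
  · simp only [State.set_arr, Nat.count_zero, Nat.add_zero, Nat.not_lt_zero, false_imp_iff,
      imp_true_iff, and_true]
    intro b hb
    rw [hs₃ b hb, if_pos hb]
  · rintro i s hi ⟨hI, hI'⟩ hx hF
    have e1 : s.arr src i = f i := by
      rw [hF.arr src (by simp [Prog.forLt, Prog.writesArr, h2.symm, h5.symm]), src₃ i hi]
    have e2 : s.arr ka (f i + d) = g i := by
      rw [hF.arr ka (by simp [Prog.forLt, Prog.writesArr, h1.symm, h4.symm]), ka₃ i hi]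
    have e3 : s.arr aCnt (g i) = sortPos g k i := hI (g i) (hgB i hi)
    have e5 := hfl i hi
    have e6 := hgB i hi
    have e7 := sortPos_lt (g := g) hi
    simp only [Prog.wp, Expr.Safe, Expr.val, Op.Fits, Op.apply, hx, State.set_vars, State.set_arr,
      e1, e2, e3, if_true, hd, State.put_arr, State.put_vars, true_and,
      Nat.reduceEqDiff, if_false, h3, h3.symm, false_and]
    refine ⟨⟨⟨by omega, by omega⟩, by omega⟩, by omega, by omega, by omega, by omega,
      ⟨by omega, by omega⟩, ?_, ?_⟩
    · intro b hb
      rw [Nat.count_succ]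
      split_ifs with h h' h'
      · rw [h]; rfl
      · exact absurd h.symm h'
      · exact absurd h'.symm h
      · exact hI b hb
    · intro j hj
      split_ifs with h
      · rw [sortPos_inj (by omega) hi h]
      · refine hI' j ?_
        rcases Nat.lt_succ_iff_lt_or_eq.1 hj with h' | h'
        · exact h'
        · exact absurd (by rw [h']) h

end Suffixient

namespace Suffixient

/-! ### The reduction step -/

notation "xM" => (16 : ℕ)
notation "xM1" => (17 : ℕ)
notation "xK1" => (18 : ℕ)
notation "xTa" => (20 : ℕ)
notation "xTb" => (21 : ℕ)
notation "xTc" => (22 : ℕ)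
notation "xCur" => (23 : ℕ)
notation "xP" => (24 : ℕ)
notation "aX" => (12 : ℕ)
notation "aY" => (13 : ℕ)
notation "aSrc" => (14 : ℕ)
notation "aDst" => (15 : ℕ)

/-- The string `X` of length `m` is stored in `aX`. -/
structure HasStr (s : State) (m : ℕ) (X : ℕ → ℕ) : Prop where
  len : s.vars xM = m
  arr : ∀ p ≤ m + 2, s.arr aX p = X p

/-- List the sample positions in the order of their triples. -/
def sortSample : Prog :=
  .seq (.assign xM1 (.bin .sub (.var xM) (.bin .div (.var xM) (.lit 3))))
  (.seq (.assign xK1 (.bin .div (.bin .add (.var xM) (.lit 2)) (.lit 3)))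
  (.seq (.assign xK (.var xM1))
  (.seq (.assign xB (.bin .add (.var xM) (.lit 2)))
  (.seq (.forLt xI (.lit 0) xM1
    (.ite (.bin .lt (.var xI) (.var xK1))
      (.store aSrc (.var xI) (.bin .add (.bin .mul (.lit 3) (.var xI)) (.lit 1)))
      (.store aSrc (.var xI)
        (.bin .add (.bin .mul (.lit 3) (.bin .sub (.var xI) (.var xK1))) (.lit 2)))))
  (.seq (countingSort aX 2 aSrc aDst)
  (.seq (countingSort aX 1 aDst aSrc)
    (countingSort aX 0 aSrc aDst)))))))

theorem enumerates_samplePos {m : ℕ} {f : ℕ → ℕ} (hf : ∀ j < m - m / 3, f j = samplePos m j) :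
    Enumerates (IsSample m) (m - m / 3) f := by
  refine ⟨fun j hj => hf j hj ▸ isSample_samplePos hj, fun p hp => ?_, fun i hi j hj h => ?_⟩
  · exact ⟨_, sampleIdx_lt hp, by rw [hf _ (sampleIdx_lt hp), samplePos_sampleIdx hp]⟩
  · rw [hf i hi, hf j hj] at h
    rw [← sampleIdx_samplePos (m := m) (j := i), h, sampleIdx_samplePos]

theorem sortSample_run {M : Machine} {s : State} {m : ℕ} {X : ℕ → ℕ} (hs : HasStr s m X)
    (hX : IsStr m X) (hcap : 20 * m + 100 ≤ M.cap) (hlen : m + 3 ≤ M.len) :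
    Run M sortSample s (400 * m + 600) fun s' => s'.vars xM1 = m - m / 3 ∧
      s'.vars xK1 = (m + 2) / 3 ∧ Enumerates (IsSample m) (m - m / 3) (s'.arr aDst) ∧
      SortedBy (triple X) (m - m / 3) (s'.arr aDst) := by
  have hXle := hX.le
  refine Run.seq (t₁ := 6) (t₂ := 400 * m + 594) ?_ (by omega)
  refine Run.assign ?_ ?_ (by simp [Expr.cost])
  · simp only [Expr.Safe, Op.Fits, Expr.val, hs.len, true_and]; omega
  refine Run.seq (t₁ := 6) (t₂ := 400 * m + 588) ?_ (by omega)
  refine Run.assign ?_ ?_ (by simp [Expr.cost])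
  · simp only [Expr.Safe, Op.Fits, Op.apply, Expr.val, State.set_vars, Nat.reduceEqDiff, if_false,
      hs.len, true_and]; omega
  refine Run.seq (t₁ := 2) (t₂ := 400 * m + 586) ?_ (by omega)
  refine Run.assign trivial ?_ (by simp [Expr.cost])
  refine Run.seq (t₁ := 4) (t₂ := 400 * m + 582) ?_ (by omega)
  refine Run.assign ?_ ?_ (by simp [Expr.cost])
  · simp only [Expr.Safe, Op.Fits, Op.apply, Expr.val, State.set_vars, Nat.reduceEqDiff, if_false,
      hs.len, true_and]; omega
  simp only [Expr.val, Op.apply, State.set_vars, Nat.reduceEqDiff, if_false, if_true, hs.len]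
  generalize hs₀ : State.set _ _ _ = s₀
  have m₀ : s₀.vars xM1 = m - m / 3 := by simp [← hs₀]
  have k₀ : s₀.vars xK1 = (m + 2) / 3 := by simp [← hs₀]
  have K₀ : s₀.vars xK = m - m / 3 := by simp [← hs₀]
  have B₀ : s₀.vars xB = m + 2 := by simp [← hs₀]
  have X₀ : ∀ p ≤ m + 2, s₀.arr aX p = X p := by simpa [← hs₀] using hs.arr
  clear hs₀
  refine Run.seqFrame (360 * m + 576) (Run.forLtWp (m - m / 3) 32
    (fun j s => ∀ i < j, s.arr aSrc i = samplePos m i) (by simp) m₀ rfl rfl (by decide)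
    (by omega) (by omega) (by decide) ?_) ?_ (by omega)
  · intro j s hj hI hx hF
    have e1 : s.vars xK1 = (m + 2) / 3 := by rw [hF.vars xK1 rfl, k₀]
    simp only [Prog.wp, Expr.Safe, Op.Fits, Op.apply, Expr.val, hx, e1, State.set_arr,
      State.put_arr, true_and, ne_eq, ite_eq_right_iff, one_ne_zero, imp_false, not_lt, not_le]
    refine ⟨by omega, fun h => ⟨by omega, by omega, fun i hi => ?_⟩,
      fun h => ⟨by omega, by omega, fun i hi => ?_⟩⟩
    · split_ifs with h'
      · rw [h', samplePos, if_pos h]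
      · exact hI i (by omega)
    · split_ifs with h'
      · rw [h', samplePos, if_neg (by omega)]
      · exact hI i (by omega)
  intro s₁ hs₁ hF₁
  have E₁ : Enumerates (IsSample m) (m - m / 3) (s₁.arr aSrc) := enumerates_samplePos hs₁
  -- A constant key starts the accumulation: each of the three sorting passes puts one more letter
  -- in front of it, ending with the triple.
  have S₁ : SortedBy (fun _ => ()) (m - m / 3) (s₁.arr aSrc) := fun _ _ _ _ => le_rfl
  have X₁ : ∀ p ≤ m + 2, s₁.arr aX p = X p := by
    intro p hp; rw [hF₁.arr aX rfl, X₀ p hp]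
  refine Run.seqFrame (240 * m + 400) (countingSort_run (g := fun i => X (s₁.arr aSrc i + 2))
    (by decide) (by decide) (by decide) (by decide) (by decide)
    ((hF₁.vars xK rfl).trans K₀) ((hF₁.vars xB rfl).trans B₀) (by omega) (by omega) (by omega)
    (by omega) (fun i hi => rfl) (fun i hi => X₁ _ (by have := (E₁.mem i hi).1; omega))
    (fun i hi => by have := (E₁.mem i hi).1; omega)
    (fun i hi => by have := hXle (s₁.arr aSrc i + 2); omega)) ?_ (by omega)
  intro s₂ hs₂ hF₂
  have E₂ := E₁.sort hs₂
  have S₂ := S₁.sort (κ := fun p => X (p + 2)) (fun i hi => rfl) hs₂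
  have X₂ : ∀ p ≤ m + 2, s₂.arr aX p = X p := by
    intro p hp; rw [hF₂.arr aX rfl, X₁ p hp]
  refine Run.seqFrame (120 * m + 200) (countingSort_run (g := fun i => X (s₂.arr aDst i + 1))
    (by decide) (by decide) (by decide) (by decide) (by decide)
    (((hF₂.vars xK rfl).trans (hF₁.vars xK rfl)).trans K₀)
    (((hF₂.vars xB rfl).trans (hF₁.vars xB rfl)).trans B₀) (by omega) (by omega) (by omega)
    (by omega) (fun i hi => rfl) (fun i hi => X₂ _ (by have := (E₂.mem i hi).1; omega))
    (fun i hi => by have := (E₂.mem i hi).1; omega)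
    (fun i hi => by have := hXle (s₂.arr aDst i + 1); omega)) ?_ (by omega)
  intro s₃ hs₃ hF₃
  have E₃ := E₂.sort hs₃
  have S₃ := S₂.sort (κ := fun p => X (p + 1)) (fun i hi => rfl) hs₃
  have X₃ : ∀ p ≤ m + 2, s₃.arr aX p = X p := by
    intro p hp; rw [hF₃.arr aX rfl, X₂ p hp]
  refine (countingSort_run (g := fun i => X (s₃.arr aSrc i))
    (by decide) (by decide) (by decide) (by decide) (by decide)
    (((hF₃.vars xK rfl).trans ((hF₂.vars xK rfl).trans (hF₁.vars xK rfl))).trans K₀)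
    (((hF₃.vars xB rfl).trans ((hF₂.vars xB rfl).trans (hF₁.vars xB rfl))).trans B₀)
    (by omega) (by omega) (by omega)
    (by omega) (fun i hi => rfl) (fun i hi => X₃ _ (by have := (E₃.mem i hi).1; omega))
    (fun i hi => by have := (E₃.mem i hi).1; omega)
    (fun i hi => by have := hXle (s₃.arr aSrc i); omega)).frame.imp (by omega) ?_
  rintro s₄ ⟨hs₄, hF₄⟩
  have S₄ := S₃.sort (κ := fun p => X p) (fun i hi => rfl) hs₄
  refine ⟨?_, ?_, E₃.sort hs₄, fun i j hij hj => ?_⟩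
  · rw [hF₄.vars xM1 rfl, hF₃.vars xM1 rfl, hF₂.vars xM1 rfl, hF₁.vars xM1 rfl, m₀]
  · rw [hF₄.vars xK1 rfl, hF₃.vars xK1 rfl, hF₂.vars xK1 rfl, hF₁.vars xK1 rfl, k₀]
  · have := S₄ i j hij hj
    simp only [Prod.Lex.toLex_le_toLex, le_refl, and_true] at this
    rw [triple, triple, Prod.Lex.toLex_le_toLex]
    refine this.imp id (And.imp id fun h => ?_)
    rw [Prod.Lex.toLex_le_toLex]
    exact h.imp id (And.imp id fun h => le_iff_lt_or_eq.2 h)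

/-- The state of the naming loop: `i` items of the sorted sequence `t` have been named; `τ` and `cur`
are the last item and its name. -/
structure NamingInv {α : Type} [LinearOrder α] (t : ℕ → α) (k i cur : ℕ) (τ : α) (y : ℕ → ℕ) :
    Prop where
  one_le : 1 ≤ cur
  le : cur ≤ i + 1
  named : ∀ a < i, 1 ≤ y a ∧ y a ≤ cur ∧ t a ≤ τ ∧ (y a < cur ↔ t a < τ)
  lt_iff : ∀ a < i, ∀ b < i, (y a < y b ↔ t a < t b)
  rest : ∀ a, i ≤ a → a < k → τ ≤ t a

/-- As the sequence is sorted, the next item either equals `τ` and shares its name, or exceeds all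
named items and receives a fresh largest name. -/
theorem NamingInv.step {α : Type} [LinearOrder α] {t : ℕ → α} {k i cur : ℕ} {τ : α}
    {y y' : ℕ → ℕ} (h : NamingInv t k i cur τ y) (ht : ∀ a b, a < b → b < k → t a ≤ t b)
    (hi : i < k) (hy : ∀ a < i, y' a = y a)
    (hy' : t i = τ ∧ y' i = cur ∨ t i ≠ τ ∧ y' i = cur + 1) :
    NamingInv t k (i + 1) (y' i) (t i) y' := by
  have hτ := h.rest i le_rfl hi
  have h1 := h.one_le
  have h2 := h.le
  have old : ∀ a < i, 1 ≤ y' a ∧ y' a ≤ y' i ∧ t a ≤ t i ∧ (y' a < y' i ↔ t a < t i) := by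
    intro a ha
    obtain ⟨n1, n2, n3, n4⟩ := h.named a ha
    rw [hy a ha]
    rcases hy' with ⟨hc, e⟩ | ⟨hc, e⟩ <;> rw [e]
    · rw [hc]; exact ⟨n1, n2, n3, n4⟩
    · have : τ < t i := lt_of_le_of_ne hτ (Ne.symm hc)
      exact ⟨n1, by omega, n3.trans hτ, ⟨fun _ => n3.trans_lt this, fun _ => by omega⟩⟩
  refine ⟨?_, ?_, fun a ha => ?_, fun a ha b hb => ?_, fun a ha hak => ?_⟩
  · omega
  · omega
  · rcases Nat.lt_succ_iff_lt_or_eq.1 ha with ha | rfl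
    · exact old a ha
    · exact ⟨by omega, le_rfl, le_rfl, by simp⟩
  · rcases Nat.lt_succ_iff_lt_or_eq.1 ha with ha | rfl
    · rcases Nat.lt_succ_iff_lt_or_eq.1 hb with hb | rfl
      · rw [hy a ha, hy b hb]; exact h.lt_iff a ha b hb
      · exact (old a ha).2.2.2
    · rcases Nat.lt_succ_iff_lt_or_eq.1 hb with hb | rfl
      · have o := old b hb
        refine ⟨fun hc => by omega, fun hc => absurd o.2.2.1 (not_le.2 hc)⟩
      · simp
  · exact ht i a (by omega) hak

/-- Name the triples of the sorted sample positions. -/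
def nameSample : Prog :=
  .seq (.assign xTa (.lit 0)) (.seq (.assign xTb (.lit 0)) (.seq (.assign xTc (.lit 0))
  (.seq (.assign xCur (.lit 1))
  (.forLt xI (.lit 0) xM1
    (.seq (.assign xP (.get aDst (.var xI)))
    (.seq (.assign xCur (.bin .add (.var xCur) (.bin .sub (.lit 1)
        (.bin .mul (.bin .eq (.get aX (.var xP)) (.var xTa))
        (.bin .mul (.bin .eq (.get aX (.bin .add (.var xP) (.lit 1))) (.var xTb))
          (.bin .eq (.get aX (.bin .add (.var xP) (.lit 2))) (.var xTc)))))))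
    (.seq (.assign xTa (.get aX (.var xP)))
    (.seq (.assign xTb (.get aX (.bin .add (.var xP) (.lit 1))))
    (.seq (.assign xTc (.get aX (.bin .add (.var xP) (.lit 2))))
    (.store aY (.bin .add (.bin .mul (.var xK1) (.bin .eq (.bin .mod (.var xP) (.lit 3)) (.lit 2)))
      (.bin .div (.var xP) (.lit 3))) (.var xCur)))))))))))

theorem ite_mul_ite_lt {P Q R : Prop} [Decidable P] [Decidable Q] [Decidable R] :
    (if P then 1 else 0) * ((if Q then 1 else 0) * (if R then 1 else 0))
      = if P ∧ Q ∧ R then 1 else 0 := by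
  split_ifs <;> simp_all

theorem nameSample_run {M : Machine} {s : State} {m : ℕ} {X : ℕ → ℕ} (hs : HasStr s m X)
    (hM1 : s.vars xM1 = m - m / 3) (hK1 : s.vars xK1 = (m + 2) / 3)
    (hE : Enumerates (IsSample m) (m - m / 3) (s.arr aDst))
    (hS : SortedBy (triple X) (m - m / 3) (s.arr aDst))
    (hcap : 20 * m + 100 ≤ M.cap) (hlen : m + 3 ≤ M.len) :
    Run M nameSample s (100 * m + 50) fun s' => IsNaming m X (s'.arr aY) ∧
      ∀ j < m - m / 3, 1 ≤ s'.arr aY j ∧ s'.arr aY j ≤ m - m / 3 + 1 := by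
  refine Run.seq (t₁ := 2) (t₂ := 100 * m + 48) ?_ (by omega)
  refine Run.assign (by simp only [Expr.Safe]; omega) ?_ (by simp [Expr.cost])
  refine Run.seq (t₁ := 2) (t₂ := 100 * m + 46) ?_ (by omega)
  refine Run.assign (by simp only [Expr.Safe]; omega) ?_ (by simp [Expr.cost])
  refine Run.seq (t₁ := 2) (t₂ := 100 * m + 44) ?_ (by omega)
  refine Run.assign (by simp only [Expr.Safe]; omega) ?_ (by simp [Expr.cost])
  refine Run.seq (t₁ := 2) (t₂ := 100 * m + 42) ?_ (by omega)
  refine Run.assign (by simp only [Expr.Safe]; omega) ?_ (by simp [Expr.cost])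
  simp only [Expr.val]
  generalize hs₀ : State.set _ _ _ = s₀
  have m₀ : s₀.vars xM1 = m - m / 3 := by simp [← hs₀, hM1]
  have k₀ : s₀.vars xK1 = (m + 2) / 3 := by simp [← hs₀, hK1]
  have X₀ : ∀ p ≤ m + 2, s₀.arr aX p = X p := by simpa [← hs₀] using hs.arr
  have D₀ : s₀.arr aDst = s.arr aDst := by simp [← hs₀]
  have a₀ : s₀.vars xTa = 0 := by simp [← hs₀]
  have b₀ : s₀.vars xTb = 0 := by simp [← hs₀]
  have c₀ : s₀.vars xTc = 0 := by simp [← hs₀]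
  have cur₀ : s₀.vars xCur = 1 := by simp [← hs₀]
  clear hs₀
  generalize s.arr aDst = L at hE hS D₀
  have hinj : ∀ a < m - m / 3, ∀ b < m - m / 3, sampleIdx m (L a) = sampleIdx m (L b) → a = b := by
    intro a ha b hb h
    refine hE.inj a ha b hb ?_
    rw [← samplePos_sampleIdx (hE.mem a ha), h, samplePos_sampleIdx (hE.mem b hb)]
  refine (Run.forLtWp (m - m / 3) 70
    (fun i s => NamingInv (fun a => triple X (L a)) (m - m / 3) i (s.vars xCur)
      (toLex (s.vars xTa, toLex (s.vars xTb, s.vars xTc)))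
      (fun a => s.arr aY (sampleIdx m (L a)))) ?_ m₀ rfl rfl (by decide)
    (by omega) (by omega) (by decide) ?_).imp (by omega) ?_
  · simp only [State.set_vars, Nat.reduceEqDiff, if_false, a₀, b₀, c₀, cur₀, State.set_arr]
    -- The name `1` is reserved for the triple `(0, 0, 0)`, the least of all. So the first item need
    -- not be treated separately, at the price of one name more than there are items.
    refine ⟨le_rfl, by omega, by simp, by simp, fun a _ _ => ?_⟩
    simp only [triple, Prod.Lex.toLex_le_toLex]
    omega
  · intro i s hi hI hx hF
    have e1 : s.vars xK1 = (m + 2) / 3 := by rw [hF.vars xK1 rfl, k₀]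
    have e2 : s.arr aDst = L := by rw [hF.arr aDst rfl, D₀]
    obtain ⟨q1, q2⟩ := hE.mem i hi
    have X' : ∀ p ≤ m + 2, s.arr aX p = X p := fun p hp => by rw [hF.arr aX rfl, X₀ p hp]
    have x0 := X' (L i) (by omega)
    have x1 := X' (L i + 1) (by omega)
    have x2 := X' (L i + 2) (by omega)
    -- The product with a comparison replaces the case distinction in `sampleIdx`.
    have hidx : (m + 2) / 3 * (if L i % 3 = 2 then 1 else 0) + L i / 3 = sampleIdx m (L i) := by
      unfold sampleIdx; split_ifs <;> omega
    have hsl := sampleIdx_lt (hE.mem i hi)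
    have c1 : (m + 2) / 3 * (if L i % 3 = 2 then 1 else 0) < M.cap := by split_ifs <;> omega
    have c2 := hI.le
    simp only [Prog.wp, Expr.Safe, Op.Fits, Op.apply, Expr.val, hx, e1, e2, State.set_arr,
      State.set_vars, Nat.reduceEqDiff, if_true, if_false, x0, x1, x2, hidx,
      State.put_arr, State.put_vars, true_and, ite_mul_ite_lt]
    have c3 : (if X (L i + 1) = s.vars xTb then 1 else 0) *
        (if X (L i + 2) = s.vars xTc then 1 else 0) < M.cap := by split_ifs <;> omega
    have c4 : (if X (L i) = s.vars xTa ∧ X (L i + 1) = s.vars xTb ∧ X (L i + 2) = s.vars xTc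
        then 1 else 0) ≤ 1 := by split_ifs <;> omega
    refine ⟨by omega, ⟨⟨by omega, ⟨by omega, ⟨by omega, by omega, c3⟩, by omega⟩, by omega⟩,
      by omega⟩, by omega, by omega, by omega, ⟨⟨by omega, c1⟩, by omega⟩, by omega, ?_⟩
    have h := hI.step (y' := fun a => if sampleIdx m (L a) = sampleIdx m (L i) then
        s.vars xCur + (1 - if X (L i) = s.vars xTa ∧ X (L i + 1) = s.vars xTb ∧
          X (L i + 2) = s.vars xTc then 1 else 0) else s.arr aY (sampleIdx m (L a)))
      hS hi ?_ ?_
    · rw [← triple]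
      simpa using h
    · intro a ha
      rw [if_neg fun h => by have := hinj a (by omega) i hi h; omega]
    · by_cases h : X (L i) = s.vars xTa ∧ X (L i + 1) = s.vars xTb ∧ X (L i + 2) = s.vars xTc
      · exact Or.inl ⟨by rw [triple, h.1, h.2.1, h.2.2], by simp [h]⟩
      · refine Or.inr ⟨fun e => h ?_, by rw [if_pos rfl, if_neg h]⟩
        simpa [triple] using e
  · intro s' h
    have hc := h.le
    refine ⟨fun p q hp hq => ?_, fun j hj => ?_⟩
    · obtain ⟨a, ha, rfl⟩ := hE.surj p hp
      obtain ⟨b, hb, rfl⟩ := hE.surj q hq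
      exact h.lt_iff a ha b hb
    · obtain ⟨a, ha, e⟩ := hE.surj _ (isSample_samplePos hj)
      have := h.named a ha
      simp only [e, sampleIdx_samplePos] at this
      omega

/-- Replace the string in `aX` by its reduced string. -/
def reduce : Prog :=
  .seq sortSample (.seq nameSample
  (.seq (.forLt xI (.lit 0) xM1 (.store aX (.var xI) (.get aY (.var xI))))
  (.seq (.store aX (.var xM1) (.lit 0))
  (.seq (.store aX (.bin .add (.var xM1) (.lit 1)) (.lit 0))
  (.seq (.store aX (.bin .add (.var xM1) (.lit 2)) (.lit 0))
  (.assign xM (.var xM1)))))))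

theorem reduce_run {M : Machine} {s : State} {m : ℕ} {X : ℕ → ℕ} (hs : HasStr s m X)
    (hX : IsStr m X) (hcap : 20 * m + 100 ≤ M.cap) (hlen : m + 3 ≤ M.len) :
    Run M reduce s (600 * m + 700) fun s' =>
      ∃ Y, IsReduced m X Y ∧ HasStr s' (m - m / 3) Y := by
  refine Run.seqFrame (200 * m + 100) (sortSample_run hs hX hcap hlen) ?_ (by omega)
  rintro s₁ ⟨m₁, k₁, E₁, S₁⟩ hF₁
  have H₁ : HasStr s₁ m X :=
    ⟨(hF₁.vars xM rfl).trans hs.len, fun p hp => by rw [hF₁.arr aX rfl, hs.arr p hp]⟩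
  refine Run.seqFrame (100 * m + 50) (nameSample_run H₁ m₁ k₁ E₁ S₁ hcap hlen) ?_ (by omega)
  rintro s₂ ⟨N₂, Y₂⟩ hF₂
  have m₂ : s₂.vars xM1 = m - m / 3 := (hF₂.vars xM1 rfl).trans m₁
  refine Run.seqFrame 40 (Run.forLtWp (m - m / 3) 4
    (fun j s => ∀ i < j, s.arr aX i = s₂.arr aY i) (by simp) m₂ rfl rfl (by decide)
    (by omega) (by omega) (by decide) ?_) ?_ (by omega)
  · intro j s hj hI hx hF
    simp only [Prog.wp, Expr.Safe, Expr.val, hx, State.set_arr, State.put_arr, true_and]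
    refine ⟨by omega, by omega, fun i hi => ?_⟩
    split_ifs with h
    · rw [h, hF.arr aY rfl]
    · exact hI i (by omega)
  intro s₃ hs₃ hF₃
  have m₃ : s₃.vars xM1 = m - m / 3 := (hF₃.vars xM1 rfl).trans m₂
  refine Run.imp (Prog.wp.run (Q := fun s' => ∃ Y, IsReduced m X Y ∧ HasStr s' (m - m / 3) Y) ?_)
    (by decide) fun _ h => h
  simp only [Prog.wp, Expr.Safe, Op.Fits, Op.apply, Expr.val, State.put_vars, m₃, true_and]
  -- The three stored zeros erase the old string up to the last index that a triple at the end of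
  -- the new string reads.
  refine ⟨by omega, by omega, by omega, by omega, by omega, by omega, by omega, by omega,
    fun p => if p < m - m / 3 then s₂.arr aY p else 0, ?_, ?_, ?_⟩
  · refine ⟨⟨fun p hp => ?_, fun p => ?_, fun p hp => if_neg (by omega)⟩, fun p q hp hq h => ?_⟩
    · rw [if_pos hp]; exact (Y₂ p hp).1
    · split_ifs with hp
      · exact (Y₂ p hp).2
      · omega
    · refine IsNaming.sLt hX (fun p q hp hq => ?_) hp hq h
      rw [if_pos (sampleIdx_lt hp), if_pos (sampleIdx_lt hq), N₂ p q hp hq]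
  · simp
  · intro p hp
    simp only [State.set_arr, State.put_arr, true_and]
    by_cases h : p < m - m / 3
    · rw [if_neg (by omega), if_neg (by omega), if_neg (by omega), if_pos h, hs₃ p h]
    · rw [if_neg h]
      split_ifs <;> first | rfl | omega

end Suffixient

namespace Suffixient

/-! ### Ranking all suffixes from the ranks of the sample suffixes -/

notation "xQ" => (25 : ℕ)
notation "xA" => (26 : ℕ)
notation "xJ" => (27 : ℕ)
notation "xF" => (28 : ℕ)
notation "xTot" => (29 : ℕ)
notation "aR" => (17 : ℕ)
notation "aSR" => (18 : ℕ)
notation "aLst" => (19 : ℕ)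

/-- The suffixes with the property `P` are the `t` smallest ones, and `R` ranks them. -/
structure RankInv (m : ℕ) (X : ℕ → ℕ) (P : ℕ → Prop) (t : ℕ) (R : ℕ → ℕ) : Prop where
  cross : ∀ u v, P u → v ≤ m → ¬ P v → SLt X u v
  lt : ∀ u, P u → R u < t
  iff : ∀ u v, P u → P v → (R u < R v ↔ SLt X u v)

/-- Appending the least remaining suffix with the next rank keeps the ranked suffixes below all
others. -/
theorem RankInv.step {m : ℕ} {X : ℕ → ℕ} {P P' : ℕ → Prop} {t : ℕ} {R R' : ℕ → ℕ}
    (h : RankInv m X P t R) {w : ℕ} (hw : w ≤ m) (hPw : ¬ P w)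
    (hmin : ∀ v ≤ m, ¬ P v → v ≠ w → SLt X w v) (hR : R' w = t) (hR' : ∀ u, u ≠ w → R' u = R u)
    (hP : ∀ u, P' u ↔ P u ∨ u = w) : RankInv m X P' (t + 1) R' := by
  have ne : ∀ u, P u → u ≠ w := fun u hu e => hPw (e ▸ hu)
  refine ⟨fun u v hu hv hPv => ?_, fun u hu => ?_, fun u v hu hv => ?_⟩
  · rw [hP, not_or] at hPv
    rcases (hP u).1 hu with h1 | rfl
    · exact h.cross u v h1 hv hPv.1
    · exact hmin v hv hPv.1 hPv.2
  · rcases (hP u).1 hu with h1 | rfl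
    · rw [hR' u (ne u h1)]; have := h.lt u h1; omega
    · omega
  · rcases (hP u).1 hu with h1 | rfl
    · rw [hR' u (ne u h1)]
      rcases (hP v).1 hv with h2 | rfl
      · rw [hR' v (ne v h2)]; exact h.iff u v h1 h2
      · rw [hR]; exact ⟨fun _ => h.cross u v h1 hw hPw, fun _ => h.lt u h1⟩
    · rcases (hP v).1 hv with h2 | rfl
      · rw [hR, hR' v (ne v h2)]
        have := h.lt v h2
        exact ⟨fun _ => by omega, fun h' => absurd h' (h.cross v u h2 hw hPw).asymm⟩
      · exact ⟨fun h' => absurd h' (lt_irrefl _), fun h' => absurd h' sLt_irrefl⟩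

/-- Expressions have no connectives; a lexicographic comparison is written with sums and products of
`0`-`1` values. -/
theorem flag_ne_zero {P Q : Prop} [Decidable P] [Decidable Q] {y : ℕ} :
    (if P then 1 else 0) + (if Q then 1 else 0) * y ≠ 0 ↔ P ∨ Q ∧ y ≠ 0 := by
  split_ifs <;> simp_all

theorem flag_mul_le {Q : Prop} [Decidable Q] {y : ℕ} : (if Q then 1 else 0) * y ≤ y := by
  split_ifs <;> simp

theorem flag_le {P Q : Prop} [Decidable P] [Decidable Q] {y : ℕ} :
    (if P then 1 else 0) + (if Q then 1 else 0) * y ≤ y + 1 := by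
  split_ifs <;> omega

theorem ite_one_le {P : Prop} [Decidable P] : (if P then 1 else 0) ≤ 1 := by
  split_ifs <;> simp

/-- Decide whether the next suffix of the merged list comes from the non-sample suffixes. -/
def mergeTest : Prog :=
  .seq (.assign xP (.get aLst (.var xA)))
  (.seq (.assign xQ (.get aSrc (.var xJ)))
  (.ite (.bin .le (.var xM1) (.var xA)) (.assign xF (.lit 1))
  (.ite (.bin .le (.var xK) (.var xJ)) (.assign xF (.lit 0))
  (.ite (.bin .eq (.bin .mod (.var xP) (.lit 3)) (.lit 1))
    (.assign xF (.bin .add (.bin .lt (.get aX (.var xQ)) (.get aX (.var xP)))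
      (.bin .mul (.bin .eq (.get aX (.var xQ)) (.get aX (.var xP)))
        (.bin .lt (.get aSR (.bin .add (.var xQ) (.lit 1)))
          (.get aSR (.bin .add (.var xP) (.lit 1)))))))
    (.assign xF (.bin .add (.bin .lt (.get aX (.var xQ)) (.get aX (.var xP)))
      (.bin .mul (.bin .eq (.get aX (.var xQ)) (.get aX (.var xP)))
        (.bin .add (.bin .lt (.get aX (.bin .add (.var xQ) (.lit 1)))
            (.get aX (.bin .add (.var xP) (.lit 1))))
          (.bin .mul (.bin .eq (.get aX (.bin .add (.var xQ) (.lit 1)))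
              (.get aX (.bin .add (.var xP) (.lit 1))))
            (.bin .lt (.get aSR (.bin .add (.var xQ) (.lit 2)))
              (.get aSR (.bin .add (.var xP) (.lit 2)))))))))))))

/-- Both list heads are read before exhaustion is tested, so `i` and `j` must be in bounds even when
the head is meaningless. A sample suffix of residue `1` is compared with a non-sample suffix by one
letter, one of residue `2` by two letters. -/
theorem mergeTest_wp {M : Machine} {s : State} {m k1 k0 i j : ℕ} {X A B : ℕ → ℕ}
    (hX : IsStr m X) (hXs : ∀ p ≤ m + 2, s.arr aX p = X p) (hS : IsSampleRank m X (s.arr aSR))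
    (hA : ∀ a < k1, IsSample m (A a)) (hB : ∀ b < k0, B b ≤ m ∧ B b % 3 = 0)
    (hAs : s.arr aLst = A) (hBs : s.arr aSrc = B) (hi : s.vars xA = i) (hj : s.vars xJ = j)
    (hk1 : s.vars xM1 = k1) (hk0 : s.vars xK = k0) (hij : i < k1 ∨ j < k0)
    (hil : i < M.len) (hjl : j < M.len)
    (hcap : 20 * m + 100 ≤ M.cap) (hlen : m + 3 ≤ M.len) :
    mergeTest.wp M (fun s' => s'.vars xP = A i ∧ s'.vars xQ = B j ∧
      (s'.vars xF ≠ 0 → j < k0 ∧ (i < k1 → SLt X (B j) (A i))) ∧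
      (s'.vars xF = 0 → i < k1 ∧ (j < k0 → SLt X (A i) (B j)))) s := by
  simp only [mergeTest, Prog.wp, Expr.Safe, Op.Fits, Op.apply, Expr.val, hi, hj, hk1, hk0, hAs, hBs,
    State.set_arr, State.set_vars, Nat.reduceEqDiff, if_true, if_false, true_and, ne_eq,
    ite_eq_right_iff, one_ne_zero, imp_false, not_le, not_not]
  refine ⟨hil, hjl, by omega, fun h => ⟨by omega, fun _ => ⟨by omega, fun h' => by omega⟩, by simp⟩,
    fun h => ⟨by omega, fun h' => ⟨by omega, by simp, fun _ => ⟨h, fun h'' => by omega⟩⟩,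
      fun h' => ⟨by have := (hA i h).1; omega, fun h3 => ?_, fun h3 => ?_⟩⟩⟩
  · obtain ⟨a1, a2⟩ := hA i h
    obtain ⟨b1, b2⟩ := hB j h'
    have ne : B j ≠ A i := by intro e; rw [e] at b2; exact a2 b2
    rw [hXs (A i) (by omega), hXs (B j) (by omega)]
    have key := hS.sLt_one hX b1 a1 ne (by omega) (by omega)
    have l1 : (if s.arr aSR (B j + 1) < s.arr aSR (A i + 1) then 1 else 0) ≤ 1 := ite_one_le
    refine ⟨⟨by omega, ⟨by omega, by omega, lt_of_le_of_lt flag_mul_le (by omega)⟩,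
      lt_of_le_of_lt flag_le (by omega)⟩, fun hf => ⟨h', fun _ => ?_⟩, fun hf => ⟨h, fun _ => ?_⟩⟩
    · rw [key]
      simpa using flag_ne_zero.1 hf
    · refine (hX.sLt_or b1 a1 ne).resolve_left fun h4 => ?_
      rw [key] at h4
      exact flag_ne_zero.2 (by simpa using h4) hf
  · obtain ⟨a1, a2⟩ := hA i h
    obtain ⟨b1, b2⟩ := hB j h'
    have ne : B j ≠ A i := by intro e; rw [e] at b2; exact a2 b2
    rw [hXs (A i) (by omega), hXs (B j) (by omega), hXs (A i + 1) (by omega),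
      hXs (B j + 1) (by omega)]
    have key := hS.sLt_two hX b1 a1 ne (by omega) (by omega)
    have l1 : (if s.arr aSR (B j + 2) < s.arr aSR (A i + 2) then 1 else 0) ≤ 1 := ite_one_le
    have l2 := flag_le (P := X (B j + 1) < X (A i + 1)) (Q := X (B j + 1) = X (A i + 1))
      (y := if s.arr aSR (B j + 2) < s.arr aSR (A i + 2) then 1 else 0)
    refine ⟨⟨by omega, ⟨by omega, ⟨by omega, ⟨by omega, by omega,
      lt_of_le_of_lt flag_mul_le (by omega)⟩, by omega⟩, lt_of_le_of_lt flag_mul_le (by omega)⟩,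
      lt_of_le_of_lt flag_le (by omega)⟩, fun hf => ⟨h', fun _ => ?_⟩, fun hf => ⟨h, fun _ => ?_⟩⟩
    · rw [key]
      rw [← ne_eq, flag_ne_zero, flag_ne_zero] at hf
      simpa using hf
    · refine (hX.sLt_or b1 a1 ne).resolve_left fun h4 => ?_
      rw [key] at h4
      refine absurd hf ?_
      rw [← ne_eq, flag_ne_zero, flag_ne_zero]
      simpa using h4

/-- Merge the sorted lists of the sample and the non-sample suffixes. -/
def merge : Prog :=
  .seq (.assign xA (.lit 0)) (.seq (.assign xJ (.lit 0))
  (.seq (.assign xTot (.bin .add (.var xM) (.lit 1)))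
  (.forLt xI (.lit 0) xTot
    (.seq mergeTest
    (.ite (.var xF)
      (.seq (.store aR (.var xQ) (.var xI)) (.assign xJ (.bin .add (.var xJ) (.lit 1))))
      (.seq (.store aR (.var xP) (.var xI)) (.assign xA (.bin .add (.var xA) (.lit 1)))))))))

theorem merge_run {M : Machine} {s : State} {m : ℕ} {X : ℕ → ℕ} (hs : HasStr s m X)
    (hX : IsStr m X) (hS : IsSampleRank m X (s.arr aSR))
    (hA : Enumerates (IsSample m) (m - m / 3) (s.arr aLst))
    (hAs : ∀ a b, a < b → b < m - m / 3 → SLt X (s.arr aLst a) (s.arr aLst b))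
    (hB : Enumerates (fun p => p ≤ m ∧ p % 3 = 0) (m / 3 + 1) (s.arr aSrc))
    (hBs : ∀ a b, a < b → b < m / 3 + 1 → SLt X (s.arr aSrc a) (s.arr aSrc b))
    (hk1 : s.vars xM1 = m - m / 3) (hk0 : s.vars xK = m / 3 + 1)
    (hcap : 20 * m + 100 ≤ M.cap) (hlen : m + 3 ≤ M.len) :
    Run M merge s (130 * m + 200) fun s' => IsRank m X (s'.arr aR) := by
  refine Run.seq (t₁ := 2) (t₂ := 130 * m + 198) ?_ (by omega)
  refine Run.assign (by simp only [Expr.Safe]; omega) ?_ (by simp [Expr.cost])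
  refine Run.seq (t₁ := 2) (t₂ := 130 * m + 196) ?_ (by omega)
  refine Run.assign (by simp only [Expr.Safe]; omega) ?_ (by simp [Expr.cost])
  refine Run.seq (t₁ := 4) (t₂ := 130 * m + 192) ?_ (by omega)
  refine Run.assign ?_ ?_ (by simp [Expr.cost])
  · simp only [Expr.Safe, Op.Fits, Expr.val, State.set_vars, Nat.reduceEqDiff, if_false, hs.len,
      true_and]; omega
  simp only [Expr.val, Op.apply, State.set_vars, Nat.reduceEqDiff, if_false, hs.len]
  generalize hs₀ : State.set _ _ _ = s₀
  have m₀ : s₀.vars xM1 = m - m / 3 := by simp [← hs₀, hk1]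
  have k₀ : s₀.vars xK = m / 3 + 1 := by simp [← hs₀, hk0]
  have t₀ : s₀.vars xTot = m + 1 := by simp [← hs₀]
  have X₀ : ∀ p ≤ m + 2, s₀.arr aX p = X p := by simpa [← hs₀] using hs.arr
  have S₀ : s₀.arr aSR = s.arr aSR := by simp [← hs₀]
  have A₀ : s₀.arr aLst = s.arr aLst := by simp [← hs₀]
  have B₀ : s₀.arr aSrc = s.arr aSrc := by simp [← hs₀]
  have i₀ : s₀.vars xA = 0 := by simp [← hs₀]
  have j₀ : s₀.vars xJ = 0 := by simp [← hs₀]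
  clear hs₀
  generalize s.arr aLst = A at hA hAs A₀
  generalize s.arr aSrc = B at hB hBs B₀
  refine (Run.forLt (m + 1) 120 (fun t s => s.vars xA + s.vars xJ = t ∧ s.vars xA ≤ m - m / 3 ∧
    s.vars xJ ≤ m / 3 + 1 ∧ RankInv m X
      (fun u => (∃ a < s.vars xA, A a = u) ∨ ∃ b < s.vars xJ, B b = u) t (s.arr aR)) ?_ t₀
    rfl rfl (by decide) (by omega) (by omega) ?_).imp (by omega) ?_
  · simp only [State.set_vars, Nat.reduceEqDiff, if_false, i₀, j₀, Nat.not_lt_zero, false_and,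
      exists_false, or_self]
    exact ⟨trivial, by omega, by omega, ⟨fun u v h => h.elim, fun u h => h.elim, fun u v h => h.elim⟩⟩
  · rintro t s ht ⟨hij, hi, hj, hI⟩ hx hF
    have X' : ∀ p ≤ m + 2, s.arr aX p = X p := fun p hp => by rw [hF.arr aX rfl, X₀ p hp]
    have S' : IsSampleRank m X (s.arr aSR) := by rw [hF.arr aSR rfl, S₀]; exact hS
    have A' : s.arr aLst = A := by rw [hF.arr aLst rfl, A₀]
    have B' : s.arr aSrc = B := by rw [hF.arr aSrc rfl, B₀]
    have m' : s.vars xM1 = m - m / 3 := by rw [hF.vars xM1 rfl, m₀]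
    have k' : s.vars xK = m / 3 + 1 := by rw [hF.vars xK rfl, k₀]
    have hcls : ∀ v ≤ m, (∃ a < m - m / 3, A a = v) ∨ ∃ b < m / 3 + 1, B b = v := by
      intro v hv
      by_cases h : v % 3 = 0
      · exact Or.inr (hB.surj v ⟨hv, h⟩)
      · exact Or.inl (hA.surj v ⟨hv, h⟩)
    have hne : ∀ a < m - m / 3, ∀ b < m / 3 + 1, A a ≠ B b := fun a ha b hb e => by
      have h1 := (hA.mem a ha).2
      have h2 := (hB.mem b hb).2
      rw [e] at h1; exact h1 h2
    have W := (mergeTest_wp (i := s.vars xA) (j := s.vars xJ) hX X' S'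
      hA.mem hB.mem A' B' rfl rfl m' k' (by omega) (by omega) (by omega) hcap hlen).run
    have hcost : mergeTest.cost ≤ 95 := by decide
    refine Run.seqFrame 20 W ?_ (by omega)
    rintro s₁ ⟨p₁, q₁, f₁, f₁'⟩ hF₁
    have R₁ : s₁.arr aR = s.arr aR := hF₁.arr aR rfl
    have a₁ : s₁.vars xA = s.vars xA := hF₁.vars xA rfl
    have j₁ : s₁.vars xJ = s.vars xJ := hF₁.vars xJ rfl
    have x₁ : s₁.vars xI = t := (hF₁.vars xI rfl).trans hx
    generalize s.vars xA = i at *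
    generalize s.vars xJ = j at *
    refine Run.imp (Prog.wp.run (Q := _) ?_) (by decide) fun _ h => h
    simp only [Prog.wp, Expr.Safe, Op.Fits, Op.apply, Expr.val, p₁, q₁, x₁, a₁, j₁,
      State.put_vars, State.set_vars, Nat.reduceEqDiff, if_true, if_false, true_and, State.set_arr]
    refine ⟨fun h => ?_, fun h => ?_⟩
    · obtain ⟨hjk, hlt⟩ := f₁ h
      have hBm := (hB.mem j hjk).1
      refine ⟨by omega, by omega, by omega, hi, hjk, ?_⟩
      refine hI.step (w := B j) hBm ?_ ?_ (by simp) (fun u hu => by simp [hu, R₁]) ?_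
      · rintro (⟨a, ha, e⟩ | ⟨b, hb, e⟩)
        · exact hne a (by omega) j hjk e
        · have := hB.inj b (by omega) j hjk e; omega
      · intro v hv hnv hvw
        rw [not_or] at hnv
        push Not at hnv
        rcases hcls v hv with ⟨a, ha, rfl⟩ | ⟨b, hb, rfl⟩
        · have h1 : i ≤ a := by by_contra h1; exact hnv.1 a (by omega) rfl
          -- The chosen suffix precedes the head of the other list, and hence everything behind that
          -- head.
          have h2 := hlt (by omega)
          rcases h1.lt_or_eq with h3 | h3
          · exact h2.trans (hAs i a h3 ha)
          · exact h3 ▸ h2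
        · have h1 : j ≤ b := by by_contra h1; exact hnv.2 b (by omega) rfl
          rcases h1.lt_or_eq with h3 | h3
          · exact hBs j b h3 hb
          · exact absurd (by rw [h3]) hvw
      · intro u
        constructor
        · rintro (h | ⟨b, hb, e⟩)
          · exact Or.inl (Or.inl h)
          · rcases Nat.lt_succ_iff_lt_or_eq.1 hb with hb | rfl
            · exact Or.inl (Or.inr ⟨b, hb, e⟩)
            · exact Or.inr e.symm
        · rintro ((h | ⟨b, hb, e⟩) | e)
          · exact Or.inl h
          · exact Or.inr ⟨b, by omega, e⟩
          · exact Or.inr ⟨j, by omega, e.symm⟩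
    · obtain ⟨hik, hlt⟩ := f₁' h
      have hAm := (hA.mem i hik).1
      refine ⟨by omega, by omega, by omega, hik, hj, ?_⟩
      refine hI.step (w := A i) hAm ?_ ?_ (by simp) (fun u hu => by simp [hu, R₁]) ?_
      · rintro (⟨a, ha, e⟩ | ⟨b, hb, e⟩)
        · have := hA.inj a (by omega) i hik e; omega
        · exact hne i hik b (by omega) e.symm
      · intro v hv hnv hvw
        rw [not_or] at hnv
        push Not at hnv
        rcases hcls v hv with ⟨a, ha, rfl⟩ | ⟨b, hb, rfl⟩
        · have h1 : i ≤ a := by by_contra h1; exact hnv.1 a (by omega) rfl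
          rcases h1.lt_or_eq with h3 | h3
          · exact hAs i a h3 ha
          · exact absurd (by rw [h3]) hvw
        · have h1 : j ≤ b := by by_contra h1; exact hnv.2 b (by omega) rfl
          have h2 := hlt (by omega)
          rcases h1.lt_or_eq with h3 | h3
          · exact h2.trans (hBs j b h3 hb)
          · exact h3 ▸ h2
      · intro u
        constructor
        · rintro (⟨a, ha, e⟩ | h)
          · rcases Nat.lt_succ_iff_lt_or_eq.1 ha with ha | rfl
            · exact Or.inl (Or.inl ⟨a, ha, e⟩)
            · exact Or.inr e.symm
          · exact Or.inl (Or.inr h)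
        · rintro ((⟨a, ha, e⟩ | h) | e)
          · exact Or.inl ⟨a, by omega, e⟩
          · exact Or.inr h
          · exact Or.inl ⟨i, by omega, e.symm⟩
  · rintro s' ⟨h1, h2, h3, hI⟩
    have all : ∀ u ≤ m, (∃ a < s'.vars xA, A a = u) ∨ ∃ b < s'.vars xJ, B b = u := by
      intro u hu
      by_cases h : u % 3 = 0
      · obtain ⟨b, hb, e⟩ := hB.surj u ⟨hu, h⟩
        exact Or.inr ⟨b, by omega, e⟩
      · obtain ⟨a, ha, e⟩ := hA.surj u ⟨hu, h⟩
        exact Or.inl ⟨a, by omega, e⟩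
    exact ⟨fun p hp => by have := hI.lt p (all p hp); omega,
      fun p hp q hq => hI.iff p q (all p hp) (all q hq)⟩

end Suffixient

namespace Suffixient

/-- Compute the ranks of all suffixes of the string in `aX` from those of the reduced string. -/
def combine : Prog :=
  .seq (.assign xM1 (.bin .sub (.var xM) (.bin .div (.var xM) (.lit 3))))
  (.seq (.assign xK1 (.bin .div (.bin .add (.var xM) (.lit 2)) (.lit 3)))
  (.seq (.assign xK (.bin .add (.bin .div (.var xM) (.lit 3)) (.lit 1)))
  (.seq (.assign xB (.bin .add (.var xM) (.lit 2)))
  (.seq (.forLt xI (.lit 0) xM1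
    (.seq (.ite (.bin .lt (.var xI) (.var xK1))
        (.assign xP (.bin .add (.bin .mul (.lit 3) (.var xI)) (.lit 1)))
        (.assign xP (.bin .add (.bin .mul (.lit 3) (.bin .sub (.var xI) (.var xK1))) (.lit 2))))
    (.seq (.store aSR (.var xP) (.get aR (.var xI)))
      (.store aLst (.bin .sub (.get aR (.var xI)) (.lit 1)) (.var xP)))))
  (.seq (.store aSR (.bin .add (.var xM) (.lit 1)) (.lit 0))
  (.seq (.forLt xI (.lit 0) xK (.store aSrc (.var xI) (.bin .mul (.lit 3) (.var xI))))
  (.seq (countingSort aSR 1 aSrc aDst)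
  (.seq (countingSort aX 0 aDst aSrc)
    merge))))))))

theorem combine_run {M : Machine} {s : State} {m : ℕ} {X Y : ℕ → ℕ} (hs : HasStr s m X)
    (hX : IsStr m X) (hY : IsReduced m X Y) (hR : IsRank (m - m / 3) Y (s.arr aR))
    (hcap : 20 * m + 100 ≤ M.cap) (hlen : m + 3 ≤ M.len) :
    Run M combine s (600 * m + 1000) fun s' => IsRank m X (s'.arr aR) := by
  refine Run.seq (t₁ := 6) (t₂ := 600 * m + 994) ?_ (by omega)
  refine Run.assign ?_ ?_ (by simp [Expr.cost])
  · simp only [Expr.Safe, Op.Fits, Expr.val, hs.len, true_and]; omega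
  refine Run.seq (t₁ := 6) (t₂ := 600 * m + 988) ?_ (by omega)
  refine Run.assign ?_ ?_ (by simp [Expr.cost])
  · simp only [Expr.Safe, Op.Fits, Op.apply, Expr.val, State.set_vars, Nat.reduceEqDiff, if_false,
      hs.len, true_and]; omega
  refine Run.seq (t₁ := 6) (t₂ := 600 * m + 982) ?_ (by omega)
  refine Run.assign ?_ ?_ (by simp [Expr.cost])
  · simp only [Expr.Safe, Op.Fits, Op.apply, Expr.val, State.set_vars, Nat.reduceEqDiff, if_false,
      hs.len, true_and]; omega
  refine Run.seq (t₁ := 4) (t₂ := 600 * m + 978) ?_ (by omega)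
  refine Run.assign ?_ ?_ (by simp [Expr.cost])
  · simp only [Expr.Safe, Op.Fits, Op.apply, Expr.val, State.set_vars, Nat.reduceEqDiff, if_false,
      hs.len, true_and]; omega
  simp only [Expr.val, Op.apply, State.set_vars, Nat.reduceEqDiff, if_false, hs.len]
  generalize hs₀ : State.set _ _ _ = s₀
  have M₀ : s₀.vars xM = m := by simp [← hs₀, hs.len]
  have m₀ : s₀.vars xM1 = m - m / 3 := by simp [← hs₀]
  have k₀ : s₀.vars xK1 = (m + 2) / 3 := by simp [← hs₀]
  have K₀ : s₀.vars xK = m / 3 + 1 := by simp [← hs₀]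
  have B₀ : s₀.vars xB = m + 2 := by simp [← hs₀]
  have X₀ : ∀ p ≤ m + 2, s₀.arr aX p = X p := by simpa [← hs₀] using hs.arr
  have R₀ : s₀.arr aR = s.arr aR := by simp [← hs₀]
  clear hs₀
  generalize s.arr aR = R at hR R₀
  -- The ranks of the nonempty suffixes of the reduced string start at `1`, the sorted list of
  -- sample positions at index `0`.
  refine Run.seqFrame (550 * m + 900) (Run.forLtWp (m - m / 3) 40
    (fun j s => ∀ i < j, s.arr aSR (samplePos m i) = R i ∧ s.arr aLst (R i - 1) = samplePos m i)
    (by simp) m₀ rfl rfl (by decide) (by omega) (by omega) (by decide) ?_) ?_ (by omega)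
  · intro j s hj hI hx hF
    have e1 : s.vars xK1 = (m + 2) / 3 := by rw [hF.vars xK1 rfl, k₀]
    have e2 : s.arr aR = R := by rw [hF.arr aR rfl, R₀]
    have e3 := hR.le j hj.le
    have step : ∀ i < j + 1, (if samplePos m i = samplePos m j then R j
          else s.arr aSR (samplePos m i)) = R i ∧
        (if R i - 1 = R j - 1 then samplePos m j else s.arr aLst (R i - 1)) = samplePos m i := by
      intro i hi
      rcases Nat.lt_succ_iff_lt_or_eq.1 hi with hi | rfl
      · rw [if_neg, if_neg]
        · exact hI i hi
        · intro h
          have h1 := hR.pos hY.str hj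
          have h2 := hR.pos hY.str (show i < m - m / 3 by omega)
          have := hR.inj hY.str (show i ≤ m - m / 3 by omega) hj.le (by omega)
          omega
        · intro h
          have h' := congrArg (sampleIdx m) h
          rw [sampleIdx_samplePos, sampleIdx_samplePos] at h'
          omega
      · simp
    simp only [Prog.wp, Expr.Safe, Op.Fits, Op.apply, Expr.val, hx, e1, e2, State.set_arr,
      State.set_vars, State.put_vars, Nat.reduceEqDiff, if_false, if_true,
      State.put_arr, true_and, ne_eq, ite_eq_right_iff, one_ne_zero, imp_false, not_lt, not_le,
      false_and]
    refine ⟨by omega, fun h => ⟨by omega, by omega, by omega, ⟨by omega, by omega, by omega⟩,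
      by omega, ?_⟩, fun h => ⟨by omega, by omega, by omega, ⟨by omega, by omega, by omega⟩,
      by omega, ?_⟩⟩
    · rw [samplePos, if_pos h] at step
      exact step
    · rw [samplePos, if_neg (by omega)] at step
      exact step
  intro s₁ hs₁ hF₁
  -- If `3` divides `m`, the non-sample position `m` is sorted by the entry at `m + 1`, which no
  -- sample suffix sets. A zero there keeps the key in the range of the counting sort.
  refine Run.seqFrame (550 * m + 895) (Run.imp (t' := 5) (Prog.wp.run (Q := fun s' =>
    s'.arr aSR (m + 1) = 0 ∧ ∀ i ≤ m, s'.arr aSR i = s₁.arr aSR i) ?_) (by decide)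
    fun _ h => h) ?_ (by omega)
  · simp only [Prog.wp, Expr.Safe, Op.Fits, Op.apply, Expr.val, hF₁.vars xM rfl, M₀, true_and,
      State.put_arr, if_true]
    exact ⟨by omega, by omega, by omega, fun i hi => if_neg (by omega)⟩
  rintro s₂ ⟨z₂, hs₂⟩ hF₂
  have K₂ : s₂.vars xK = m / 3 + 1 := by rw [hF₂.vars xK rfl, hF₁.vars xK rfl, K₀]
  refine Run.seqFrame (500 * m + 850) (Run.forLtWp (m / 3 + 1) 6
    (fun j s => ∀ i < j, s.arr aSrc i = 3 * i) (by simp) K₂ rfl rfl (by decide)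
    (by omega) (by omega) (by decide) ?_) ?_ (by omega)
  · intro j s hj hI hx hF
    simp only [Prog.wp, Expr.Safe, Op.Fits, Expr.val, Op.apply, hx, State.set_arr, State.put_arr,
      true_and]
    refine ⟨by omega, by omega, fun i hi => ?_⟩
    split_ifs with h
    · rw [h]
    · exact hI i (by omega)
  intro s₃ hs₃ hF₃
  have E₃ : Enumerates (fun p => p ≤ m ∧ p % 3 = 0) (m / 3 + 1) (s₃.arr aSrc) := by
    refine ⟨fun i hi => ?_, fun p hp => ⟨p / 3, by omega, ?_⟩, fun i hi j hj h => ?_⟩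
    · rw [hs₃ i hi]; omega
    · rw [hs₃ _ (by omega)]; omega
    · rw [hs₃ i hi, hs₃ j hj] at h; omega
  have M₃ : s₃.vars xM = m := by
    rw [hF₃.vars xM rfl, hF₂.vars xM rfl, hF₁.vars xM rfl, M₀]
  have m₃ : s₃.vars xM1 = m - m / 3 := by
    rw [hF₃.vars xM1 rfl, hF₂.vars xM1 rfl, hF₁.vars xM1 rfl, m₀]
  have K₃ : s₃.vars xK = m / 3 + 1 := by rw [hF₃.vars xK rfl, K₂]
  have B₃ : s₃.vars xB = m + 2 := by
    rw [hF₃.vars xB rfl, hF₂.vars xB rfl, hF₁.vars xB rfl, B₀]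
  have X₃ : ∀ p ≤ m + 2, s₃.arr aX p = X p := by
    intro p hp; rw [hF₃.arr aX rfl, hF₂.arr aX rfl, hF₁.arr aX rfl, X₀ p hp]
  have L₃ : ∀ i < m - m / 3, s₃.arr aLst (R i - 1) = samplePos m i := by
    intro i hi; rw [hF₃.arr aLst rfl, hF₂.arr aLst rfl]; exact (hs₁ i hi).2
  have S₃ : ∀ p, IsSample m p → s₃.arr aSR p = R (sampleIdx m p) := by
    intro p hp
    rw [hF₃.arr aSR rfl, hs₂ p hp.1, ← (hs₁ _ (sampleIdx_lt hp)).1, samplePos_sampleIdx hp]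
  have Z₃ : s₃.arr aSR (m + 1) = 0 := by rw [hF₃.arr aSR rfl, z₂]
  have SR₃ : IsSampleRank m X (s₃.arr aSR) := hY.isSampleRank hX hR S₃
  clear hs₁ hs₂ hF₁ hF₂ hF₃ hs₃
  refine Run.seqFrame (400 * m + 600) (countingSort_run (g := fun i => s₃.arr aSR (s₃.arr aSrc i + 1))
    (by decide) (by decide) (by decide) (by decide) (by decide) K₃ B₃
    (by omega) (by omega) (by omega) (by omega) (fun i hi => rfl) (fun i hi => rfl)
    (fun i hi => by have := (E₃.mem i hi).1; omega) (fun i hi => ?_)) ?_ (by omega)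
  · obtain ⟨h1, h2⟩ := E₃.mem i hi
    rcases h1.lt_or_eq with h | h
    · have h3 : IsSample m (s₃.arr aSrc i + 1) := ⟨by omega, by omega⟩
      have := hR.le _ (sampleIdx_lt h3).le
      rw [S₃ _ h3]; omega
    · rw [h, Z₃]; omega
  intro s₄ hs₄ hF₄
  have E₄ := E₃.sort hs₄
  have T₃ : SortedBy (fun _ => ()) (m / 3 + 1) (s₃.arr aSrc) := fun _ _ _ _ => le_rfl
  have T₄ := T₃.sort (κ := fun p => s₃.arr aSR (p + 1)) (fun i hi => rfl) hs₄
  have X₄ : ∀ p ≤ m + 2, s₄.arr aX p = X p := by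
    intro p hp; rw [hF₄.arr aX rfl, X₃ p hp]
  refine Run.seqFrame (130 * m + 200) (countingSort_run (g := fun i => X (s₄.arr aDst i))
    (by decide) (by decide) (by decide) (by decide) (by decide)
    ((hF₄.vars xK rfl).trans K₃) ((hF₄.vars xB rfl).trans B₃)
    (by omega) (by omega) (by omega) (by omega) (fun i hi => rfl)
    (fun i hi => X₄ _ (by have := (E₄.mem i hi).1; omega))
    (fun i hi => by have := (E₄.mem i hi).1; omega)
    (fun i hi => by have := hX.le (s₄.arr aDst i); omega)) ?_ (by omega)
  intro s₅ hs₅ hF₅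
  have E₅ := E₄.sort hs₅
  have T₅ := T₄.sort (κ := X) (fun i hi => rfl) hs₅
  have eSR : s₅.arr aSR = s₃.arr aSR := by rw [hF₅.arr aSR rfl, hF₄.arr aSR rfl]
  have eL : s₅.arr aLst = s₃.arr aLst := by rw [hF₅.arr aLst rfl, hF₄.arr aLst rfl]
  -- Only the empty suffix of the reduced string has rank `0`, so every other rank comes from a
  -- genuine index.
  have hidx : ∀ a < m - m / 3, ∃ i < m - m / 3, R i - 1 = a ∧ R i = a + 1 := by
    intro a ha
    obtain ⟨i, hi, e⟩ := hR.surj hY.str (show a + 1 ≤ m - m / 3 by omega)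
    refine ⟨i, ?_, by omega, e⟩
    rcases hi.lt_or_eq with h | h
    · exact h
    · have := hR.length hY.str; rw [← h] at this; omega
  refine merge_run ⟨?_, fun p hp => by rw [hF₅.arr aX rfl, X₄ p hp]⟩ hX (eSR ▸ SR₃) ?_ ?_ E₅ ?_ ?_ ?_
    hcap hlen
  · rw [hF₅.vars xM rfl, hF₄.vars xM rfl, M₃]
  · rw [eL]
    refine ⟨fun a ha => ?_, fun p hp => ?_, fun a ha b hb h => ?_⟩
    · obtain ⟨i, hi, rfl, -⟩ := hidx a ha
      rw [L₃ i hi]; exact isSample_samplePos hi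
    · have h1 := hR.pos hY.str (sampleIdx_lt hp)
      have h2 := hR.le _ (sampleIdx_lt hp).le
      exact ⟨R (sampleIdx m p) - 1, by omega, by rw [L₃ _ (sampleIdx_lt hp), samplePos_sampleIdx hp]⟩
    · obtain ⟨i, hi, rfl, -⟩ := hidx a ha
      obtain ⟨j, hj, rfl, -⟩ := hidx b hb
      rw [L₃ i hi, L₃ j hj] at h
      have h' := congrArg (sampleIdx m) h
      rw [sampleIdx_samplePos, sampleIdx_samplePos] at h'
      rw [h']
  · rw [eL]
    intro a b hab hb
    obtain ⟨i, hi, e1, e2⟩ := hidx a (by omega)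
    obtain ⟨j, hj, e3, e4⟩ := hidx b hb
    rw [← e1, ← e3, L₃ i hi, L₃ j hj,
      ← SR₃ _ _ (isSample_samplePos hi) (isSample_samplePos hj), S₃ _ (isSample_samplePos hi),
      S₃ _ (isSample_samplePos hj), sampleIdx_samplePos, sampleIdx_samplePos]
    omega
  · intro a b hab hb
    have h1 := E₅.mem a (by omega)
    have h2 := E₅.mem b hb
    have ne : s₅.arr aSrc a ≠ s₅.arr aSrc b := fun h => by
      have := E₅.inj a (by omega) b hb h; omega
    -- By `sLt_one` the order of two non-sample suffixes is decided by the very pair of keys that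
    -- the list was sorted by.
    refine (hX.sLt_or h1.1 h2.1 ne).resolve_right fun h => ?_
    rw [SR₃.sLt_one hX h2.1 h1.1 ne.symm (by omega) (by omega)] at h
    have := T₅ a b hab hb
    simp only [Prod.Lex.toLex_le_toLex, le_refl, and_true] at this
    omega
  · rw [hF₅.vars xM1 rfl, hF₄.vars xM1 rfl, m₃]
  · rw [hF₅.vars xK rfl, hF₄.vars xK rfl, K₃]

/-! ### The recursion, with an explicit stack -/

notation "xSp" => (19 : ℕ)
notation "aStk" => (16 : ℕ)

def push : Prog :=
  .seq (.forLt xI (.lit 0) xM (.store aStk (.bin .add (.var xSp) (.var xI)) (.get aX (.var xI))))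
  (.seq (.store aStk (.bin .add (.var xSp) (.var xM)) (.var xM))
  (.assign xSp (.bin .add (.bin .add (.var xSp) (.var xM)) (.lit 1))))

def pop : Prog :=
  .seq (.assign xM (.get aStk (.bin .sub (.var xSp) (.lit 1))))
  (.seq (.assign xSp (.bin .sub (.var xSp) (.bin .add (.var xM) (.lit 1))))
  (.seq (.forLt xI (.lit 0) xM (.store aX (.var xI) (.get aStk (.bin .add (.var xSp) (.var xI)))))
  (.seq (.store aX (.var xM) (.lit 0))
  (.seq (.store aX (.bin .add (.var xM) (.lit 1)) (.lit 0))
  (.store aX (.bin .add (.var xM) (.lit 2)) (.lit 0))))))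

/-- The array `a` holds a stack of strings below the address `sp`. -/
def IsStack (a : ℕ → ℕ) : List (ℕ × (ℕ → ℕ)) → ℕ → Prop
  | [], sp => sp = 0
  | (m, X) :: F, sp => ∃ b, sp = b + m + 1 ∧ a (b + m) = m ∧ (∀ p < m, a (b + p) = X p) ∧
      IsStack a F b

theorem IsStack.congr {a a' : ℕ → ℕ} {F : List (ℕ × (ℕ → ℕ))} {sp : ℕ} (h : IsStack a F sp)
    (ha : ∀ i < sp, a' i = a i) : IsStack a' F sp := by
  induction F generalizing sp with
  | nil => exact h
  | cons f F ih =>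
    obtain ⟨m, X⟩ := f
    obtain ⟨b, h1, h2, h3, h4⟩ := h
    refine ⟨b, h1, by rw [ha _ (by omega), h2], fun p hp => by rw [ha _ (by omega), h3 p hp],
      ih h4 fun i hi => ha i (by omega)⟩

/-- `X` results from the string `X₀` of length `n` by successive reductions of the strings in a
stack. -/
def IsReductionChain (n : ℕ) (X₀ : ℕ → ℕ) : List (ℕ × (ℕ → ℕ)) → ℕ → (ℕ → ℕ) → Prop
  | [], m, X => m = n ∧ X = X₀
  | (m₁, X₁) :: F, m, X => m = m₁ - m₁ / 3 ∧ IsStr m₁ X₁ ∧ IsReduced m₁ X₁ X ∧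
      IsReductionChain n X₀ F m₁ X₁

theorem push_run {M : Machine} {s : State} {m sp : ℕ} {X : ℕ → ℕ} {F : List (ℕ × (ℕ → ℕ))}
    (hs : HasStr s m X) (hF : IsStack (s.arr aStk) F sp) (hsp : s.vars xSp = sp)
    (hcap : sp + m + 10 < M.cap) (hlen : sp + m + 1 < M.len) :
    Run M push s (20 * m + 20) fun s' =>
      IsStack (s'.arr aStk) ((m, X) :: F) (s'.vars xSp) ∧ s'.vars xSp = sp + m + 1 := by
  refine Run.seqFrame 14 (Run.forLtWp m 6
    (fun j s' => (∀ i < sp, s'.arr aStk i = s.arr aStk i) ∧ ∀ i < j, s'.arr aStk (sp + i) = X i)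
    (by simp) hs.len rfl rfl (by decide) (by omega) (by omega) (by decide) ?_) ?_ (by omega)
  · rintro j s' hj ⟨hI, hI'⟩ hx hF'
    have e1 : s'.vars xSp = sp := by rw [hF'.vars xSp rfl, hsp]
    simp only [Prog.wp, Expr.Safe, Op.Fits, Op.apply, Expr.val, hx, e1, State.set_arr,
      State.put_arr, true_and]
    refine ⟨by omega, by omega, by omega, fun i hi => ?_, fun i hi => ?_⟩
    · rw [if_neg (by omega), hI i hi]
    · split_ifs with h
      · rw [show i = j by omega, hF'.arr aX rfl, hs.arr j (by omega)]
      · exact hI' i (by omega)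
  rintro s₁ ⟨hI, hI'⟩ hF₁
  refine Run.imp (Prog.wp.run (Q := _) ?_) (by decide) fun _ h => h
  simp only [Prog.wp, Expr.Safe, Op.Fits, Op.apply, Expr.val, hF₁.vars xSp rfl, hF₁.vars xM rfl,
    hsp, hs.len, State.put_vars, State.set_vars, if_true, State.set_arr, true_and]
  refine ⟨by omega, by omega, by omega, ⟨sp, rfl, by simp, fun p hp => ?_, hF.congr fun i hi => ?_⟩,
    trivial⟩
  · rw [State.put_arr, if_neg (by omega), hI' p hp]
  · rw [State.put_arr, if_neg (by omega), hI i hi]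

theorem pop_run {M : Machine} {s : State} {m : ℕ} {X : ℕ → ℕ} {F : List (ℕ × (ℕ → ℕ))}
    (hX : IsStr m X) (hF : IsStack (s.arr aStk) ((m, X) :: F) (s.vars xSp))
    (hcap : s.vars xSp + m + 10 < M.cap) (hlen : s.vars xSp + m + 3 < M.len) :
    Run M pop s (20 * m + 40) fun s' => HasStr s' m X ∧ IsStack (s'.arr aStk) F (s'.vars xSp) ∧
      s'.vars xSp + m + 1 = s.vars xSp := by
  obtain ⟨b, h1, h2, h3, h4⟩ := hF
  have e0 : s.vars xSp - 1 = b + m := by omega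
  have e1 : s.vars xSp - (m + 1) = b := by omega
  refine Run.seq (t₁ := 5) (t₂ := 20 * m + 35) ?_ (by omega)
  refine Run.assign ?_ ?_ (by simp [Expr.cost])
  · simp only [Expr.Safe, Op.Fits, Op.apply, Expr.val, true_and]; omega
  simp only [Expr.val, Op.apply, e0, h2]
  refine Run.seq (t₁ := 6) (t₂ := 20 * m + 29) ?_ (by omega)
  refine Run.assign ?_ ?_ (by simp [Expr.cost])
  · simp only [Expr.Safe, Op.Fits, Expr.val, true_and, State.set_vars, Nat.reduceEqDiff,
      if_true, if_false]
    omega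
  simp only [Expr.val, Op.apply, State.set_vars, Nat.reduceEqDiff, if_true, if_false, e1]
  generalize hs₀ : State.set _ _ _ = s₀
  have m₀ : s₀.vars xM = m := by simp [← hs₀]
  have b₀ : s₀.vars xSp = b := by simp [← hs₀]
  have a₀ : s₀.arr aStk = s.arr aStk := by simp [← hs₀]
  clear hs₀
  refine Run.seqFrame 20 (Run.forLtWp m 6
    (fun j s' => ∀ i < j, s'.arr aX i = X i)
    (by simp) m₀ rfl rfl (by decide) (by omega) (by omega) (by decide) ?_) ?_ (by omega)
  · rintro j s' hj hI hx hF'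
    have e1 : s'.vars xSp = b := by rw [hF'.vars xSp rfl, b₀]
    simp only [Prog.wp, Expr.Safe, Op.Fits, Op.apply, Expr.val, hx, e1, State.set_arr,
      State.put_arr, true_and]
    refine ⟨by omega, by omega, fun i hi => ?_⟩
    split_ifs with h
    · rw [h, hF'.arr aStk rfl, a₀, h3 j hj]
    · exact hI i (by omega)
  rintro s₁ hI hF₁
  refine Run.imp (Prog.wp.run (Q := _) ?_) (by decide) fun _ h => h
  simp only [Prog.wp, Expr.Safe, Op.Fits, Op.apply, Expr.val, hF₁.vars xSp rfl, hF₁.vars xM rfl,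
    m₀, b₀, State.put_vars, true_and]
  refine ⟨by omega, by omega, by omega, by omega, by omega, by omega, by omega, by omega,
    ⟨by simp only [State.put_vars]; rw [hF₁.vars xM rfl, m₀], fun p hp => ?_⟩, ?_, by omega⟩
  · simp only [State.put_arr, true_and]
    by_cases h : p < m
    · rw [if_neg (by omega), if_neg (by omega), if_neg (by omega), hI p h]
    · rw [hX.zero p (by omega)]
      split_ifs <;> first | rfl | omega
  · refine h4.congr fun i hi => ?_
    simp only [State.put_arr, Nat.reduceEqDiff, false_and, if_false]
    rw [hF₁.arr aStk rfl, a₀]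

theorem Expr.val_lt_eq_zero {s : State} {e₁ e₂ : Expr} :
    (Expr.bin .lt e₁ e₂).val s = 0 ↔ e₂.val s ≤ e₁.val s := by
  simp [Expr.val, Op.apply]

/-- Reduce the string in `aX` to length `2`. -/
def descend : Prog := .while (.bin .lt (.lit 2) (.var xM)) (.seq push reduce)

/-- Rank the suffixes of all strings on the stack. -/
def ascend : Prog := .while (.bin .lt (.lit 0) (.var xSp)) (.seq pop combine)

/-- A reduction shortens a string of length `m ≥ 3` by `m / 3 ≥ 1`. Since `18 * (m / 3) ≥ m + 1`,
the stack stays below `18 * n`, and in the same way `9000 * (m / 3)` pays for the linear work. The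
descent stops at length `2` because `m - m / 3 = m` there. -/
theorem descend_run {M : Machine} {s : State} {n : ℕ} {X₀ : ℕ → ℕ} (hs : HasStr s n X₀)
    (hX₀ : IsStr n X₀) (hn : 2 ≤ n) (hsp : s.vars xSp = 0)
    (hcap : 1000 * n + 1000 ≤ M.cap) (hlen : 40 * n ≤ M.len) :
    Run M descend s (9000 * n + 4) fun s' => ∃ F X, HasStr s' 2 X ∧ IsStr 2 X ∧
      IsStack (s'.arr aStk) F (s'.vars xSp) ∧ IsReductionChain n X₀ F 2 X ∧
      s'.vars xSp ≤ 18 * n := by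
  refine (Run.loop (fun s => ∃ F m X, HasStr s m X ∧ IsStr m X ∧ 2 ≤ m ∧
      IsStack (s.arr aStk) F (s.vars xSp) ∧ IsReductionChain n X₀ F m X ∧
      s.vars xSp + 18 * m ≤ 18 * n) (fun s => 9000 * s.vars xM) ?_ ?_ ?_).imp ?_ ?_
  · exact ⟨[], n, X₀, hs, hX₀, hn, hsp, ⟨rfl, rfl⟩, by omega⟩
  · rintro s' - -
    simp only [Expr.Safe, Op.Fits, true_and]; omega
  · rintro s₁ ⟨F, m, X, hm, hX, h2, hF, hch, hsp₁⟩ - hv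
    rw [ne_eq, Expr.val_lt_eq_zero] at hv
    have hm3 : 2 < m := by simpa [Expr.val, hm.len] using hv
    refine ⟨620 * m + 720, Run.seqFrame (600 * m + 700) (push_run hm hF rfl (by omega) (by omega))
      ?_ (by linarith)⟩
    rintro s₂ ⟨hF₂, hsp₂⟩ hFr
    have H₂ : HasStr s₂ m X :=
      ⟨(hFr.vars xM rfl).trans hm.len, fun p hp => by rw [hFr.arr aX rfl, hm.arr p hp]⟩
    refine (reduce_run H₂ hX (by omega) (by omega)).frame.imp le_rfl ?_
    rintro s₃ ⟨⟨Y, hY, hY'⟩, hFr'⟩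
    have sp₃ : s₃.vars xSp = s₂.vars xSp := hFr'.vars xSp rfl
    refine ⟨⟨(m, X) :: F, _, Y, hY', hY.str, by omega, ?_, ⟨rfl, hX, hY, hch⟩, by omega⟩, ?_⟩
    · rw [sp₃, hFr'.arr aStk rfl]; exact hF₂
    · rw [hY'.len, hm.len]; simp only [Expr.cost]; omega
  · rw [hs.len]; simp [Expr.cost]
  · rintro s' ⟨⟨F, m, X, hm, hX, h2, hF, hch, hsp'⟩, hv⟩
    rw [Expr.val_lt_eq_zero] at hv
    have : m ≤ 2 := by simpa [Expr.val, hm.len] using hv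
    have : m = 2 := by omega
    subst this
    exact ⟨F, X, hm, hX, hF, hch, by omega⟩

/-- Popping a string of length `m₁` frees `m₁ + 1` cells, and `1100` steps for each of them pay for
combining; at most `18 * n` cells are in use. -/
theorem ascend_run {M : Machine} {s : State} {n m : ℕ} {X₀ X : ℕ → ℕ} {F : List (ℕ × (ℕ → ℕ))}
    (hs : HasStr s m X) (hR : IsRank m X (s.arr aR)) (hF : IsStack (s.arr aStk) F (s.vars xSp))
    (hch : IsReductionChain n X₀ F m X) (hsp : s.vars xSp ≤ 18 * n)
    (hcap : 1000 * n + 1000 ≤ M.cap) (hlen : 40 * n + 40 ≤ M.len) :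
    Run M ascend s (19800 * n + 4) fun s' => HasStr s' n X₀ ∧ IsRank n X₀ (s'.arr aR) := by
  refine (Run.loop (fun s => ∃ F m X, HasStr s m X ∧ IsRank m X (s.arr aR) ∧
      IsStack (s.arr aStk) F (s.vars xSp) ∧ IsReductionChain n X₀ F m X ∧
      s.vars xSp ≤ 18 * n) (fun s => 1100 * s.vars xSp) ?_ ?_ ?_).imp ?_ ?_
  · exact ⟨F, m, X, hs, hR, hF, hch, hsp⟩
  · rintro s' - -
    simp only [Expr.Safe, Op.Fits, true_and]; omega
  · rintro s₁ ⟨F, m, X, hm, hR, hF, hch, hsp₁⟩ - hv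
    rw [ne_eq, Expr.val_lt_eq_zero] at hv
    have hpos : 0 < s₁.vars xSp := by simpa [Expr.val, Nat.pos_iff_ne_zero] using hv
    rcases F with _ | ⟨⟨m₁, X₁⟩, F⟩
    · simp only [IsStack] at hF; omega
    obtain ⟨rfl, hX₁, hred, hch₁⟩ := hch
    have hm₁ : m₁ < s₁.vars xSp := by obtain ⟨b, hb, -⟩ := hF; omega
    refine ⟨620 * m₁ + 1040, Run.seqFrame (600 * m₁ + 1000)
      (pop_run hX₁ hF (by omega) (by omega)) ?_ (by linarith)⟩
    rintro s₂ ⟨H₂, hF₂, sp₂⟩ hFr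
    refine (combine_run H₂ hX₁ hred (by rw [hFr.arr aR rfl]; exact hR) (by omega)
      (by omega)).frame.imp le_rfl ?_
    rintro s₃ ⟨hR₃, hFr'⟩
    have sp₃ : s₃.vars xSp = s₂.vars xSp := hFr'.vars xSp rfl
    refine ⟨⟨F, m₁, X₁, ⟨(hFr'.vars xM rfl).trans H₂.len, fun p hp => ?_⟩, hR₃, ?_, hch₁, by omega⟩,
      ?_⟩
    · rw [hFr'.arr aX rfl, H₂.arr p hp]
    · rw [sp₃, hFr'.arr aStk rfl]; exact hF₂
    · simp only [Expr.cost]; omega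
  · simp only [Expr.cost]; omega
  · rintro s' ⟨⟨F, m, X, hm, hR, hF, hch, hsp'⟩, hv⟩
    rcases F with _ | ⟨⟨m₁, X₁⟩, F⟩
    · obtain ⟨rfl, rfl⟩ := hch
      exact ⟨hm, hR⟩
    · obtain ⟨b, hb, -⟩ := hF
      rw [Expr.val_lt_eq_zero] at hv
      simp only [Expr.val] at hv
      omega

/-- Rank the suffixes of the string in `aX`. -/
def rankSuffixes : Prog :=
  .seq (.assign xSp (.lit 0))
  (.seq descend
  (.seq (.ite (.bin .lt (.get aX (.lit 0)) (.get aX (.lit 1)))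
    (.seq (.store aR (.lit 0) (.lit 1)) (.seq (.store aR (.lit 1) (.lit 2))
      (.store aR (.lit 2) (.lit 0))))
    (.seq (.store aR (.lit 0) (.lit 2)) (.seq (.store aR (.lit 1) (.lit 1))
      (.store aR (.lit 2) (.lit 0)))))
  ascend))

/-- When the two letters are equal, the suffix of length one is a proper prefix of the other and
comes first; hence the strict test. -/
theorem isRank_two {X R : ℕ → ℕ} (hX : IsStr 2 X) (h2 : R 2 = 0)
    (h : X 0 < X 1 ∧ R 0 = 1 ∧ R 1 = 2 ∨ X 1 ≤ X 0 ∧ R 0 = 2 ∧ R 1 = 1) : IsRank 2 X R := by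
  have p0 := hX.pos 0 (by omega)
  have p1 := hX.pos 1 (by omega)
  have z2 := hX.zero 2 le_rfl
  have a01 : X 0 < X 1 → SLt X 0 1 := fun h => sLt_cons.2 (Or.inl h)
  have a20 : SLt X 2 0 := hX.sLt_length (by omega)
  have a21 : SLt X 2 1 := hX.sLt_length (by omega)
  have a10 : X 1 ≤ X 0 → SLt X 1 0 := fun h => by
    rw [sLt_cons]
    rcases h.lt_or_eq with h | h
    · exact Or.inl h
    · exact Or.inr ⟨h, hX.sLt_length (by omega)⟩
  have key : ∀ p ≤ 2, ∀ q ≤ 2, R p < R q → SLt X p q := by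
    intro p hp q hq hlt
    rcases h with ⟨h, r0, r1⟩ | ⟨h, r0, r1⟩ <;> interval_cases p <;> interval_cases q <;>
      first | omega | assumption | exact a01 h | exact a10 h
  have inj : ∀ p ≤ 2, ∀ q ≤ 2, R p = R q → p = q := by
    intro p hp q hq hlt
    rcases h with ⟨h, r0, r1⟩ | ⟨h, r0, r1⟩ <;> interval_cases p <;> interval_cases q <;> omega
  refine ⟨fun p hp => ?_, fun p hp q hq => ⟨key p hp q hq, fun h' => ?_⟩⟩
  · rcases h with ⟨h, r0, r1⟩ | ⟨h, r0, r1⟩ <;> interval_cases p <;> omega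
  · rcases lt_trichotomy (R p) (R q) with h1 | h1 | h1
    · exact h1
    · rw [inj p hp q hq h1] at h'; exact absurd h' sLt_irrefl
    · exact absurd h' (key q hq p hp h1).asymm

theorem rankSuffixes_run {M : Machine} {s : State} {n : ℕ} {X₀ : ℕ → ℕ} (hs : HasStr s n X₀)
    (hX₀ : IsStr n X₀) (hn : 2 ≤ n) (hcap : 1000 * n + 1000 ≤ M.cap)
    (hlen : 40 * n + 40 ≤ M.len) :
    Run M rankSuffixes s (30000 * n) fun s' => HasStr s' n X₀ ∧ IsRank n X₀ (s'.arr aR) := by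
  refine Run.seq (t₁ := 2) (t₂ := 30000 * n - 2) ?_ (by omega)
  refine Run.assign (by simp only [Expr.Safe]; omega) ?_ (by simp [Expr.cost])
  refine Run.seqFrame (20000 * n) (descend_run ⟨by simpa using hs.len, by simpa using hs.arr⟩
    hX₀ hn (by simp [Expr.val]) hcap (by omega)) ?_ (by omega)
  rintro s₁ ⟨F, X, H₁, hX, hF, hch, hsp⟩ -
  refine Run.seqFrame (19800 * n + 4) (Run.imp (t' := 40) (Prog.wp.run
    (Q := fun s' => IsRank 2 X (s'.arr aR)) ?_) (by decide) fun _ h => h) ?_ (by omega)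
  · have x0 := H₁.arr 0 (by omega)
    have x1 := H₁.arr 1 (by omega)
    simp only [Prog.wp, Expr.Safe, Op.Fits, Op.apply, Expr.val, x0, x1, ne_eq, ite_eq_right_iff,
      one_ne_zero, imp_false, not_lt]
    refine ⟨by omega, fun h => ⟨by omega, by omega, by omega, by omega, by omega, by omega, by omega,
      by omega, by omega, isRank_two hX (by simp) (by simpa using not_le.1 h)⟩,
      fun h => ⟨by omega, by omega, by omega, by omega, by omega, by omega, by omega,
      by omega, by omega, isRank_two hX (by simp) (by simp [h])⟩⟩
  · intro s₂ hR₂ hF₂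
    refine ascend_run (F := F) (X := X) ⟨(hF₂.vars xM rfl).trans H₁.len, fun p hp => ?_⟩ hR₂ ?_ hch
      ?_ hcap hlen
    · rw [hF₂.arr aX rfl, H₁.arr p hp]
    · rw [hF₂.vars xSp rfl, hF₂.arr aStk rfl]; exact hF
    · rw [hF₂.vars xSp rfl]; exact hsp

end Suffixient

namespace Suffixient

/-! ### The suffix array and the Burrows–Wheeler transform -/

notation "xH" => (30 : ℕ)
notation "xR" => (31 : ℕ)

/-- Fill the suffix array and the Burrows–Wheeler transform. -/
def invertRanks : Prog :=
  .forLt xI (.lit 0) xM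
    (.seq (.store aSA (.get aR (.var xI)) (.bin .add (.var xI) (.lit 1)))
    (.ite (.bin .eq (.var xI) (.lit 0))
      (.store aBWT (.get aR (.var xI)) (.get aX (.bin .sub (.var xM) (.lit 1))))
      (.store aBWT (.get aR (.var xI)) (.get aX (.bin .sub (.var xI) (.lit 1))))))

/-- Positions of `X` count from `0` but entries of the suffix array from `1`. The letter before the
whole string is, cyclically, its last one. -/
theorem invertRanks_run {M : Machine} {s : State} {n : ℕ} {X R : ℕ → ℕ} (hs : HasStr s n X)
    (hX : IsStr n X) (hR : IsRank n X R) (hRs : s.arr aR = R) (hn : 2 ≤ n)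
    (hcap : 1000 * n + 1000 ≤ M.cap) (hlen : 40 * n + 40 ≤ M.len) :
    Run M invertRanks s (50 * n) fun s' => ∀ p < n, s'.arr aSA (R p) = p + 1 ∧
      s'.arr aBWT (R p) = X (if p = 0 then n - 1 else p - 1) := by
  refine (Run.forLtWp n 36 (fun j s => ∀ p < j, s.arr aSA (R p) = p + 1 ∧
    s.arr aBWT (R p) = X (if p = 0 then n - 1 else p - 1)) (by simp) hs.len rfl rfl (by decide)
    (by omega) (by omega) (by decide) ?_).imp (by omega) fun _ h => h
  intro j s' hj hI hx hF
  have e1 : s'.arr aR = R := by rw [hF.arr aR rfl, hRs]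
  have e2 : s'.vars xM = n := by rw [hF.vars xM rfl, hs.len]
  have e3 : ∀ p ≤ n + 2, s'.arr aX p = X p := fun p hp => by rw [hF.arr aX rfl, hs.arr p hp]
  have e4 := hR.le j hj.le
  have ne : ∀ p < j, R p ≠ R j := fun p hp h => by
    have := hR.inj hX (show p ≤ n by omega) hj.le h; omega
  simp only [Prog.wp, Expr.Safe, Op.Fits, Op.apply, Expr.val, hx, e1, e2, State.set_arr,
    State.put_vars, State.put_arr, true_and, ne_eq, ite_eq_right_iff, one_ne_zero, imp_false,
    false_and, if_false, not_not, aSA, aBWT, OfNat.ofNat_ne_one,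
    OfNat.one_ne_ofNat]
  refine ⟨by omega, by omega, by omega, by omega, fun h => ⟨by omega, by omega, by omega,
    fun p hp => ?_⟩, fun h => ⟨by omega, by omega, by omega, fun p hp => ?_⟩⟩
  · rcases Nat.lt_succ_iff_lt_or_eq.1 hp with hp | rfl
    · rw [if_neg (ne p hp), if_neg (ne p hp)]; exact hI p hp
    · rw [if_pos rfl, if_pos rfl, e3 _ (by omega)]; simp [h]
  · rcases Nat.lt_succ_iff_lt_or_eq.1 hp with hp | rfl
    · rw [if_neg (ne p hp), if_neg (ne p hp)]; exact hI p hp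
    · rw [if_pos rfl, if_pos rfl, e3 _ (by omega)]; simp [h]

/-! ### The longest common prefix array -/

/-- `k` is the length of the longest common prefix of the suffixes at `p` and `q`. -/
def IsLcp (X : ℕ → ℕ) (p q k : ℕ) : Prop := Agree X k p q ∧ X (p + k) ≠ X (q + k)

/-- Drop the common first letter: suffix `q + 1` is still below suffix `k + 1` and agrees with it on
`h - 1` letters. The direct predecessor `q'` of `k + 1` is `q + 1` or lies between the two, so it
agrees at least as far. -/
theorem IsRank.agree_succ_pred {n : ℕ} {X R : ℕ → ℕ} (hX : IsStr n X) (hR : IsRank n X R)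
    {k q q' h : ℕ} (hk : k < n) (hq : q < n) (hq' : q' < n) (hkq : R k = R q + 1)
    (hkq' : R (k + 1) = R q' + 1) (ha : Agree X h k q) : Agree X (h - 1) (k + 1) q' := by
  rcases h with _ | h
  · exact agree_zero
  obtain ⟨h0, h1⟩ := agree_succ.1 ha
  have lt : SLt X q k := (hR.lt_iff q hq.le k hk.le).1 (by omega)
  have lt' : SLt X (q + 1) (k + 1) := by
    rcases sLt_cons.1 lt with h | h
    · omega
    · exact h.2
  have h2 := (hR.lt_iff _ (by omega) _ (by omega)).2 lt'
  have lt3 : SLt X q' (k + 1) := (hR.lt_iff _ hq'.le _ (by omega)).1 (by omega)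
  simp only [Nat.add_sub_cancel]
  rcases Nat.lt_or_ge (R (q + 1)) (R q') with h3 | h3
  · have lt4 := (hR.lt_iff (q + 1) (by omega) q' hq'.le).1 h3
    exact h1.trans (h1.symm.of_sLt_of_sLt lt4 lt3)
  · rw [← hR.inj hX (show q + 1 ≤ n by omega) hq'.le (by omega)]
    exact h1

/-- With two matching letters, suffix `q + 1` would be nonempty and below suffix `k + 1`, so the
latter could not have rank `1`. Thus resetting the match length at rank `1` forfeits nothing. -/
theorem IsRank.le_one_of_succ_first {n : ℕ} {X R : ℕ → ℕ} (hX : IsStr n X) (hR : IsRank n X R)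
    {k q h : ℕ} (hk : k < n) (hq : q < n) (hkq : R k = R q + 1) (hk1 : R (k + 1) = 1)
    (ha : Agree X h k q) : h ≤ 1 := by
  by_contra hh
  have hne : k ≠ q := fun h => by rw [h] at hkq; omega
  have hle := hX.agree_le hk.le hq.le hne ha
  have lt : SLt X q k := (hR.lt_iff q hq.le k hk.le).1 (by omega)
  have h0 := ha 0 (by omega)
  rcases sLt_cons.1 lt with h' | h'
  · simp only [Nat.add_zero] at h0; omega
  · have h2 := (hR.lt_iff _ (by omega) _ (by omega)).2 h'.2
    have := hR.pos hX (show q + 1 < n by omega)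
    omega

def lcpScan : Prog :=
  .while (.bin .eq (.get aX (.bin .add (.var xI) (.var xH)))
      (.get aX (.bin .add (.var xQ) (.var xH))))
    (.assign xH (.bin .add (.var xH) (.lit 1)))

/-- A matching letter costs `14` steps and raises the match length, which is at most `n - p`; the
final test costs `10`. -/
theorem lcpScan_run {M : Machine} {s : State} {n p q : ℕ} {X : ℕ → ℕ}
    (hXs : ∀ p ≤ n + 2, s.arr aX p = X p) (hX : IsStr n X) (hp : p < n) (hq : q < n) (hpq : p ≠ q)
    (hps : s.vars xI = p) (hqs : s.vars xQ = q) (hh : Agree X (s.vars xH) p q)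
    (hcap : 1000 * n + 1000 ≤ M.cap) (hlen : 40 * n + 40 ≤ M.len) :
    RunT M lcpScan s fun t s' => IsLcp X p q (s'.vars xH) ∧
      t + 14 * (n - p - s'.vars xH) ≤ 14 * (n - p - s.vars xH) + 10 := by
  refine (RunT.loop (fun s => Agree X (s.vars xH) p q) (fun s => 14 * (n - p - s.vars xH)) hh
    ?_ ?_).frame.imp ?_
  · intro s' h hF
    have := hX.agree_le hp.le hq.le hpq h
    simp only [Expr.Safe, Op.Fits, Op.apply, Expr.val, hF.vars xI rfl, hF.vars xQ rfl, hps, hqs,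
      true_and]
    omega
  · intro s' h hF hv
    have h1 := hX.agree_le hp.le hq.le hpq h
    simp only [Expr.val, Op.apply, hF.vars xI rfl, hF.vars xQ rfl, hps, hqs, hF.arr aX rfl,
      ne_eq, ite_eq_right_iff, one_ne_zero, imp_false, not_not] at hv
    rw [hXs _ (by omega), hXs _ (by omega)] at hv
    have h2 : Agree X (s'.vars xH + 1) p q := by
      intro j hj
      rcases Nat.lt_succ_iff_lt_or_eq.1 hj with hj | rfl
      · exact h j hj
      · exact hv
    have h3 := hX.agree_le hp.le hq.le hpq h2
    refine (Run.assign (t := 4) ?_ (Q := fun s'' => s''.vars xH = s'.vars xH + 1) ?_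
      (by simp [Expr.cost])).toRunT ?_
    · simp only [Expr.Safe, Op.Fits, Expr.val, true_and]; omega
    · simp [Expr.val, Op.apply]
    · intro u s'' hu e _
      refine ⟨e ▸ h2, ?_⟩
      simp only [Expr.cost, e]; omega
  · rintro t s' ⟨⟨⟨h1, h2⟩, h3⟩, hF⟩
    have h4 := hX.agree_le hp.le hq.le hpq h1
    simp only [Expr.val, Op.apply, hF.vars xI rfl, hF.vars xQ rfl, hps, hqs, hF.arr aX rfl,
      ite_eq_right_iff, one_ne_zero, imp_false] at h2
    rw [hXs _ (by omega), hXs _ (by omega)] at h2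
    exact ⟨⟨h1, h2⟩, by simpa [Expr.cost] using h3⟩

/-- Fill the array of the longest common prefixes. -/
def lcpArray : Prog :=
  .seq (.assign xH (.lit 0)) (.seq (.assign xI (.lit 0))
  (.while (.bin .lt (.var xI) (.var xM))
    (.seq (.seq (.assign xR (.get aR (.var xI)))
      (.ite (.bin .lt (.lit 1) (.var xR))
        (.seq (.assign xQ (.bin .sub (.get aSA (.bin .sub (.var xR) (.lit 1))) (.lit 1)))
        (.seq lcpScan
        (.seq (.store aLCP (.var xR) (.var xH))
          (.assign xH (.bin .sub (.var xH) (.lit 1))))))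
        (.assign xH (.lit 0))))
      (.assign xI (.bin .add (.var xI) (.lit 1))))))

theorem lcpArray_run {M : Machine} {s : State} {n : ℕ} {X R : ℕ → ℕ} (hs : HasStr s n X)
    (hX : IsStr n X) (hR : IsRank n X R) (hRs : s.arr aR = R)
    (hSA : ∀ p < n, s.arr aSA (R p) = p + 1) (hn : 2 ≤ n)
    (hcap : 1000 * n + 1000 ≤ M.cap) (hlen : 40 * n + 40 ≤ M.len) :
    Run M lcpArray s (100 * n) fun s' => ∀ p < n, ∀ q < n, R p = R q + 1 →
      IsLcp X p q (s'.arr aLCP (R p)) := by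
  refine Run.seq (t₁ := 2) (t₂ := 100 * n - 2) ?_ (by omega)
  refine Run.assign (by simp only [Expr.Safe]; omega) ?_ (by simp [Expr.cost])
  refine Run.seq (t₁ := 2) (t₂ := 100 * n - 4) ?_ (by omega)
  refine Run.assign (by simp only [Expr.Safe]; omega) ?_ (by simp [Expr.cost])
  simp only [Expr.val]
  generalize hs₀ : State.set _ _ _ = s₀
  have i₀ : s₀.vars xI = 0 := by simp [← hs₀]
  have h₀ : s₀.vars xH = 0 := by simp [← hs₀]
  have m₀ : s₀.vars xM = n := by simp [← hs₀, hs.len]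
  have X₀ : ∀ p ≤ n + 2, s₀.arr aX p = X p := by simpa [← hs₀] using hs.arr
  have R₀ : s₀.arr aR = R := by simp [← hs₀, hRs]
  have A₀ : s₀.arr aSA = s.arr aSA := by simp [← hs₀]
  clear hs₀
  generalize s.arr aSA = A at hSA A₀
  -- Moving to the next position and lowering the match length by one leave `n - k - xH` unchanged,
  -- so each matching letter is paid for once. The last clause ensures that the reset at rank `1`
  -- does not raise the potential.
  refine (RunT.count 0 n (fun k s => (∀ p < k, ∀ q < n, R p = R q + 1 →
      IsLcp X p q (s.arr aLCP (R p))) ∧ k + s.vars xH ≤ n ∧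
      (k < n → ∀ q < n, R k = R q + 1 → Agree X (s.vars xH) k q) ∧
      (k < n → R k = 1 → s.vars xH = 0))
    (fun s => 60 * (n - s.vars xI) + 14 * (n - s.vars xI - s.vars xH)) i₀ m₀ (by omega)
    ⟨by simp, by omega, fun _ q _ _ => by rw [h₀]; exact agree_zero, fun _ _ => h₀⟩
    rfl rfl (by decide) (by omega)
    (by omega) ?_).imp (by rw [i₀, h₀]; omega) fun s' h => h.1
  rintro k s' - hk ⟨hI, hkh, hag, hz⟩ hx hF
  have e1 : s'.arr aR = R := by rw [hF.arr aR rfl, R₀]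
  have e2 : s'.arr aSA = A := by rw [hF.arr aSA rfl, A₀]
  have e3 : ∀ p ≤ n + 2, s'.arr aX p = X p := fun p hp => by rw [hF.arr aX rfl, X₀ p hp]
  have hRk := hR.le k hk.le
  have hRk1 := hR.pos hX hk
  refine RunT.seq ((Run.assign (t := 3) (Q := fun s₁ => s₁.vars xR = R k) ?_ ?_
    (by simp [Expr.cost])).toRunT ?_)
  · simp only [Expr.Safe, Expr.val, hx, true_and]; omega
  · simp [Expr.val, hx, e1]
  intro u s₁ hu r₁ hF₁
  have x₁ : s₁.vars xI = k := by rw [hF₁.vars xI rfl, hx]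
  have h₁ : s₁.vars xH = s'.vars xH := hF₁.vars xH rfl
  refine RunT.ite (by simp only [Expr.Safe, Op.Fits, true_and]; omega) ?_ ?_
  · intro hv
    rw [ne_eq, Expr.val_lt_eq_zero] at hv
    simp only [Expr.val, r₁, not_le] at hv
    obtain ⟨q, hq, eq⟩ := hR.surj hX (show R k - 1 ≤ n by omega)
    have hqn : q < n := by
      rcases hq.lt_or_eq with h | h
      · exact h
      · have := hR.length hX; rw [← h] at this; omega
    have hkq : R k = R q + 1 := by omega
    have hne : k ≠ q := fun h => by rw [h] at hkq; omega
    refine RunT.seq ((Run.assign (t := 7) (Q := fun s₂ => s₂.vars xQ = q) ?_ ?_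
      (by simp [Expr.cost])).toRunT ?_)
    · simp only [Expr.Safe, Op.Fits, Op.apply, Expr.val, r₁, hF₁.arr aSA rfl, e2, ← eq, true_and,
        hSA q hqn]
      omega
    · simp only [Expr.val, Op.apply, r₁, hF₁.arr aSA rfl, e2, ← eq, hSA q hqn, State.set_vars,
        if_true]
      omega
    intro u₂ s₂ hu₂ q₂ hF₂
    have h₂ : s₂.vars xH = s'.vars xH := by rw [hF₂.vars xH rfl, h₁]
    have x₂ : s₂.vars xI = k := by rw [hF₂.vars xI rfl, x₁]
    refine RunT.seq ((lcpScan_run (p := k) (q := q) (n := n) (X := X) ?_ hX hk hqn hne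
      x₂ q₂ ?_ hcap hlen).frame.imp ?_)
    · intro p hp; rw [hF₂.arr aX rfl, hF₁.arr aX rfl, e3 p hp]
    · rw [h₂]; exact hag hk q hqn hkq
    rintro u₃ s₃ ⟨⟨hl, hu₃⟩, hF₃⟩
    have r₃ : s₃.vars xR = R k := by rw [hF₃.vars xR rfl, hF₂.vars xR rfl, r₁]
    have L₃ : s₃.arr aLCP = s'.arr aLCP := by
      rw [hF₃.arr aLCP rfl, hF₂.arr aLCP rfl, hF₁.arr aLCP rfl]
    have b₃ := hX.agree_le hk.le hqn.le hne hl.1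
    refine (Prog.wp.run (Q := fun s₄ => s₄.vars xH = s₃.vars xH - 1 ∧ ∀ i, s₄.arr aLCP i =
      if i = R k then s₃.vars xH else s'.arr aLCP i) ?_).toRunT ?_
    · simp only [Prog.wp, Expr.Safe, Op.Fits, Op.apply, Expr.val, r₃, State.put_vars,
        State.set_vars, if_true, State.set_arr, State.put_arr, true_and, L₃]
      exact ⟨by omega, by omega, fun i => trivial⟩
    rintro u₄ s₄ hu₄ ⟨h₄, L₄⟩ -
    simp only [Prog.cost, Expr.cost] at hu₄
    refine ⟨⟨?_, ?_, ?_, ?_⟩, ?_⟩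
    · intro p hp q' hq' hpq
      simp only [State.set_arr, L₄]
      rcases Nat.lt_succ_iff_lt_or_eq.1 hp with hp | rfl
      · rw [if_neg]
        · exact hI p hp q' hq' hpq
        · intro h; have := hR.inj hX (show p ≤ n by omega) hk.le h; omega
      · rw [if_pos rfl, hR.inj hX hq'.le hqn.le (by omega)]
        exact hl
    · simp only [State.set_vars, Nat.reduceEqDiff, if_false, h₄]; omega
    · intro hk1 q' hq' hkq'
      simp only [State.set_vars, Nat.reduceEqDiff, if_false, h₄]
      exact hR.agree_succ_pred hX hk hqn hq' hkq hkq' hl.1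
    · intro _ hk1
      have := hR.le_one_of_succ_first hX hk hqn hkq hk1 hl.1
      simp only [State.set_vars, Nat.reduceEqDiff, if_false, h₄]; omega
    · simp only [State.set_vars, Nat.reduceEqDiff, if_false, if_true, h₄, hx, Expr.cost]
      rw [h₂] at hu₃
      omega
  · intro hv
    rw [Expr.val_lt_eq_zero] at hv
    simp only [Expr.val, r₁] at hv
    refine (Run.assign (t := 2) (Q := fun s₂ => s₂.vars xH = 0) ?_ ?_
      (by simp [Expr.cost])).toRunT ?_
    · simp only [Expr.Safe]; omega
    · simp [Expr.val]
    intro u₂ s₂ hu₂ z₂ hF₂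
    have L₂ : s₂.arr aLCP = s'.arr aLCP := by rw [hF₂.arr aLCP rfl, hF₁.arr aLCP rfl]
    refine ⟨⟨?_, ?_, ?_, ?_⟩, ?_⟩
    · intro p hp q hq hpq
      simp only [State.set_arr, L₂]
      rcases Nat.lt_succ_iff_lt_or_eq.1 hp with hp | rfl
      · exact hI p hp q hq hpq
      · have := hR.pos hX hq; omega
    · simp only [State.set_vars, Nat.reduceEqDiff, if_false, z₂]; omega
    · intro _ q _ _
      simp only [State.set_vars, Nat.reduceEqDiff, if_false, z₂]
      exact agree_zero
    · intro _ _
      simp only [State.set_vars, Nat.reduceEqDiff, if_false, z₂]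
    · have := hz hk (by omega)
      simp only [State.set_vars, Nat.reduceEqDiff, if_false, if_true, z₂, hx, Expr.cost]
      omega

end Suffixient

namespace Suffixient

/-! ### Previous and next smaller values -/

theorem psv_cases (L : ℕ → ℕ) (i : ℕ) :
    PSV L i = 0 ∨ 2 ≤ PSV L i ∧ PSV L i < i ∧ L (PSV L i) < L i := by
  have h := Finset.max'_mem _ (Finset.insert_nonempty 0 ((Finset.Ico 2 i).filter fun j => L j < L i))
  rwa [Finset.mem_insert, Finset.mem_filter, Finset.mem_Ico, and_assoc] at h

theorem le_of_psv_lt {L : ℕ → ℕ} {i k : ℕ} (hk : 2 ≤ k) (h : PSV L i < k) (hki : k < i) :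
    L i ≤ L k := by
  by_contra hlt
  have : k ≤ PSV L i := Finset.le_max' _ _ (by simp; omega)
  omega

theorem psv_eq {L : ℕ → ℕ} {i v : ℕ} (hv : v = 0 ∨ 2 ≤ v ∧ v < i ∧ L v < L i)
    (h : ∀ k, 2 ≤ k → v < k → k < i → L i ≤ L k) : PSV L i = v := by
  have h1 := psv_cases L i
  rcases lt_trichotomy (PSV L i) v with hlt | he | hlt
  · have := le_of_psv_lt (L := L) (i := i) (k := v) (by omega) hlt (by omega); omega
  · exact he
  · have := h (PSV L i) (by omega) hlt (by omega); omega

theorem psv_lt {L : ℕ → ℕ} {i : ℕ} (hi : 2 ≤ i) : PSV L i < i := by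
  have := psv_cases L i; omega

theorem nsv_cases (n : ℕ) (L : ℕ → ℕ) (i : ℕ) :
    NSV n L i = n + 1 ∨ i < NSV n L i ∧ NSV n L i ≤ n ∧ L (NSV n L i) < L i := by
  have h := Finset.min'_mem _
    (Finset.insert_nonempty (n + 1) ((Finset.Ioc i n).filter fun j => L j < L i))
  rwa [Finset.mem_insert, Finset.mem_filter, Finset.mem_Ioc, and_assoc] at h

theorem le_of_lt_nsv {n : ℕ} {L : ℕ → ℕ} {i k : ℕ} (h : k < NSV n L i) (hki : i < k) :
    L i ≤ L k := by
  by_contra hlt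
  have h1 := nsv_cases n L i
  have : NSV n L i ≤ k := Finset.min'_le _ _ (by simp; omega)
  omega

theorem nsv_eq {n : ℕ} {L : ℕ → ℕ} {i v : ℕ} (hv : v = n + 1 ∨ i < v ∧ v ≤ n ∧ L v < L i)
    (h : ∀ k, i < k → k < v → L i ≤ L k) : NSV n L i = v := by
  have h1 := nsv_cases n L i
  rcases lt_trichotomy (NSV n L i) v with hlt | he | hlt
  · have := h (NSV n L i) (by omega) hlt; omega
  · exact he
  · have := le_of_lt_nsv (n := n) (L := L) (i := i) (k := v) hlt (by omega); omega

theorem lt_nsv {n : ℕ} {L : ℕ → ℕ} {i : ℕ} (hi : i ≤ n) : i < NSV n L i := by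
  have := nsv_cases n L i; omega

/-- The program works on its own array, which agrees with the LCP array only on `[2, n]`. -/
theorem psv_congr {n : ℕ} {L L' : ℕ → ℕ} (h : ∀ i, 2 ≤ i → i ≤ n → L i = L' i) {i : ℕ}
    (hi : 2 ≤ i) (hin : i ≤ n) : PSV L i = PSV L' i := by
  have h1 := psv_cases L' i
  have h2 := h i hi hin
  refine psv_eq ?_ fun k hk hk' hki => ?_
  · rcases h1 with h1 | h1
    · exact Or.inl h1
    · refine Or.inr ⟨h1.1, h1.2.1, ?_⟩
      rw [h _ h1.1 (by omega), h2]; exact h1.2.2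
  · rw [h2, h k hk (by omega)]; exact le_of_psv_lt hk hk' hki

theorem nsv_congr {n : ℕ} {L L' : ℕ → ℕ} (h : ∀ i, 2 ≤ i → i ≤ n → L i = L' i) {i : ℕ}
    (hi : 2 ≤ i) (hin : i ≤ n) : NSV n L i = NSV n L' i := by
  have h1 := nsv_cases n L' i
  have h2 := h i hi hin
  refine nsv_eq ?_ fun k hk hk' => ?_
  · rcases h1 with h1 | h1
    · exact Or.inl h1
    · refine Or.inr ⟨h1.1, h1.2.1, ?_⟩
      rw [h _ (by omega) h1.2.1, h2]; exact h1.2.2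
  · rw [h2, h k (by omega) (by omega)]; exact le_of_lt_nsv hk' hk

/-- The length of the chain of previous smaller values. -/
def psvDepth (L : ℕ → ℕ) (j : ℕ) : ℕ :=
  if h : 2 ≤ j then psvDepth L (PSV L j) + 1 else 0
termination_by j
decreasing_by exact psv_lt h

/-- The length of the chain of next smaller values. -/
def nsvDepth (n : ℕ) (L : ℕ → ℕ) (j : ℕ) : ℕ :=
  if h : j ≤ n then nsvDepth n L (NSV n L j) + 1 else 0
termination_by n + 1 - j
decreasing_by have := lt_nsv (L := L) h; omega

theorem psvDepth_eq {L : ℕ → ℕ} {j : ℕ} (h : 2 ≤ j) :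
    psvDepth L j = psvDepth L (PSV L j) + 1 := by
  rw [psvDepth, dif_pos h]

theorem psvDepth_of_lt {L : ℕ → ℕ} {j : ℕ} (h : j < 2) : psvDepth L j = 0 := by
  rw [psvDepth, dif_neg (by omega)]

theorem nsvDepth_eq {n : ℕ} {L : ℕ → ℕ} {j : ℕ} (h : j ≤ n) :
    nsvDepth n L j = nsvDepth n L (NSV n L j) + 1 := by
  rw [nsvDepth, dif_pos h]

theorem nsvDepth_of_lt {n : ℕ} {L : ℕ → ℕ} {j : ℕ} (h : n < j) : nsvDepth n L j = 0 := by
  rw [nsvDepth, dif_neg (by omega)]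

theorem Expr.val_and_eq_zero {s : State} {e₁ e₂ e₃ e₄ : Expr} :
    (Expr.bin .mul (.bin .le e₁ e₂) (.bin .le e₃ e₄)).val s = 0 ↔
      ¬ (e₁.val s ≤ e₂.val s ∧ e₃.val s ≤ e₄.val s) := by
  simp only [Expr.val, Op.apply]
  split_ifs <;> simp_all

theorem Op.apply_le_mul_lt {a b c d k : ℕ} (h : 1 < k) :
    Op.apply .le a b * Op.apply .le c d < k := by
  simp only [Op.apply]
  split_ifs <;> omega

def psvScan : Prog :=
  .while (.bin .mul (.bin .le (.lit 2) (.var xJ))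
      (.bin .le (.get aLCP (.var xI)) (.get aLCP (.var xJ))))
    (.assign xJ (.get aPSV (.var xJ)))

/-- A jump from `j` to `PSV[j]` passes only entries at least `L j`, hence at least `L i`. Each jump
lowers the depth of the chain by one, while the depth of `i` exceeds that of `PSV[i]` by just one;
so all jumps together are linear in number. -/
theorem psvScan_run {M : Machine} {s : State} {i : ℕ} {L : ℕ → ℕ} (hL : s.arr aLCP = L)
    (hi : 2 ≤ i) (his : s.vars xI = i) (hj : s.vars xJ = i - 1)
    (hP : ∀ j, 2 ≤ j → j < i → s.arr aPSV j = PSV L j)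
    (hcap : 10 ≤ M.cap) (hlen : i < M.len) :
    RunT M psvScan s fun t s' => (if 2 ≤ s'.vars xJ then s'.vars xJ else 0) = PSV L i ∧
      s'.vars xJ < i ∧
      t + 13 * psvDepth L (PSV L i) ≤ 13 * psvDepth L (i - 1) + 10 := by
  refine (RunT.loop (fun s => s.vars xJ < i ∧ ∀ k, 2 ≤ k → s.vars xJ < k → k < i → L i ≤ L k)
    (fun s => 13 * psvDepth L (s.vars xJ)) ⟨by omega, fun k _ _ _ => by omega⟩
    ?_ ?_).frame.imp ?_
  · rintro s' ⟨h1, h2⟩ hF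
    simp only [Expr.Safe, Op.Fits, Expr.val, hF.vars xI rfl, his, true_and]
    -- Both factors of the test are evaluated, so the array access must be in bounds also when `xJ`
    -- is `0` or `1`.
    exact ⟨by omega, by omega, Op.apply_le_mul_lt (by omega)⟩
  · rintro s' ⟨h1, h2⟩ hF hv
    rw [ne_eq, Expr.val_and_eq_zero, not_not] at hv
    simp only [Expr.val, hF.vars xI rfl, his, hF.arr aLCP rfl, hL] at hv
    have hp : s'.arr aPSV (s'.vars xJ) = PSV L (s'.vars xJ) := by
      rw [hF.arr aPSV rfl, hP _ hv.1 h1]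
    refine (Run.assign (t := 3) ?_ (Q := fun s'' => s''.vars xJ = PSV L (s'.vars xJ)) ?_
      (by simp [Expr.cost])).toRunT ?_
    · simp only [Expr.Safe, Expr.val, true_and]; omega
    · simpa [Expr.val] using hp
    · intro u s'' hu e _
      have hlt := psv_lt (L := L) hv.1
      refine ⟨⟨by omega, fun k hk hk' hki => ?_⟩, ?_⟩
      · rcases lt_trichotomy k (s'.vars xJ) with h | h | h
        · exact hv.2.trans (le_of_psv_lt hk (by omega) h)
        · rw [h]; exact hv.2
        · exact h2 k hk h hki
      · rw [e, psvDepth_eq hv.1]; simp only [Expr.cost]; omega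
  · rintro t s' ⟨⟨⟨⟨h1, h2⟩, hv⟩, h3⟩, hF⟩
    rw [Expr.val_and_eq_zero] at hv
    simp only [Expr.val, hF.vars xI rfl, his, hF.arr aLCP rfl, hL, not_and, not_le] at hv
    simp only [Expr.cost, hj] at h3
    by_cases h : 2 ≤ s'.vars xJ
    · have e : PSV L i = s'.vars xJ := psv_eq (Or.inr ⟨h, h1, hv h⟩) h2
      rw [if_pos h, e]
      exact ⟨rfl, h1, h3⟩
    · have e : PSV L i = 0 := psv_eq (Or.inl rfl) fun k hk _ hki => h2 k hk (by omega) hki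
      rw [if_neg h, e, psvDepth_of_lt (by omega)]
      rw [psvDepth_of_lt (show s'.vars xJ < 2 by omega)] at h3
      exact ⟨rfl, h1, h3⟩

/-- Fill the array of the previous smaller values. -/
def psvArray : Prog :=
  .seq (.assign xTot (.bin .add (.var xM) (.lit 1))) (.seq (.assign xI (.lit 2))
  (.while (.bin .lt (.var xI) (.var xTot))
    (.seq (.seq (.assign xJ (.bin .sub (.var xI) (.lit 1)))
      (.seq psvScan
        (.store aPSV (.var xI) (.bin .mul (.var xJ) (.bin .le (.lit 2) (.var xJ))))))
      (.assign xI (.bin .add (.var xI) (.lit 1))))))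

theorem Op.apply_mul (a b : ℕ) : Op.apply .mul a b = a * b := rfl

theorem psvArray_run {M : Machine} {s : State} {n : ℕ} {L : ℕ → ℕ} (hL : s.arr aLCP = L)
    (hm : s.vars xM = n) (hn : 2 ≤ n)
    (hcap : 1000 * n + 1000 ≤ M.cap) (hlen : 40 * n + 40 ≤ M.len) :
    Run M psvArray s (70 * n) fun s' => ∀ i, 2 ≤ i → i ≤ n → s'.arr aPSV i = PSV L i := by
  refine Run.seq (t₁ := 4) (t₂ := 70 * n - 4) ?_ (by omega)
  refine Run.assign ?_ ?_ (by simp [Expr.cost])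
  · simp only [Expr.Safe, Op.Fits, Expr.val, hm, true_and]; omega
  refine Run.seq (t₁ := 2) (t₂ := 70 * n - 6) ?_ (by omega)
  refine Run.assign (by simp only [Expr.Safe]; omega) ?_ (by simp [Expr.cost])
  simp only [Expr.val, Op.apply, hm]
  generalize hs₀ : State.set _ _ _ = s₀
  have i₀ : s₀.vars xI = 2 := by simp [← hs₀]
  have t₀ : s₀.vars xTot = n + 1 := by simp [← hs₀]
  have L₀ : s₀.arr aLCP = L := by simp [← hs₀, hL]
  clear hs₀
  refine (RunT.count 2 (n + 1) (fun k s => ∀ i, 2 ≤ i → i < k → s.arr aPSV i = PSV L i)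
    (fun s => 60 * (n + 1 - s.vars xI) + 13 * psvDepth L (s.vars xI - 1)) i₀ t₀ (by omega)
    (fun i _ _ => by omega) rfl rfl (by decide) (by omega) (by omega) ?_).imp ?_
    fun s' h i hi hin => h i hi (by omega)
  · rintro k s' hk2 hk hI hx hF
    refine RunT.seq ((Run.assign (t := 4) (Q := fun s₁ => s₁.vars xJ = k - 1) ?_ ?_
      (by simp [Expr.cost])).toRunT ?_)
    · simp only [Expr.Safe, Op.Fits, Expr.val, hx, true_and]; omega
    · simp [Expr.val, Op.apply, hx]
    intro u s₁ hu j₁ hF₁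
    have x₁ : s₁.vars xI = k := by rw [hF₁.vars xI rfl, hx]
    refine RunT.seq ((psvScan_run (L := L) ?_ hk2 x₁ j₁ ?_ (by omega) (by omega)).frame.imp ?_)
    · rw [hF₁.arr aLCP rfl, hF.arr aLCP rfl, L₀]
    · rw [hF₁.arr aPSV rfl]; exact hI
    rintro u₂ s₂ ⟨⟨h1, h2, h3⟩, hF₂⟩
    have x₂ : s₂.vars xI = k := by rw [hF₂.vars xI rfl, x₁]
    refine (Prog.wp.run (Q := fun s₃ => ∀ i, s₃.arr aPSV i =
      if i = k then PSV L k else s'.arr aPSV i) ?_).toRunT ?_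
    · have hv : s₂.vars xJ * Op.apply .le 2 (s₂.vars xJ) = PSV L k := by
        rw [← h1]; simp only [Op.apply]; split_ifs <;> simp
      have := psv_lt (L := L) hk2
      simp only [Prog.wp, Expr.Safe, Op.Fits, Op.apply_mul, Expr.val, x₂, State.put_arr, true_and,
        hv]
      refine ⟨by omega, by omega, fun i => ?_⟩
      rw [hF₂.arr aPSV rfl, hF₁.arr aPSV rfl]
    intro u₃ s₃ hu₃ h₃ _
    simp only [Prog.cost, Expr.cost] at hu₃
    refine ⟨fun i hi hik => ?_, ?_⟩
    · simp only [State.set_arr, h₃]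
      split_ifs with h
      · rw [h]
      · exact hI i hi (by omega)
    · simp only [State.set_vars, if_true, hx, Nat.add_sub_cancel]
      rw [psvDepth_eq hk2]
      omega
  · rw [i₀, psvDepth_of_lt (by omega)]; omega

def nsvScan : Prog :=
  .while (.bin .mul (.bin .le (.var xJ) (.var xM))
      (.bin .le (.get aLCP (.var xP)) (.get aLCP (.var xJ))))
    (.assign xJ (.get aNSV (.var xJ)))

/-- The mirror image of the previous scan, filling the array from the right. Here a chain can only
end at `n + 1`, which is already the default value. -/
theorem nsvScan_run {M : Machine} {s : State} {i n : ℕ} {L : ℕ → ℕ} (hL : s.arr aLCP = L)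
    (hi : i ≤ n) (his : s.vars xP = i) (hj : s.vars xJ = i + 1) (hm : s.vars xM = n)
    (hP : ∀ j, i < j → j ≤ n → s.arr aNSV j = NSV n L j)
    (hcap : 10 ≤ M.cap) (hlen : n + 1 < M.len) :
    RunT M nsvScan s fun t s' => s'.vars xJ = NSV n L i ∧
      t + 13 * nsvDepth n L (NSV n L i) ≤ 13 * nsvDepth n L (i + 1) + 10 := by
  refine (RunT.loop (fun s => i < s.vars xJ ∧ s.vars xJ ≤ n + 1 ∧
      ∀ k, i < k → k < s.vars xJ → L i ≤ L k)
    (fun s => 13 * nsvDepth n L (s.vars xJ)) ⟨by omega, by omega, fun k _ _ => by omega⟩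
    ?_ ?_).frame.imp ?_
  · rintro s' ⟨h1, h2, h3⟩ hF
    simp only [Expr.Safe, Op.Fits, Expr.val, hF.vars xP rfl, his, true_and]
    exact ⟨by omega, by omega, Op.apply_le_mul_lt (by omega)⟩
  · rintro s' ⟨h1, h2, h3⟩ hF hv
    rw [ne_eq, Expr.val_and_eq_zero, not_not] at hv
    simp only [Expr.val, hF.vars xP rfl, his, hF.vars xM rfl, hm, hF.arr aLCP rfl, hL] at hv
    have hp : s'.arr aNSV (s'.vars xJ) = NSV n L (s'.vars xJ) := by
      rw [hF.arr aNSV rfl, hP _ h1 hv.1]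
    refine (Run.assign (t := 3) ?_ (Q := fun s'' => s''.vars xJ = NSV n L (s'.vars xJ)) ?_
      (by simp [Expr.cost])).toRunT ?_
    · simp only [Expr.Safe, Expr.val, true_and]; omega
    · simpa [Expr.val] using hp
    · intro u s'' hu e _
      have hlt := lt_nsv (L := L) hv.1
      have hle := nsv_cases n L (s'.vars xJ)
      refine ⟨⟨by omega, by omega, fun k hk hk' => ?_⟩, ?_⟩
      · rcases lt_trichotomy k (s'.vars xJ) with h | h | h
        · exact h3 k hk h
        · rw [h]; exact hv.2
        · exact hv.2.trans (le_of_lt_nsv (e ▸ hk') h)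
      · rw [e, nsvDepth_eq hv.1]; simp only [Expr.cost]; omega
  · rintro t s' ⟨⟨⟨⟨h1, h2, h3⟩, hv⟩, h4⟩, hF⟩
    rw [Expr.val_and_eq_zero] at hv
    simp only [Expr.val, hF.vars xP rfl, his, hF.vars xM rfl, hm, hF.arr aLCP rfl, hL, not_and,
      not_le] at hv
    simp only [Expr.cost, hj] at h4
    have e : NSV n L i = s'.vars xJ := by
      refine nsv_eq ?_ h3
      by_cases h : s'.vars xJ ≤ n
      · exact Or.inr ⟨h1, h, hv h⟩
      · exact Or.inl (by omega)
    rw [e]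
    exact ⟨rfl, h4⟩

/-- Fill the array of the next smaller values. -/
def nsvArray : Prog :=
  .seq (.assign xTot (.bin .sub (.var xM) (.lit 1))) (.seq (.assign xI (.lit 0))
  (.while (.bin .lt (.var xI) (.var xTot))
    (.seq (.seq (.assign xP (.bin .sub (.var xM) (.var xI)))
      (.seq (.assign xJ (.bin .add (.var xP) (.lit 1)))
      (.seq nsvScan (.store aNSV (.var xP) (.var xJ)))))
      (.assign xI (.bin .add (.var xI) (.lit 1))))))

theorem nsvArray_run {M : Machine} {s : State} {n : ℕ} {L : ℕ → ℕ} (hL : s.arr aLCP = L)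
    (hm : s.vars xM = n) (hn : 2 ≤ n)
    (hcap : 1000 * n + 1000 ≤ M.cap) (hlen : 40 * n + 40 ≤ M.len) :
    Run M nsvArray s (70 * n) fun s' => ∀ i, 2 ≤ i → i ≤ n → s'.arr aNSV i = NSV n L i := by
  refine Run.seq (t₁ := 4) (t₂ := 70 * n - 4) ?_ (by omega)
  refine Run.assign ?_ ?_ (by simp [Expr.cost])
  · simp only [Expr.Safe, Op.Fits, Expr.val, hm, true_and]; omega
  refine Run.seq (t₁ := 2) (t₂ := 70 * n - 6) ?_ (by omega)
  refine Run.assign (by simp only [Expr.Safe]; omega) ?_ (by simp [Expr.cost])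
  simp only [Expr.val, Op.apply, hm]
  generalize hs₀ : State.set _ _ _ = s₀
  have i₀ : s₀.vars xI = 0 := by simp [← hs₀]
  have t₀ : s₀.vars xTot = n - 1 := by simp [← hs₀]
  have m₀ : s₀.vars xM = n := by simp [← hs₀, hm]
  have L₀ : s₀.arr aLCP = L := by simp [← hs₀, hL]
  clear hs₀
  refine (RunT.count 0 (n - 1) (fun k s => ∀ i, n < i + k → i ≤ n → s.arr aNSV i = NSV n L i)
    (fun s => 60 * (n - 1 - s.vars xI) + 13 * nsvDepth n L (n - s.vars xI + 1)) i₀ t₀ (by omega)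
    (fun i _ _ => by omega) rfl rfl (by decide) (by omega) (by omega) ?_).imp ?_
    fun s' h i hi hin => h i (by omega) hin
  · rintro k s' - hk hI hx hF
    have m' : s'.vars xM = n := by rw [hF.vars xM rfl, m₀]
    refine RunT.seq ((Run.assign (t := 4) (Q := fun s₁ => s₁.vars xP = n - k) ?_ ?_
      (by simp [Expr.cost])).toRunT ?_)
    · simp only [Expr.Safe, Op.Fits, Expr.val, m', true_and]; omega
    · simp [Expr.val, Op.apply, hx, m']
    intro u s₁ hu p₁ hF₁
    refine RunT.seq ((Run.assign (t := 4) (Q := fun s₂ => s₂.vars xJ = n - k + 1) ?_ ?_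
      (by simp [Expr.cost])).toRunT ?_)
    · simp only [Expr.Safe, Op.Fits, Expr.val, p₁, true_and]; omega
    · simp [Expr.val, Op.apply, p₁]
    intro u' s₂ hu' j₂ hF₂
    have p₂ : s₂.vars xP = n - k := by rw [hF₂.vars xP rfl, p₁]
    refine RunT.seq ((nsvScan_run (L := L) (n := n) ?_ (by omega) p₂ j₂ ?_ ?_ (by omega)
      (by omega)).frame.imp ?_)
    · rw [hF₂.arr aLCP rfl, hF₁.arr aLCP rfl, hF.arr aLCP rfl, L₀]
    · rw [hF₂.vars xM rfl, hF₁.vars xM rfl, m']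
    · intro j hj hjn
      rw [hF₂.arr aNSV rfl, hF₁.arr aNSV rfl]
      exact hI j (by omega) hjn
    rintro u₃ s₃ ⟨⟨h1, h2⟩, hF₃⟩
    have p₃ : s₃.vars xP = n - k := by rw [hF₃.vars xP rfl, p₂]
    refine (Prog.wp.run (Q := fun s₄ => ∀ i, s₄.arr aNSV i =
      if i = n - k then NSV n L (n - k) else s'.arr aNSV i) ?_).toRunT ?_
    · simp only [Prog.wp, Expr.Safe, Expr.val, p₃, State.put_arr, true_and, h1]
      refine ⟨by omega, fun i => ?_⟩
      rw [hF₃.arr aNSV rfl, hF₂.arr aNSV rfl, hF₁.arr aNSV rfl]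
    intro u₄ s₄ hu₄ h₄ _
    simp only [Prog.cost, Expr.cost] at hu₄
    refine ⟨fun i hi hin => ?_, ?_⟩
    · simp only [State.set_arr, h₄]
      split_ifs with h
      · rw [h]
      · exact hI i (by omega) hin
    · simp only [State.set_vars, if_true, hx]
      rw [show n - (k + 1) + 1 = n - k by omega, nsvDepth_eq (show n - k ≤ n by omega)]
      omega
  · rw [i₀, nsvDepth_of_lt (by omega)]; omega

/-! ### All arrays -/

/-- Write the reversed text into `aX`. -/
def loadText : Prog :=
  .seq (.assign xM (.var vN))
  (.seq (.assign xTot (.bin .sub (.var vN) (.lit 1)))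
  (.seq (.forLt xI (.lit 0) xTot
    (.store aX (.var xI) (.get aT (.bin .sub (.var xTot) (.var xI)))))
  (.seq (.store aX (.var xTot) (.get aT (.var vN)))
  (.seq (.store aX (.var vN) (.lit 0))
  (.seq (.store aX (.bin .add (.var vN) (.lit 1)) (.lit 0))
  (.store aX (.bin .add (.var vN) (.lit 2)) (.lit 0)))))))

theorem loadText_run {M : Machine} {s : State} {n : ℕ} {X : ℕ → ℕ} (hn : 2 ≤ n)
    (hns : s.vars vN = n) (hX : IsStr n X) (h1 : ∀ p < n - 1, s.arr aT (n - 1 - p) = X p)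
    (h2 : s.arr aT n = X (n - 1))
    (hcap : 1000 * n + 1000 ≤ M.cap) (hlen : 40 * n + 40 ≤ M.len) :
    Run M loadText s (50 * n) fun s' => HasStr s' n X := by
  refine Run.seq (t₁ := 2) (t₂ := 50 * n - 2) ?_ (by omega)
  refine Run.assign trivial ?_ (by simp [Expr.cost])
  refine Run.seq (t₁ := 4) (t₂ := 50 * n - 6) ?_ (by omega)
  refine Run.assign ?_ ?_ (by simp [Expr.cost])
  · simp only [Expr.Safe, Op.Fits, Expr.val, State.set_vars, OfNat.zero_ne_ofNat, if_false, hns,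
      true_and]
    omega
  simp only [Expr.val, Op.apply, State.set_vars, OfNat.zero_ne_ofNat, if_false, hns]
  generalize hs₀ : State.set _ _ _ = s₀
  have m₀ : s₀.vars xM = n := by simp [← hs₀]
  have t₀ : s₀.vars xTot = n - 1 := by simp [← hs₀]
  have n₀ : s₀.vars vN = n := by simp [← hs₀, hns]
  have T₀ : s₀.arr aT = s.arr aT := by simp [← hs₀]
  clear hs₀
  refine Run.seqFrame (24 + 3 * n) (Run.forLtWp (n - 1) 8 (fun j s => ∀ p < j, s.arr aX p = X p)
    (by simp) t₀ rfl rfl (by decide) (by omega) (by omega) (by decide) ?_) ?_ (by omega)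
  · intro j s' hj hI hx hF
    simp only [Prog.wp, Expr.Safe, Op.Fits, Op.apply, Expr.val, hx, hF.vars xTot rfl, t₀,
      hF.arr aT rfl, T₀, State.set_arr, State.put_arr, true_and, h1 j hj]
    refine ⟨by omega, by omega, fun p hp => ?_⟩
    split_ifs with h
    · rw [h]
    · exact hI p (by omega)
  intro s₁ hI hF₁
  refine Run.imp (Prog.wp.run (Q := _) ?_) (show _ ≤ 24 + 3 * n from le_trans (by decide)
    (show 24 ≤ 24 + 3 * n by omega)) fun _ h => h
  simp only [Prog.wp, Expr.Safe, Op.Fits, Op.apply, Expr.val, hF₁.vars xTot rfl, t₀,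
    hF₁.vars vN rfl, n₀, hF₁.arr aT rfl, T₀, h2, State.put_vars, true_and]
  refine ⟨by omega, by omega, by omega, by omega, by omega, by omega, by omega, by omega, by omega,
    by omega, ?_, fun p hp => ?_⟩
  · simp only [State.put_vars]; rw [hF₁.vars xM rfl, m₀]
  · simp only [State.put_arr, true_and]
    by_cases h : p < n
    · rw [if_neg (by omega), if_neg (by omega), if_neg (by omega)]
      split_ifs with h'
      · rw [h']
      · exact hI p (by omega)
    · rw [hX.zero p (by omega)]
      split_ifs <;> first | rfl | omega

/-- Compute the arrays SA, BWT, LCP, PSV and NSV of the reversed text. -/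
def computeArrays : Prog :=
  .seq loadText (.seq rankSuffixes (.seq invertRanks (.seq lcpArray (.seq psvArray nsvArray))))

theorem computeArrays_run {M : Machine} {s : State} {n : ℕ} {X : ℕ → ℕ} (hn : 2 ≤ n)
    (hns : s.vars vN = n) (hX : IsStr n X) (h1 : ∀ p < n - 1, s.arr aT (n - 1 - p) = X p)
    (h2 : s.arr aT n = X (n - 1))
    (hcap : 1000 * n + 1000 ≤ M.cap) (hlen : 40 * n + 40 ≤ M.len) :
    Run M computeArrays s (31000 * n) fun s' => ∃ R, IsRank n X R ∧
      (∀ p < n, s'.arr aSA (R p) = p + 1 ∧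
        s'.arr aBWT (R p) = X (if p = 0 then n - 1 else p - 1)) ∧
      (∀ p < n, ∀ q < n, R p = R q + 1 → IsLcp X p q (s'.arr aLCP (R p))) ∧
      ∀ i, 2 ≤ i → i ≤ n → s'.arr aPSV i = PSV (s'.arr aLCP) i ∧
        s'.arr aNSV i = NSV n (s'.arr aLCP) i := by
  refine Run.seqFrame (30500 * n) (loadText_run hn hns hX h1 h2 hcap hlen) ?_ (by linarith)
  intro s₁ H₁ _
  refine Run.seqFrame (500 * n) (rankSuffixes_run H₁ hX hn hcap hlen) ?_ (by linarith)
  rintro s₂ ⟨H₂, R₂⟩ _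
  refine Run.seqFrame (400 * n) (invertRanks_run H₂ hX R₂ rfl hn hcap hlen) ?_ (by linarith)
  intro s₃ A₃ hF₃
  have H₃ : HasStr s₃ n X :=
    ⟨(hF₃.vars xM rfl).trans H₂.len, fun p hp => by rw [hF₃.arr aX rfl, H₂.arr p hp]⟩
  refine Run.seqFrame (200 * n) (lcpArray_run H₃ hX R₂ (hF₃.arr aR rfl) (fun p hp => (A₃ p hp).1)
    hn hcap hlen) ?_ (by linarith)
  intro s₄ L₄ hF₄
  have m₄ : s₄.vars xM = n := (hF₄.vars xM rfl).trans H₃.len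
  refine Run.seqFrame (70 * n) (psvArray_run rfl m₄ hn hcap hlen) ?_ (by linarith)
  intro s₅ P₅ hF₅
  have m₅ : s₅.vars xM = n := (hF₅.vars xM rfl).trans m₄
  refine (nsvArray_run rfl m₅ hn hcap hlen).frame.imp le_rfl ?_
  rintro s₆ ⟨N₆, hF₆⟩
  refine ⟨s₂.arr aR, R₂, fun p hp => ?_, fun p hp q hq hpq => ?_, fun i hi hin => ⟨?_, ?_⟩⟩
  · rw [hF₆.arr aSA rfl, hF₅.arr aSA rfl, hF₄.arr aSA rfl, hF₆.arr aBWT rfl, hF₅.arr aBWT rfl,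
      hF₄.arr aBWT rfl]
    exact A₃ p hp
  · rw [hF₆.arr aLCP rfl, hF₅.arr aLCP rfl]
    exact L₄ p hp q hq hpq
  · rw [hF₆.arr aPSV rfl, hF₆.arr aLCP rfl, P₅ i hi hin, hF₅.arr aLCP rfl]
  · rw [N₆ i hi hin, hF₆.arr aLCP rfl]

end Suffixient

namespace Suffixient

/-! ### The scan of the Burrows–Wheeler transform -/

/-- The loop `for x = a, …, b do p`, where `b` is the value of the variable `y`. -/
theorem Run.forLe {M : Machine} {p : Prog} {x y : ℕ} (a b c : ℕ) (I : ℕ → State → Prop)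
    {s₀ : State} (hI : I a (s₀.set x a)) (hb : s₀.vars y = b) (hab : a ≤ b + 1)
    (hw : p.writesVar x = false) (hy : p.writesVar y = false) (hxy : x ≠ y)
    (hcap : b + 1 < M.cap) (hcap1 : 1 < M.cap) (hc : p.cost ≤ c)
    (hp : ∀ k s, a ≤ k → k ≤ b → I k s → s.vars x = k →
      Frame (.for x (.lit a) (.var y) p) s₀ s →
      p.wp M (fun s' => I (k + 1) (s'.set x (k + 1))) s) :
    Run M (.for x (.lit a) (.var y) p) s₀ ((b + 1) * (c + 8) + 6) fun s' => I (b + 1) s' := by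
  refine Run.seq (t₁ := 2) (t₂ := (b + 1) * (c + 8) + 4) ?_ (by omega)
  refine Run.assign (by simp only [Expr.Safe]; omega) ?_ (by simp [Expr.cost])
  refine (Run.count a (b + 1) c I (by simp [Expr.val]) hab (by simpa [Expr.val] using hI)
    hw hcap hcap1 ?_ ?_).imp ?_ fun s h => h.1
  · intro k s _ hk hIk hxk hF
    have h1 : s.vars y = b := by
      rw [hF.vars y (by simp [Prog.writesVar, hy, hxy]), State.set_vars, if_neg hxy.symm, hb]
    simp [Expr.Safe, Expr.val, Op.Fits, Op.apply, hxk, h1, hcap1]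
  · intro k s hk hk' hIk hxk hF
    refine (Prog.wp.run (hp k s hk (by omega) hIk hxk ⟨fun z hz => ?_, fun z hz => ?_⟩)).imp hc
      fun _ h => h
    · simp only [Prog.for, Prog.writesVar, Bool.or_eq_false_iff, beq_eq_false_iff_ne] at hz
      rw [hF.vars z (by simp [Prog.writesVar, hz]), State.set_vars, if_neg (Ne.symm hz.1)]
    · simp only [Prog.for, Prog.writesArr, Bool.or_eq_false_iff] at hz
      rw [hF.arr z (by simp [Prog.writesArr, hz])]; rfl
  · simp only [Expr.cost, add_assoc]
    norm_num

theorem Prog.wp.mono {M : Machine} {p : Prog} {Q Q' : State → Prop} {s : State} (h : p.wp M Q s)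
    (hQ : ∀ s', Q s' → Frame p s s' → Q' s') : p.wp M Q' s := by
  induction p generalizing Q Q' s with
  | skip => exact hQ _ h (Frame.refl _ _)
  | assign x e => exact ⟨h.1, hQ _ h.2 (Exec.assign s x e _ h.1.eval_eq).frame⟩
  | store a i e =>
    exact ⟨h.1, h.2.1, h.2.2.1, hQ _ h.2.2.2
      (Exec.store s a i e _ _ h.1.eval_eq h.2.1 h.2.2.1.eval_eq).frame⟩
  | seq p q ihp ihq =>
    refine ihp h fun s₁ h₁ hF₁ => ihq h₁ fun s₂ h₂ hF₂ => hQ _ h₂ ?_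
    refine Frame.trans (hF₁.mono ?_ ?_) (hF₂.mono ?_ ?_) <;>
      simp +contextual [Prog.writesVar, Prog.writesArr]
  | ite e p q ihp ihq =>
    refine ⟨h.1, fun hv => ihp (h.2.1 hv) fun s' h' hF => hQ _ h' (hF.mono ?_ ?_),
      fun hv => ihq (h.2.2 hv) fun s' h' hF => hQ _ h' (hF.mono ?_ ?_)⟩ <;>
      simp +contextual [Prog.writesVar, Prog.writesArr]
  | _ => exact h.elim

/-- The data that the scan works on: `bw` is the Burrows–Wheeler transform, with letters coded by
`1, …, σ`, and `L` and `sa` are the LCP array and the suffix array. -/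
structure ScanData where
  n : ℕ
  σ : ℕ
  bw : ℕ → ℕ
  L : ℕ → ℕ
  sa : ℕ → ℕ
  two_le : 2 ≤ n
  σ_le : σ ≤ n
  bw_mem : ∀ i, 1 ≤ i → i ≤ n → 1 ≤ bw i ∧ bw i ≤ σ
  sa_mem : ∀ i, 1 ≤ i → i ≤ n → 1 ≤ sa i ∧ sa i ≤ n

namespace ScanData

variable (D : ScanData)

def Brk (γ i : ℕ) : Prop :=
  2 ≤ i ∧ i ≤ D.n ∧ D.bw (i - 1) ≠ D.bw i ∧ (D.bw (i - 1) = γ ∨ D.bw i = γ)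

/-- All earlier run breaks lie to the left of the box of `i`. -/
def Cand (γ i : ℕ) : Prop := D.Brk γ i ∧ ∀ j, D.Brk γ j → j < i → j ≤ PSV D.L i

def Max (γ i : ℕ) : Prop :=
  D.Cand γ i ∧ ∀ j, D.Brk γ j → i < j → i ≤ PSV D.L j → NSV D.n D.L i < j

/-- `x` is the text position that belongs to the `γ`-run break `i`. -/
def Out (γ i x : ℕ) : Prop :=
  ∃ i', (i' = i - 1 ∨ i' = i) ∧ D.bw i' = γ ∧ x = D.n - D.sa i' + 1

/-- The record of `γ` before the run breaks from `k` on are processed. -/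
def RecInv (γ k a t act v : ℕ) : Prop :=
  ((∀ j, D.Brk γ j → k ≤ j) ∧ a = 0 ∧ act = 0 ∧ v = D.n + 1) ∨
  (D.Cand γ a ∧ a < k ∧ D.Out γ a t ∧ act = 1 ∧ v = NSV D.n D.L a ∧
    ∀ j, D.Brk γ j → a < j → j < k → PSV D.L j < a)

/-- `x` belongs to a maximum that has been superseded by a candidate before `k`. -/
def Reported (γ k x : ℕ) : Prop :=
  ∃ j, D.Max γ j ∧ D.Out γ j x ∧ ∃ j', D.Cand γ j' ∧ j < j' ∧ j' < k

/-! ### Candidates and the record of a single letter -/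

variable {D}

theorem Out.mem {γ i x : ℕ} (h : D.Out γ i x) (hi : D.Brk γ i) : 1 ≤ x ∧ x ≤ D.n := by
  obtain ⟨i', h1, -, rfl⟩ := h
  have := D.sa_mem i' (by have := hi.1; omega) (by have := hi.2.1; omega)
  omega

/-- The two letters at a run break differ, so only one of `i - 1` and `i` carries `γ`. -/
theorem Out.unique {γ i x y : ℕ} (h : D.Out γ i x) (h' : D.Out γ i y) (hi : D.Brk γ i) :
    x = y := by
  obtain ⟨i', h1, h2, rfl⟩ := h
  obtain ⟨j', h3, h4, rfl⟩ := h'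
  have h5 := hi.2.2.1
  have : i' = j' := by
    rcases h1 with rfl | rfl <;> rcases h3 with rfl | rfl
    · rfl
    · exact absurd (h2.trans h4.symm) h5
    · exact absurd (h4.trans h2.symm) h5
    · rfl
  rw [this]

/-- Suppose a break `j` after `a` lay in `(PSV[k], k)`. Then `L k ≤ L j`, and `PSV[j] < a ≤ PSV[k] <
j` gives `L j ≤ L (PSV[k])`, contradicting `L (PSV[k]) < L k`. -/
theorem cand_step {γ k a : ℕ} (ha : D.Cand γ a)
    (hbt : ∀ j, D.Brk γ j → a < j → j < k → PSV D.L j < a) (hk : D.Brk γ k)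
    (hle : a ≤ PSV D.L k) : D.Cand γ k := by
  refine ⟨hk, fun j hj hjk => ?_⟩
  rcases Nat.lt_or_ge a j with h | h
  · by_contra hlt
    have h1 := hbt j hj h hjk
    have h2 := le_of_psv_lt (L := D.L) (i := k) hj.1 (by omega) hjk
    have h3 := psv_cases D.L k
    have h4 := ha.1.1
    have h5 := le_of_psv_lt (L := D.L) (i := j) (k := PSV D.L k) (by omega) (by omega) (by omega)
    omega
  · omega

/-- No break strictly between `a` and `k` meets the premise of condition (b), `k` does, and breaks
beyond `k` are further away; so (b) has to be tested at `k` only. -/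
theorem max_iff_of_next {γ k a : ℕ} (ha : D.Cand γ a) (hak : a < k)
    (hbt : ∀ j, D.Brk γ j → a < j → j < k → PSV D.L j < a) (hk : D.Brk γ k)
    (hle : a ≤ PSV D.L k) : D.Max γ a ↔ NSV D.n D.L a < k := by
  refine ⟨fun h => h.2 k hk hak hle, fun h => ⟨ha, fun j hj haj hle' => ?_⟩⟩
  rcases Nat.lt_or_ge j k with h1 | h1
  · have := hbt j hj haj h1; omega
  · omega

/-- A break `j` after `a` with `PSV[j] < a` has `a` in its box, so it is not a candidate. -/
theorem cand_le_of_between {γ k a j : ℕ} (ha : D.Cand γ a)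
    (hbt : ∀ j, D.Brk γ j → a < j → j < k → PSV D.L j < a) (hj : D.Cand γ j) (hjk : j < k) :
    j ≤ a := by
  by_contra h
  have h1 := hbt j hj.1 (by omega) hjk
  have h2 := hj.2 a ha.1 (by omega)
  omega

theorem RecInv.skip {γ k a t act v : ℕ} (h : D.RecInv γ k a t act v)
    (hk : D.Brk γ k → a ≠ 0 ∧ PSV D.L k < a) : D.RecInv γ (k + 1) a t act v := by
  rcases h with ⟨h1, h2, h3, h4⟩ | ⟨h1, h2, h3, h4, h5, h6⟩
  · refine Or.inl ⟨fun j hj => ?_, h2, h3, h4⟩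
    have := h1 j hj
    rcases this.lt_or_eq with h | h
    · exact h
    · subst h; exact absurd h2 (hk hj).1
  · refine Or.inr ⟨h1, by omega, h3, h4, h5, fun j hj haj hjk => ?_⟩
    rcases Nat.lt_succ_iff_lt_or_eq.1 hjk with h | h
    · exact h6 j hj haj h
    · subst h; exact (hk hj).2

theorem reported_skip {γ k x : ℕ} (hk : ¬ D.Cand γ k) :
    D.Reported γ (k + 1) x ↔ D.Reported γ k x := by
  constructor
  · rintro ⟨j, h1, h2, j', h3, h4, h5⟩
    refine ⟨j, h1, h2, j', h3, h4, ?_⟩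
    rcases Nat.lt_succ_iff_lt_or_eq.1 h5 with h | h
    · exact h
    · exact absurd (h ▸ h3) hk
  · rintro ⟨j, h1, h2, j', h3, h4, h5⟩
    exact ⟨j, h1, h2, j', h3, h4, by omega⟩

theorem RecInv.not_cand {γ k a t act v : ℕ} (h : D.RecInv γ k a t act v)
    (hlt : PSV D.L k < a) : ¬ D.Cand γ k := by
  rintro ⟨hk, hc⟩
  rcases h with ⟨h1, h2, h3, h4⟩ | ⟨h1, h2, h3, h4, h5, h6⟩
  · omega
  · have := hc a h1.1 h2; omega

/-- The record after a candidate `k` has been processed. -/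
theorem RecInv.next {γ k a t act v t' : ℕ} (h : D.RecInv γ k a t act v) (hk : D.Brk γ k)
    (hle : a ≤ PSV D.L k) (ht : D.Out γ k t') :
    D.RecInv γ (k + 1) k t' 1 (NSV D.n D.L k) := by
  refine Or.inr ⟨?_, by omega, ht, rfl, rfl, fun j hj h1 h2 => by omega⟩
  rcases h with ⟨h1, h2, h3, h4⟩ | ⟨h1, h2, h3, h4, h5, h6⟩
  · exact ⟨hk, fun j hj hjk => by have := h1 j hj; omega⟩
  · exact cand_step h1 h6 hk hle

/-- Maxima before `a` were superseded by `a` at the latest, so only `a` itself can be new, and the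
stored `NSV[a]` decides whether it is a maximum. An empty record reports nothing, since its value `n
+ 1` is not below `k`. -/
theorem RecInv.reported_next {γ k a t act v x : ℕ} (h : D.RecInv γ k a t act v) (hk : D.Brk γ k)
    (hle : a ≤ PSV D.L k) :
    D.Reported γ (k + 1) x ↔ D.Reported γ k x ∨ (v < k ∧ x = t) := by
  have hkn := hk.2.1
  rcases h with ⟨h1, h2, h3, h4⟩ | ⟨h1, h2, h3, h4, h5, h6⟩
  · have no : ∀ k', k' ≤ k + 1 → ¬ D.Reported γ k' x := by
      rintro k' hk' ⟨j, hj, -, j', hj', hlt, hlt'⟩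
      have e1 := h1 j hj.1.1
      omega
    refine ⟨fun h => absurd h (no _ le_rfl), ?_⟩
    rintro (h | h)
    · exact absurd h (no _ (by omega))
    · omega
  · have ck := cand_step h1 h6 hk hle
    have hmax := max_iff_of_next h1 h2 h6 hk hle
    rw [← h5] at hmax
    constructor
    · rintro ⟨j, hj, hx, j', hj', hlt, hlt'⟩
      rcases Nat.lt_succ_iff_lt_or_eq.1 hlt' with h | h
      · exact Or.inl ⟨j, hj, hx, j', hj', hlt, h⟩
      · have hja := cand_le_of_between h1 h6 hj.1 (by omega)
        rcases hja.lt_or_eq with h7 | h7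
        · exact Or.inl ⟨j, hj, hx, a, h1, h7, h2⟩
        · subst h7
          exact Or.inr ⟨hmax.1 hj, hx.unique h3 h1.1⟩
    · rintro (⟨j, hj, hx, j', hj', hlt, hlt'⟩ | ⟨hv, rfl⟩)
      · exact ⟨j, hj, hx, j', hj', hlt, by omega⟩
      · exact ⟨a, hmax.2 hv, h3, k, ck, h2, by omega⟩

/-- The last candidate is a maximum without further test: no later break `j` has `a ≤ PSV[j]`, so
(b) holds vacuously. -/
theorem RecInv.final {γ a t act v x : ℕ} (h : D.RecInv γ (D.n + 1) a t act v) :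
    (∃ j, D.Max γ j ∧ D.Out γ j x) ↔ D.Reported γ (D.n + 1) x ∨ (act = 1 ∧ x = t) := by
  rcases h with ⟨h1, h2, h3, h4⟩ | ⟨h1, h2, h3, h4, h5, h6⟩
  · constructor
    · rintro ⟨j, hj, -⟩
      have := h1 j hj.1.1
      have := hj.1.1.2.1
      omega
    · rintro (⟨j, hj, hx, -⟩ | h)
      · exact ⟨j, hj, hx⟩
      · omega
  · constructor
    · rintro ⟨j, hj, hx⟩
      have hja := cand_le_of_between h1 h6 hj.1 (by have := hj.1.1.2.1; omega)
      rcases hja.lt_or_eq with h7 | h7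
      · exact Or.inl ⟨j, hj, hx, a, h1, h7, h2⟩
      · subst h7; exact Or.inr ⟨h4, hx.unique h3 h1.1⟩
    · rintro (⟨j, hj, hx, -⟩ | ⟨-, rfl⟩)
      · exact ⟨j, hj, hx⟩
      · refine ⟨a, ⟨h1, fun j hj haj hle => ?_⟩, h3⟩
        have := h6 j hj haj (by have := hj.2.1; omega)
        omega

/-! ### Correctness of the scan as a program -/

variable (D)

/-- The arrays that the scan reads are in place. -/
structure Loaded (s : State) : Prop where
  n : s.vars vN = D.n
  σ : s.vars vSigma = D.σ
  bw : ∀ i, 1 ≤ i → i ≤ D.n → s.arr aBWT i = D.bw i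
  sa : ∀ i, 1 ≤ i → i ≤ D.n → s.arr aSA i = D.sa i
  psv : ∀ i, 2 ≤ i → i ≤ D.n → s.arr aPSV i = PSV D.L i
  nsv : ∀ i, 2 ≤ i → i ≤ D.n → s.arr aNSV i = NSV D.n D.L i

/-- The state of the scan when the run breaks of every letter `γ` below `K γ` are processed. -/
structure Inv (K : ℕ → ℕ) (s : State) : Prop where
  rcd : ∀ γ, 1 ≤ γ → γ ≤ D.σ → D.RecInv γ (K γ) (s.arr aRsa γ) (s.arr aRtext γ)
    (s.arr aRact γ) (s.arr aRnsv γ)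
  out : ∀ x, 1 ≤ x → x ≤ D.n →
    (s.arr aS x = 1 ↔ ∃ γ, 1 ≤ γ ∧ γ ≤ D.σ ∧ D.Reported γ (K γ) x)

variable {D}

theorem Inv.congr {K : ℕ → ℕ} {s s' : State} (h : D.Inv K s) (he : s'.arr = s.arr) :
    D.Inv K s' :=
  ⟨fun γ h1 h2 => by rw [he]; exact h.rcd γ h1 h2, fun x h1 h2 => by rw [he]; exact h.out x h1 h2⟩

theorem exists_update_iff {K : ℕ → ℕ} {γ k σ x : ℕ} {P : ℕ → ℕ → ℕ → Prop} (h1 : 1 ≤ γ)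
    (h2 : γ ≤ σ) {B : Prop} (hP : P γ k x ↔ P γ (K γ) x ∨ B) :
    (∃ δ, 1 ≤ δ ∧ δ ≤ σ ∧ P δ (Function.update K γ k δ) x) ↔
      (∃ δ, 1 ≤ δ ∧ δ ≤ σ ∧ P δ (K δ) x) ∨ B := by
  constructor
  · rintro ⟨δ, h3, h4, h5⟩
    by_cases h : δ = γ
    · subst h
      rw [Function.update_self, hP] at h5
      exact h5.imp (fun h => ⟨δ, h3, h4, h⟩) id
    · rw [Function.update_of_ne h] at h5
      exact Or.inl ⟨δ, h3, h4, h5⟩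
  · rintro (⟨δ, h3, h4, h5⟩ | hB)
    · by_cases h : δ = γ
      · subst h
        exact ⟨δ, h3, h4, by rw [Function.update_self, hP]; exact Or.inl h5⟩
      · exact ⟨δ, h3, h4, by rw [Function.update_of_ne h]; exact h5⟩
    · exact ⟨γ, h1, h2, by rw [Function.update_self, hP]; exact Or.inr hB⟩

theorem Inv.next {K : ℕ → ℕ} {s s' : State} {γ k t : ℕ} (hI : D.Inv K s) (h1 : 1 ≤ γ)
    (h2 : γ ≤ D.σ) (hK : K γ = k) (hb : D.Brk γ k) (hle : s.arr aRsa γ ≤ PSV D.L k)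
    (ht : D.Out γ k t)
    (hS : ∀ x, s'.arr aS x = 1 ↔
      s.arr aS x = 1 ∨ (s.arr aRnsv γ < k ∧ x = s.arr aRtext γ))
    (hsa : ∀ δ, s'.arr aRsa δ = if δ = γ then k else s.arr aRsa δ)
    (htext : ∀ δ, s'.arr aRtext δ = if δ = γ then t else s.arr aRtext δ)
    (hact : ∀ δ, s'.arr aRact δ = if δ = γ then 1 else s.arr aRact δ)
    (hnsv : ∀ δ, s'.arr aRnsv δ = if δ = γ then NSV D.n D.L k else s.arr aRnsv δ) :
    D.Inv (Function.update K γ (k + 1)) s' := by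
  have hR := hI.rcd γ h1 h2
  rw [hK] at hR
  refine ⟨fun δ h3 h4 => ?_, fun x h3 h4 => ?_⟩
  · rw [hsa, htext, hact, hnsv]
    by_cases h : δ = γ
    · subst h
      simp only [Function.update_self, if_true]
      exact hR.next hb hle ht
    · simp only [Function.update_of_ne h, if_neg h]
      exact hI.rcd δ h3 h4
  · rw [hS, hI.out x h3 h4]
    exact (exists_update_iff (P := D.Reported) h1 h2 (by rw [hK]; exact hR.reported_next hb hle)).symm

theorem Inv.skip {K : ℕ → ℕ} {s : State} {γ k : ℕ} (hI : D.Inv K s) (h1 : 1 ≤ γ)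
    (h2 : γ ≤ D.σ) (hK : K γ = k) (hlt : PSV D.L k < s.arr aRsa γ) :
    D.Inv (Function.update K γ (k + 1)) s := by
  have hR := hI.rcd γ h1 h2
  rw [hK] at hR
  refine ⟨fun δ h3 h4 => ?_, fun x h3 h4 => ?_⟩
  · by_cases h : δ = γ
    · subst h
      rw [Function.update_self]
      exact hR.skip fun _ => ⟨by omega, hlt⟩
    · rw [Function.update_of_ne h]
      exact hI.rcd δ h3 h4
  · rw [hI.out x h3 h4, exists_update_iff (P := D.Reported) (B := False) h1 h2
      (by rw [hK, or_false]; exact reported_skip (hR.not_cand hlt)), or_false]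

/-- Letters without a run break at `k` need no treatment there. -/
theorem Inv.advance {K K' : ℕ → ℕ} {s : State} {k : ℕ} (hI : D.Inv K s)
    (h : ∀ γ, K' γ = K γ ∨ (K γ = k ∧ K' γ = k + 1 ∧ ¬ D.Brk γ k)) : D.Inv K' s := by
  refine ⟨fun γ h1 h2 => ?_, fun x h1 h2 => ?_⟩
  · have hR := hI.rcd γ h1 h2
    rcases h γ with e | ⟨e1, e2, hn⟩
    · rw [e]; exact hR
    · rw [e2]; rw [e1] at hR
      exact hR.skip fun hb => absurd hb hn
  · rw [hI.out x h1 h2]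
    refine exists_congr fun γ => and_congr_right fun _ => and_congr_right fun _ => ?_
    rcases h γ with e | ⟨e1, e2, hn⟩
    · rw [e]
    · rw [e1, e2, reported_skip fun hc => hn hc.1]

theorem Loaded.congr {s s' : State} (h : D.Loaded s) (h1 : s'.vars vN = s.vars vN)
    (h2 : s'.vars vSigma = s.vars vSigma)
    (h3 : ∀ a, a = aBWT ∨ a = aSA ∨ a = aPSV ∨ a = aNSV → s'.arr a = s.arr a) :
    D.Loaded s' where
  n := h1.trans h.n
  σ := h2.trans h.σ
  bw := by rw [h3 aBWT (by simp)]; exact h.bw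
  sa := by rw [h3 aSA (by simp)]; exact h.sa
  psv := by rw [h3 aPSV (by simp)]; exact h.psv
  nsv := by rw [h3 aNSV (by simp)]; exact h.nsv

theorem Loaded.frame {p : Prog} {s s' : State} (h : D.Loaded s) (hF : Frame p s s')
    (hp : (p.writesVar vN || p.writesVar vSigma || p.writesArr aBWT || p.writesArr aSA ||
      p.writesArr aPSV || p.writesArr aNSV) = false) : D.Loaded s' := by
  simp only [Bool.or_eq_false_iff] at hp
  refine h.congr (hF.vars _ (by tauto)) (hF.vars _ (by tauto)) ?_
  rintro a (rfl | rfl | rfl | rfl) <;> exact hF.arr _ (by tauto)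

theorem processBreak_wp {M : Machine} {s : State} {K : ℕ → ℕ} {k i' : ℕ} (hs : D.Loaded s)
    (hI : D.Inv K s) (hk : s.vars vI = k) (hi : s.vars vI' = i') (hii : i' = k - 1 ∨ i' = k)
    (hb : D.Brk (D.bw i') k) (hK : K (D.bw i') = k)
    (hcap : 1000 * D.n + 1000 ≤ M.cap) (hlen : 40 * D.n + 40 ≤ M.len) :
    processBreak.wp M (fun s' => D.Inv (Function.update K (D.bw i') (k + 1)) s') s := by
  have hn := D.two_le
  have hσ := D.σ_le
  have hk2 := hb.1
  have hkn := hb.2.1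
  have b1 := hs.bw i' (by omega) (by omega)
  have b2 := D.bw_mem i' (by omega) (by omega)
  have b3 := hs.sa i' (by omega) (by omega)
  have b4 := D.sa_mem i' (by omega) (by omega)
  have b5 := hs.psv k hk2 hkn
  have b6 := hs.nsv k hk2 hkn
  have hout : D.Out (D.bw i') k (D.n - D.sa i' + 1) := ⟨i', hii, rfl, rfl⟩
  generalize hγ : D.bw i' = γ at *
  have hR := hI.rcd γ b2.1 b2.2
  rw [hK] at hR
  have hnext := fun s' hle => hI.next (s' := s') b2.1 b2.2 hK hb hle hout
  have hskip := hI.skip b2.1 b2.2 hK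
  -- The stored text position is used as an address only after the NSV test, which an empty record
  -- fails.
  have ht : s.arr aRnsv γ < k → s.arr aRtext γ ≤ D.n := fun h => by
    rcases hR with ⟨-, -, -, h4⟩ | ⟨h1, h2, h3, -⟩
    · omega
    · exact (h3.mem h1.1).2
  simp only [processBreak, Prog.block, Prog.wp, Expr.Safe, Op.Fits, Op.apply, Expr.val, hk, hi,
    State.set_arr, State.set_vars, b1, hs.n, b3, b5, b6, State.put_vars, if_true, true_and, ne_eq,
    ite_eq_right_iff, one_ne_zero, imp_false, not_lt, not_le, State.put_arr, Nat.reduceEqDiff,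
    if_false, aRsa, aPSV, aRnsv, aS, aRtext, aSA, aNSV, aRact, vC, vI, vI', vN,
    OfNat.zero_ne_ofNat, false_and]
  refine ⟨by omega, by omega, fun hle => ⟨by omega, fun hv => ?_, fun hv => ?_⟩, fun hlt => ?_⟩
  · have ht' : s.arr 8 γ ≤ D.n := ht hv
    refine ⟨by omega, by omega, by omega, by omega, by omega, by omega, by omega, by omega,
      by omega, by omega, hnext _ hle ?_ ?_ ?_ ?_ ?_⟩
    · intro x
      simp only [State.put_arr, State.set_arr, Nat.reduceEqDiff, false_and, if_false, true_and, aS,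
        aRtext, aRnsv]
      split_ifs with h <;> simp [h, hv]
    all_goals simp
  · refine ⟨by omega, by omega, by omega, by omega,
      by omega, by omega, by omega, hnext _ hle ?_ ?_ ?_ ?_ ?_⟩
    · intro x
      simp [hv.not_gt]
    all_goals simp
  · exact (hskip hlt).congr rfl

theorem scanBWT_run {M : Machine} {s : State} (hs : D.Loaded s) (hI : D.Inv (fun _ => 2) s)
    (hcap : 1000 * D.n + 1000 ≤ M.cap) (hlen : 40 * D.n + 40 ≤ M.len) :
    Run M scanBWT s (200 * D.n) fun s' => D.Inv (fun _ => D.n + 1) s' := by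
  have hn := D.two_le
  refine (Run.forLe (M := M) 2 D.n 100 (fun k s => D.Inv (fun _ => k) s) (hI.congr rfl) hs.n
    (by omega) rfl rfl (by decide) (by omega) (by omega) ?_ ?_).imp ?_ fun _ h => h
  · decide
  · intro k s₁ hk hkn hI₁ hk₁ hF
    have hL := hs.frame hF rfl
    have b1 := hL.bw k (by omega) hkn
    have b2 := hL.bw (k - 1) (by omega) (by omega)
    refine ⟨?_, fun hne => ?_, fun heq => ?_⟩
    · simp only [Expr.Safe, Expr.val, Op.Fits, hk₁, Op.apply, true_and]
      omega
    · simp only [Expr.val, Op.apply, hk₁, b1, b2, ne_eq, ite_eq_right_iff, one_ne_zero, imp_false,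
        not_not] at hne
      refine Inv.advance (k := k) (hI₁.congr rfl) fun γ => Or.inr ⟨rfl, rfl, fun hb => ?_⟩
      exact hb.2.2.1 hne.symm
    · simp only [Expr.val, Op.apply, hk₁, b1, b2, ite_eq_right_iff, one_ne_zero, imp_false]
        at heq
      have heq' : D.bw (k - 1) ≠ D.bw k := fun h => heq h.symm
      refine ⟨by simp only [Expr.Safe, Expr.val, Op.Fits, hk₁, true_and]; omega, ?_⟩
      have hL₁ : D.Loaded (s₁.set vI' ((Expr.bin .sub (.var vI) (.lit 1)).val s₁)) :=
        hL.congr rfl rfl fun _ _ => rfl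
      change Prog.wp M processBreak
        (Prog.wp M (.seq (.assign vI' (.var vI)) processBreak) _) _
      refine (processBreak_wp (K := fun _ => k) (k := k) (i' := k - 1) hL₁ (hI₁.congr rfl) ?_ ?_ (Or.inl rfl)
        ⟨hk, hkn, heq', Or.inl rfl⟩ rfl hcap hlen).mono fun s₂ hI₂ hF₂ => ?_
      · simpa using hk₁
      · simp [Expr.val, Op.apply, hk₁]
      have hk₂ : s₂.vars vI = k := by
        rw [hF₂.vars vI rfl]; simpa using hk₁
      have hL₂ : D.Loaded s₂ := hL₁.frame hF₂ rfl
      refine ⟨trivial, ?_⟩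
      -- The second letter at the break differs from the first, so its own progress still stands at
      -- `k`.
      refine (processBreak_wp (s := s₂.set vI' ((Expr.var vI).val s₂))
        (K := Function.update (fun _ => k) (D.bw (k - 1)) (k + 1)) (k := k) (i' := k) (hL₂.congr rfl rfl fun _ _ => rfl) (hI₂.congr rfl) ?_ ?_ (Or.inr rfl)
        ⟨hk, hkn, heq', Or.inr rfl⟩ (Function.update_of_ne heq _ _) hcap hlen).mono
          fun s₃ hI₃ hF₃ => ?_
      · simpa using hk₂
      · simpa [Expr.val] using hk₂
      -- All letters other than the two at the break move on without any action.
      refine Inv.advance (k := k) (hI₃.congr rfl) fun γ => ?_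
      by_cases h1 : γ = D.bw k
      · subst h1; left; rw [Function.update_self]
      · rw [Function.update_of_ne h1]
        by_cases h2 : γ = D.bw (k - 1)
        · subst h2; left; rw [Function.update_self]
        · rw [Function.update_of_ne h2]
          refine Or.inr ⟨rfl, rfl, fun hb => ?_⟩
          rcases hb.2.2.2 with h | h
          · exact h2 h.symm
          · exact h1 h.symm
  · omega

theorem clearS_run {M : Machine} {s : State} {n : ℕ} (hs : s.vars vN = n)
    (hcap : 1000 * n + 1000 ≤ M.cap) (hlen : 40 * n + 40 ≤ M.len) :
    Run M clearS s (50 * n + 50) fun s' => ∀ x, 1 ≤ x → x ≤ n → s'.arr aS x = 0 := by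
  refine (Run.forLe (M := M) 1 n 10 (fun k s => ∀ x, 1 ≤ x → x < k → s.arr aS x = 0)
    (fun x h1 h2 => by omega) hs (by omega) rfl rfl (by decide) (by omega) (by omega) (by decide)
    ?_).imp (by omega) fun _ h x h1 h2 => h x h1 (by omega)
  intro k s₁ hk hkn hI₁ hk₁ hF
  refine ⟨trivial, by simp only [Expr.val, hk₁]; omega, by simp only [Expr.Safe]; omega, ?_⟩
  intro x h1 h2
  simp only [State.set_arr, State.put_arr, Expr.val, hk₁, true_and]
  split_ifs with h
  · rfl
  · exact hI₁ x h1 (by omega)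

theorem initR_run {M : Machine} {s : State} {n σ : ℕ} (hs : s.vars vN = n)
    (hσ : s.vars vSigma = σ) (hle : σ ≤ n)
    (hcap : 1000 * n + 1000 ≤ M.cap) (hlen : 40 * n + 40 ≤ M.len) :
    Run M initR s (50 * n + 50) fun s' => ∀ γ, 1 ≤ γ → γ ≤ σ →
      s'.arr aRsa γ = 0 ∧ s'.arr aRact γ = 0 ∧ s'.arr aRnsv γ = n + 1 := by
  refine (Run.forLe (M := M) 1 σ 30 (fun k s => ∀ γ, 1 ≤ γ → γ < k →
      s.arr aRsa γ = 0 ∧ s.arr aRact γ = 0 ∧ s.arr aRnsv γ = n + 1)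
    (fun x h1 h2 => by omega) hσ (by omega) rfl rfl (by decide) (by omega) (by omega) (by decide)
    ?_).imp (by omega) fun _ h x h1 h2 => h x h1 (by omega)
  intro k s₁ hk hkn hI₁ hk₁ hF
  have hN : s₁.vars vN = n := by rw [hF.vars vN rfl, hs]
  simp only [Prog.block, Prog.wp, Expr.Safe, Op.Fits, Op.apply, Expr.val, hk₁, hN,
    State.put_vars, true_and, State.set_arr]
  refine ⟨by omega, by omega, by omega, by omega, by omega, by omega, by omega, by omega, ?_⟩
  intro x h1 h2
  simp only [State.put_arr, Nat.reduceEqDiff, false_and, if_false, true_and, aRsa, aRact, aRnsv,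
    aRtext]
  split_ifs with h
  · simp
  · exact hI₁ x h1 (by omega)

theorem reportActive_run {M : Machine} {s : State} (hs : D.Loaded s)
    (hI : D.Inv (fun _ => D.n + 1) s)
    (hcap : 1000 * D.n + 1000 ≤ M.cap) (hlen : 40 * D.n + 40 ≤ M.len) :
    Run M reportActive s (50 * D.n + 50) fun s' => ∀ x, 1 ≤ x → x ≤ D.n →
      (s'.arr aS x = 1 ↔ ∃ γ, 1 ≤ γ ∧ γ ≤ D.σ ∧ ∃ j, D.Max γ j ∧ D.Out γ j x) := by
  have hσ := D.σ_le
  have hn := D.two_le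
  refine (Run.forLe (M := M) 1 D.σ 30 (fun k s' => ∀ x,
      (s'.arr aS x = 1 ↔ s.arr aS x = 1 ∨ ∃ γ, 1 ≤ γ ∧ γ < k ∧ s.arr aRact γ = 1 ∧
        x = s.arr aRtext γ))
    (fun x => ?_) hs.σ (by omega) rfl rfl (by decide) (by omega) (by omega) (by decide)
    ?_).imp (by omega) fun s' h x h1 h2 => ?_
  · simp only [State.set_arr, iff_self_or]
    rintro ⟨γ, h1, h2, -⟩
    omega
  · intro k s₁ hk hkn hI₁ hk₁ hF
    have ea := hF.arr aRact rfl
    have et := hF.arr aRtext rfl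
    have hR := hI.rcd k hk hkn
    have key : ∀ x, (∃ γ, 1 ≤ γ ∧ γ < k + 1 ∧ s.arr aRact γ = 1 ∧ x = s.arr aRtext γ) ↔
        (∃ γ, 1 ≤ γ ∧ γ < k ∧ s.arr aRact γ = 1 ∧ x = s.arr aRtext γ) ∨
          (s.arr aRact k = 1 ∧ x = s.arr aRtext k) := by
      intro x
      constructor
      · rintro ⟨γ, h1, h2, h3⟩
        rcases Nat.lt_succ_iff_lt_or_eq.1 h2 with h | h
        · exact Or.inl ⟨γ, h1, h, h3⟩
        · subst h; exact Or.inr h3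
      · rintro (⟨γ, h1, h2, h3⟩ | h)
        · exact ⟨γ, h1, by omega, h3⟩
        · exact ⟨k, hk, by omega, h⟩
    refine ⟨?_, fun hne => ?_, fun heq => ?_⟩
    · simp only [Expr.Safe, Expr.val, Op.Fits, hk₁, true_and]
      omega
    · simp only [Expr.val, Op.apply, hk₁, ea, ne_eq, ite_eq_right_iff, one_ne_zero, imp_false,
        not_not] at hne
      have ht : s.arr aRtext k ≤ D.n := by
        rcases hR with ⟨-, -, h4, -⟩ | ⟨h1, h2, h3, -⟩
        · omega
        · exact (h3.mem h1.1).2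
      refine ⟨?_, ?_, ?_, fun x => ?_⟩
      · simp only [Expr.Safe, Expr.val, hk₁, true_and]; omega
      · simp only [Expr.val, hk₁, et]; omega
      · simp only [Expr.Safe]; omega
      · rw [key, ← or_assoc, ← hI₁]
        simp only [State.set_arr, State.put_arr, Expr.val, hk₁, et, true_and]
        split_ifs with h <;> simp [h, hne]
    · simp only [Expr.val, Op.apply, hk₁, ea, ite_eq_right_iff, one_ne_zero, imp_false] at heq
      intro x
      rw [key, ← or_assoc, ← hI₁, State.set_arr]
      simp [heq]
  · rw [h x, hI.out x h1 h2]
    constructor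
    · rintro (⟨γ, h3, h4, h5⟩ | ⟨γ, h3, h4, h5⟩)
      · exact ⟨γ, h3, h4, (hI.rcd γ h3 h4).final.2 (Or.inl h5)⟩
      · exact ⟨γ, h3, by omega, (hI.rcd γ h3 (by omega)).final.2 (Or.inr h5)⟩
    · rintro ⟨γ, h3, h4, h5⟩
      rcases (hI.rcd γ h3 h4).final.1 h5 with h | h
      · exact Or.inl ⟨γ, h3, h4, h⟩
      · exact Or.inr ⟨γ, h3, by omega, h⟩

theorem scan_run {M : Machine} {s : State} (hs : D.Loaded s)
    (hcap : 1000 * D.n + 1000 ≤ M.cap) (hlen : 40 * D.n + 40 ≤ M.len) :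
    Run M (.block [clearS, initR, scanBWT, reportActive]) s (1000 * D.n)
      fun s' => ∀ x, 1 ≤ x → x ≤ D.n →
        (s'.arr aS x = 1 ↔ ∃ γ, 1 ≤ γ ∧ γ ≤ D.σ ∧ ∃ j, D.Max γ j ∧ D.Out γ j x) := by
  have hn := D.two_le
  refine Run.seqFrame (300 * D.n + 100) (clearS_run hs.n hcap hlen) (fun s₁ h₁ hF₁ => ?_)
    (by omega)
  have hs₁ := hs.frame hF₁ rfl
  refine Run.seqFrame (250 * D.n + 50) (initR_run hs₁.n hs₁.σ D.σ_le hcap hlen)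
    (fun s₂ h₂ hF₂ => ?_) (by omega)
  have hs₂ := hs₁.frame hF₂ rfl
  have hI₂ : D.Inv (fun _ => 2) s₂ := by
    refine ⟨fun γ h3 h4 => Or.inl ⟨fun j hj => hj.1, h₂ γ h3 h4⟩, fun x h3 h4 => ?_⟩
    rw [hF₂.arr aS rfl, h₁ x h3 h4]
    simp only [zero_ne_one, false_iff]
    rintro ⟨γ, -, -, j, hj, -, j', hj', hlt, hlt'⟩
    have := hj.1.1.1
    omega
  refine Run.seqFrame (50 * D.n + 50) (scanBWT_run hs₂ hI₂ hcap hlen)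
    (fun s₃ h₃ hF₃ => ?_) (by omega)
  exact reportActive_run (hs₂.frame hF₃ rfl) h₃ hcap hlen

end ScanData

end Suffixient

namespace Suffixient

/-! ### Suffix arrays of lists -/

section Code

variable {A : Type*} [LinearOrder A] [Fintype A]

theorem code_strictMono : StrictMono (code : A → ℕ) := by
  intro a b h
  refine Finset.card_lt_card (Finset.ssubset_iff_of_subset ?_ |>.2 ⟨b, by simp, by simpa using h⟩)
  intro x hx
  simp only [Finset.mem_filter, Finset.mem_univ, true_and] at hx ⊢
  exact hx.trans h.le

theorem one_le_code (a : A) : 1 ≤ code a :=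
  Finset.card_pos.2 ⟨a, by simp⟩

theorem code_le_card (a : A) : code a ≤ Fintype.card A := Finset.card_le_univ _

/-- The letters of `U`, coded by their ranks; positions are counted from `0`. -/
def codeStr (U : List A) (p : ℕ) : ℕ := (U[p]?).elim 0 code

theorem codeStr_of_lt {U : List A} {p : ℕ} (h : p < U.length) : codeStr U p = code U[p] := by
  simp [codeStr, h]

theorem codeStr_of_le {U : List A} {p : ℕ} (h : U.length ≤ p) : codeStr U p = 0 := by
  simp [codeStr, h]

theorem codeStr_eq_iff {U : List A} {p q : ℕ} : codeStr U p = codeStr U q ↔ U[p]? = U[q]? := by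
  refine ⟨fun h => ?_, fun h => by rw [codeStr, codeStr, h]⟩
  unfold codeStr at h
  cases h1 : U[p]? with
  | none => cases h2 : U[q]? with
    | none => rfl
    | some b => have := one_le_code b; rw [h1, h2] at h; simp at h; omega
  | some a => cases h2 : U[q]? with
    | none => have := one_le_code a; rw [h1, h2] at h; simp at h; omega
    | some b => rw [h1, h2] at h; simp at h; rw [code_strictMono.injective h]

theorem codeStr_eq_code_iff {U : List A} {p : ℕ} {a : A} :
    codeStr U p = code a ↔ U[p]? = some a := by
  have := one_le_code a
  unfold codeStr
  cases h1 : U[p]? with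
  | none => simp; omega
  | some b => simp [code_strictMono.injective.eq_iff]

theorem isStr_codeStr {U : List A} (h : Fintype.card A ≤ U.length) :
    IsStr U.length (codeStr U) where
  pos p hp := by rw [codeStr_of_lt hp]; exact one_le_code _
  le p := by
    rcases lt_or_ge p U.length with hp | hp
    · rw [codeStr_of_lt hp]; have := code_le_card U[p]; omega
    · rw [codeStr_of_le hp]; omega
  zero p hp := codeStr_of_le hp

/-- The value `0` beyond the end lies below all codes, just as the empty list lies below every
nonempty one. -/
theorem drop_lt_of_sLt {U : List A} {p q : ℕ} (h : SLt (codeStr U) p q) :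
    U.drop p < U.drop q := by
  obtain ⟨k, h, hk⟩ := h
  induction k generalizing p q with
  | zero =>
    simp only [add_zero] at hk
    have hq : q < U.length := by
      by_contra hq; rw [codeStr_of_le (by omega : U.length ≤ q)] at hk; omega
    rw [List.drop_eq_getElem_cons hq]
    rcases lt_or_ge p U.length with hp | hp
    · rw [List.drop_eq_getElem_cons hp, List.cons_lt_cons_iff]
      rw [codeStr_of_lt hp, codeStr_of_lt hq] at hk
      exact Or.inl (code_strictMono.lt_iff_lt.1 hk)
    · rw [List.drop_eq_nil_of_le hp]
      exact List.nil_lt_cons _ _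
  | succ k ih =>
    obtain ⟨h0, h1⟩ := agree_succ.1 h
    have hlt := ih h1 (by rwa [add_assoc, add_assoc, add_comm 1])
    rcases lt_or_ge p U.length with hp | hp
    · rcases lt_or_ge q U.length with hq | hq
      · rw [List.drop_eq_getElem_cons hq, List.drop_eq_getElem_cons hp, List.cons_lt_cons_iff]
        rw [codeStr_of_lt hp, codeStr_of_lt hq] at h0
        exact Or.inr ⟨code_strictMono.injective h0, hlt⟩
      · rw [codeStr_of_le (p := q + (k + 1)) (by omega)] at hk; omega
    · rw [codeStr_of_le hp] at h0
      have hq : U.length ≤ q := by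
        by_contra hq
        rw [codeStr_of_lt (not_le.1 hq)] at h0
        have := one_le_code U[q]
        omega
      rw [codeStr_of_le (p := q + (k + 1)) (by omega)] at hk; omega

theorem drop_lt_iff {U : List A} (hU : Fintype.card A ≤ U.length) {p q : ℕ} (hp : p ≤ U.length)
    (hq : q ≤ U.length) : U.drop p < U.drop q ↔ SLt (codeStr U) p q := by
  refine ⟨fun h => ?_, drop_lt_of_sLt⟩
  by_cases hpq : p = q
  · subst hpq; exact absurd h (lt_irrefl _)
  · rcases (isStr_codeStr hU).sLt_or hp hq hpq with h' | h'
    · exact h'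
    · exact absurd h (drop_lt_of_sLt h').asymm

end Code

section SuffixArray

variable {A : Type*} [LinearOrder A]

theorem suffixArray_perm (U : List A) : (suffixArray U).Perm (List.range' 1 U.length) :=
  List.mergeSort_perm _ _

theorem length_suffixArray (U : List A) : (suffixArray U).length = U.length := by
  rw [(suffixArray_perm U).length_eq, List.length_range']

/-- Distinct positions have suffixes of different lengths, so the sorted order is strict. -/
theorem suffixArray_pairwise (U : List A) :
    (suffixArray U).Pairwise fun p q => suffixAt U p < suffixAt U q := by
  have h1 : (suffixArray U).Pairwise fun p q =>
      decide (suffixAt U p ≤ suffixAt U q) = true :=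
    List.pairwise_mergeSort (fun a b c h h' => by
      simp only [decide_eq_true_eq] at *; exact le_trans h h')
      (fun a b => by simpa using le_total _ _) _
  have h2 : (suffixArray U).Pairwise (· ≠ ·) :=
    (suffixArray_perm U).nodup_iff.2 (List.nodup_range' _)
  have h3 : ∀ p ∈ suffixArray U, 1 ≤ p ∧ p ≤ U.length := fun p hp => by
    have := (suffixArray_perm U).mem_iff.1 hp
    simp at this; omega
  refine (h1.and h2).imp_of_mem fun {p q} hp hq h => ?_
  have b1 := h3 p hp
  have b2 := h3 q hq
  refine lt_of_le_of_ne (by simpa using h.1) fun he => h.2 ?_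
  have := congrArg List.length he
  simp only [suffixAt, List.length_drop] at this
  omega

theorem SA_eq_getElem {U : List A} {i : ℕ} (h1 : 1 ≤ i) (h2 : i ≤ U.length) :
    SA U i = (suffixArray U)[i - 1]'(by rw [length_suffixArray]; omega) := by
  rw [SA, List.getD_eq_getElem]

theorem SA_mem {U : List A} {i : ℕ} (h1 : 1 ≤ i) (h2 : i ≤ U.length) :
    1 ≤ SA U i ∧ SA U i ≤ U.length := by
  rw [SA_eq_getElem h1 h2]
  have := (suffixArray_perm U).mem_iff.1
    (List.getElem_mem (l := suffixArray U) (n := i - 1) (by rw [length_suffixArray]; omega))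
  simp at this
  omega

theorem suffixAt_SA_lt {U : List A} {i j : ℕ} (h1 : 1 ≤ i) (hij : i < j) (h2 : j ≤ U.length) :
    suffixAt U (SA U i) < suffixAt U (SA U j) := by
  rw [SA_eq_getElem h1 (by omega), SA_eq_getElem (by omega) h2]
  exact List.pairwise_iff_getElem.1 (suffixArray_pairwise U) _ _ _ _ (by omega)

theorem exists_SA_eq {U : List A} {p : ℕ} (h1 : 1 ≤ p) (h2 : p ≤ U.length) :
    ∃ i, 1 ≤ i ∧ i ≤ U.length ∧ SA U i = p := by
  have hp : p ∈ suffixArray U := (suffixArray_perm U).mem_iff.2 (by simp; omega)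
  obtain ⟨k, hk, e⟩ := List.mem_iff_getElem.1 hp
  rw [length_suffixArray] at hk
  exact ⟨k + 1, by omega, by omega, by rw [SA_eq_getElem (by omega) (by omega)]; simpa using e⟩

/-- Different lengths guarantee a mismatch right after the common prefix, possibly of a letter with
`none`. -/
theorem lcpLength_spec (l₁ l₂ : List A) : (∀ j < lcpLength l₁ l₂, l₁[j]? = l₂[j]?) ∧
    (l₁.length ≠ l₂.length → l₁[lcpLength l₁ l₂]? ≠ l₂[lcpLength l₁ l₂]?) := by
  induction l₁ generalizing l₂ with
  | nil => cases l₂ <;> simp [lcpLength]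
  | cons a l₁ ih =>
    cases l₂ with
    | nil => simp [lcpLength]
    | cons b l₂ =>
      rw [lcpLength]
      split_ifs with h
      · subst h
        refine ⟨fun j hj => ?_, fun hne => ?_⟩
        · cases j with
          | zero => rfl
          | succ j => simpa using (ih l₂).1 j (by omega)
        · simpa using (ih l₂).2 (by simpa using hne)
      · simp [h]

variable [Fintype A]

theorem IsLcp.symm {X : ℕ → ℕ} {p q k : ℕ} (h : IsLcp X p q k) : IsLcp X q p k :=
  ⟨h.1.symm, h.2.symm⟩

theorem IsLcp.le_iff {X : ℕ → ℕ} {p q k h : ℕ} (hk : IsLcp X p q k) : h ≤ k ↔ Agree X h p q :=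
  ⟨fun hl => hk.1.mono hl, fun ha => by by_contra hl; exact hk.2 (ha k (by omega))⟩

theorem IsLcp.unique {X : ℕ → ℕ} {p q k k' : ℕ} (h : IsLcp X p q k) (h' : IsLcp X p q k') :
    k = k' :=
  le_antisymm (h'.le_iff.2 h.1) (h.le_iff.2 h'.1)

theorem isLcp_lcpLength {U : List A} {p q : ℕ} (hp : p ≤ U.length) (hq : q ≤ U.length)
    (hpq : p ≠ q) : IsLcp (codeStr U) p q (lcpLength (U.drop p) (U.drop q)) := by
  have h := lcpLength_spec (U.drop p) (U.drop q)
  refine ⟨fun j hj => codeStr_eq_iff.2 (by simpa using h.1 j hj), fun he => ?_⟩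
  refine h.2 (by simp; omega) ?_
  simpa using codeStr_eq_iff.1 he

theorem SA_sLt {U : List A} (hU : Fintype.card A ≤ U.length) {i j : ℕ} (h1 : 1 ≤ i) (hij : i < j)
    (h2 : j ≤ U.length) : SLt (codeStr U) (SA U i - 1) (SA U j - 1) := by
  have := SA_mem (U := U) h1 (by omega)
  have := SA_mem (U := U) (i := j) (by omega) h2
  exact (drop_lt_iff hU (by omega) (by omega)).1 (suffixAt_SA_lt h1 hij h2)

theorem SA_inj {U : List A} (hU : Fintype.card A ≤ U.length) {i j : ℕ} (h1 : 1 ≤ i)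
    (h2 : i ≤ U.length) (h3 : 1 ≤ j) (h4 : j ≤ U.length) (h : SA U i = SA U j) : i = j := by
  rcases lt_trichotomy i j with h' | h' | h'
  · exact absurd (h ▸ SA_sLt hU h1 h' h4) sLt_irrefl
  · exact h'
  · exact absurd (h ▸ SA_sLt hU h3 h' h2) sLt_irrefl

theorem LCP_isLcp {U : List A} (hU : Fintype.card A ≤ U.length) {i : ℕ} (h1 : 2 ≤ i)
    (h2 : i ≤ U.length) :
    IsLcp (codeStr U) (SA U (i - 1) - 1) (SA U i - 1) (LCP U i) := by
  have b1 := SA_mem (U := U) (i := i) (by omega) h2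
  have b2 := SA_mem (U := U) (i := i - 1) (by omega) (by omega)
  refine isLcp_lcpLength (by omega) (by omega) fun h => ?_
  have := SA_inj hU (i := i - 1) (j := i) (by omega) (by omega) (by omega) h2 (by omega)
  omega

/-- The map `i ↦ R (SA U i - 1)` is strictly increasing from `{1, …, n}` into itself, hence the
identity; the two bounds are induction from either end. -/
theorem rank_SA {U : List A} (hU : Fintype.card A ≤ U.length) {R : ℕ → ℕ}
    (hR : IsRank U.length (codeStr U) R) {i : ℕ} (h1 : 1 ≤ i) (h2 : i ≤ U.length) :
    R (SA U i - 1) = i := by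
  have hX := isStr_codeStr hU
  have mono : ∀ i j, 1 ≤ i → i < j → j ≤ U.length → R (SA U i - 1) < R (SA U j - 1) := by
    intro i j h1 h2 h3
    have := SA_mem (U := U) h1 (by omega)
    have := SA_mem (U := U) (i := j) (by omega) h3
    exact (hR.lt_iff _ (by omega) _ (by omega)).2 (SA_sLt hU h1 h2 h3)
  have lower : ∀ i, 1 ≤ i → i ≤ U.length → i ≤ R (SA U i - 1) := by
    intro i h1
    induction i, h1 using Nat.le_induction with
    | base =>
      intro h
      have := SA_mem (U := U) le_rfl h
      exact hR.pos hX (by omega)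
    | succ i hi ih =>
      intro h
      have := ih (by omega)
      have := mono i (i + 1) hi (by omega) h
      omega
  have upper : ∀ d, d < U.length → R (SA U (U.length - d) - 1) ≤ U.length - d := by
    intro d
    induction d with
    | zero =>
      intro h
      have := SA_mem (U := U) (i := U.length) (by omega) le_rfl
      exact hR.le _ (by simp; omega)
    | succ d ih =>
      intro h
      have := ih (by omega)
      have := mono (U.length - (d + 1)) (U.length - d) (by omega) (by omega) (by omega)
      omega
  have := lower i h1 h2
  have := upper (U.length - i) (by omega)
  rw [show U.length - (U.length - i) = i by omega] at this
  omega

end SuffixArray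

section RevText

variable {A : Type*}

theorem IsText.exists_eq [LinearOrder A] {T : List A} (h : IsText T) :
    ∃ (W : List A) (d : A), T = W ++ [d] ∧ revText T = W.reverse ++ [d] ∧ d ∉ W ∧
      ∀ a, a ≠ d → d < a := by
  obtain ⟨d, h1, h2, h3⟩ := h
  obtain ⟨W, rfl⟩ : ∃ W, T = W ++ [d] := by
    obtain ⟨W, e⟩ := List.getLast?_eq_some_iff.1 h2
    exact ⟨W, e⟩
  refine ⟨W, d, rfl, ?_, by simpa using h3, h1⟩
  simp [revText]

theorem IsText.length_revText [LinearOrder A] {T : List A} (h : IsText T) :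
    (revText T).length = T.length := by
  obtain ⟨W, d, rfl, h2, -⟩ := h.exists_eq
  rw [h2]; simp

end RevText

section Compute

variable {A : Type*} [LinearOrder A] [Fintype A]

theorem arraysComputed_run {T : List A} (hT : IsText T) (hn : 2 ≤ T.length)
    (hA : Fintype.card A ≤ T.length) {M : Machine} (hcap : 1000 * T.length + 1000 ≤ M.cap)
    (hlen : 40 * T.length + 40 ≤ M.len) :
    Run M computeArrays (inputState T) (31000 * T.length) (ArraysComputed T) := by
  have hl := hT.length_revText
  have hU : Fintype.card A ≤ (revText T).length := by omega
  obtain ⟨W, d, hW, hr, hd, -⟩ := hT.exists_eq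
  have hWl : T.length = W.length + 1 := by rw [hW]; simp
  have hX := isStr_codeStr hU
  rw [hl] at hX
  refine (computeArrays_run (X := codeStr (revText T)) hn rfl hX ?_ ?_ hcap hlen).frame.imp le_rfl
    ?_
  · intro p hp
    simp only [inputState, codeStr, true_and]
    rw [if_pos (by omega)]
    congr 1
    rw [hr, hW, List.getElem?_append_left (by simp; omega), List.getElem?_append_left
      (by simp at hWl ⊢; omega), List.getElem?_reverse (by omega)]
    congr 1
    simp; omega
  · simp only [inputState, codeStr, true_and]
    rw [if_pos (by omega), hr, hW]
    simp
  · rintro s ⟨⟨R, hR, h1, h2, h3⟩, hF⟩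
    rw [← hl] at hR
    have rk : ∀ i, 1 ≤ i → i ≤ T.length →
        1 ≤ SA (revText T) i ∧ SA (revText T) i ≤ T.length ∧ R (SA (revText T) i - 1) = i := by
      intro i hi hi'
      have := SA_mem (U := revText T) hi (by omega)
      exact ⟨this.1, by omega, rank_SA hU hR hi (by omega)⟩
    have hlcp : ∀ i, 2 ≤ i → i ≤ T.length → s.arr aLCP i = LCP (revText T) i := by
      intro i hi hi'
      obtain ⟨a1, a2, a3⟩ := rk i (by omega) hi'
      obtain ⟨b1, b2, b3⟩ := rk (i - 1) (by omega) (by omega)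
      have := h2 _ (by omega : SA (revText T) i - 1 < T.length) _
        (by omega : SA (revText T) (i - 1) - 1 < T.length) (by omega)
      rw [a3] at this
      exact this.symm.unique (LCP_isLcp hU hi (by omega))
    refine ⟨hF.vars vN rfl, hF.vars vSigma rfl, fun i hi => ?_, fun i hi => ?_⟩
    · rw [Finset.mem_Icc] at hi
      obtain ⟨a1, a2, a3⟩ := rk i hi.1 hi.2
      obtain ⟨c1, c2⟩ := h1 _ (by omega : SA (revText T) i - 1 < T.length)
      rw [a3] at c1 c2
      refine ⟨by omega, ?_⟩
      rw [c2, BWT, charAt]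
      split_ifs with h
      · rw [List.getLast?_eq_getElem?, hl, codeStr, List.getElem?_eq_getElem (by omega)]
        rfl
      · rw [codeStr, List.getElem?_eq_getElem (by omega)]
        rfl
    · rw [Finset.mem_Icc] at hi
      obtain ⟨c1, c2⟩ := h3 i hi.1 hi.2
      exact ⟨hlcp i hi.1 hi.2, c1.trans (psv_congr hlcp hi.1 hi.2),
        c2.trans (nsv_congr hlcp hi.1 hi.2)⟩

end Compute

end Suffixient

namespace Suffixient

/-! ### Boxes and first maxima -/

namespace ScanData

variable {D : ScanData}

/-- A larger break `j` in the box to the right has `i ≤ PSV[j]`, so (b) excludes it, while (a)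
excludes breaks to the left. Conversely, a violation `j` of (b) has `L j ≤ L i`, yet `PSV[j]` lies
in the box of `i`, where all values are at least `L i`. -/
theorem max_iff {γ i : ℕ} (hi : D.Brk γ i) : D.Max γ i ↔
    ∀ j, D.Brk γ j → PSV D.L i < j → j < NSV D.n D.L i → D.L j ≤ D.L i ∧ i ≤ j := by
  constructor
  · rintro ⟨⟨-, h1⟩, h2⟩ j hj hl hr
    have hij : i ≤ j := by
      by_contra h
      have := h1 j hj (by omega)
      omega
    refine ⟨?_, hij⟩
    by_contra hlt
    have hne : i ≠ j := by rintro rfl; omega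
    have : i ≤ PSV D.L j := by
      by_contra h
      have := le_of_psv_lt (L := D.L) (i := j) hi.1 (by omega) (by omega)
      omega
    have := h2 j hj (by omega) this
    omega
  · intro h
    have hnsv := lt_nsv (L := D.L) hi.2.1
    refine ⟨⟨hi, fun j hj hji => ?_⟩, fun j hj hij hle => ?_⟩
    · by_contra hlt
      have := h j hj (by omega) (by omega)
      omega
    · by_contra hge
      have hpsv := psv_lt (L := D.L) hi.1
      have b1 := psv_cases D.L j
      have b2 := hi.1
      have hLj : D.L j ≤ D.L i := by
        rcases (not_lt.1 hge).lt_or_eq with h' | h'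
        · exact (h j hj (by omega) h').1
        -- The break `j = NSV[i]` just outside the box has a value smaller than `L i` by definition.
        · have := nsv_cases D.n D.L i
          have := hj.2.1
          rw [h'] at *; omega
      have : D.L i ≤ D.L (PSV D.L j) := by
        rcases hle.lt_or_eq with h' | h'
        · exact le_of_lt_nsv (n := D.n) (by omega) h'
        · rw [← h']
      omega

end ScanData

section Box

variable {A : Type*} [LinearOrder A]

theorem mem_box_iff {U : List A} {i j : ℕ} (h1 : 2 ≤ i) (h2 : i ≤ U.length) :
    j ∈ box U i ↔ 2 ≤ j ∧ PSV (LCP U) i < j ∧ j < NSV U.length (LCP U) i := by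
  have a1 := psv_cases (LCP U) i
  have a2 := nsv_cases U.length (LCP U) i
  simp only [box, Finset.mem_filter, Finset.mem_Icc, Finset.mem_uIcc]
  constructor
  · rintro ⟨⟨b1, b2⟩, h⟩
    refine ⟨b1, ?_, ?_⟩
    · by_contra hlt
      have := h (PSV (LCP U) i) (by omega)
      omega
    · by_contra hlt
      have := h (NSV U.length (LCP U) i) (by omega)
      omega
  · rintro ⟨b1, b2, b3⟩
    refine ⟨⟨b1, by omega⟩, fun k hk => ?_⟩
    rcases lt_trichotomy k i with h | h | h
    · exact le_of_psv_lt (by omega) (by omega) h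
    · rw [h]
    · exact le_of_lt_nsv (n := U.length) (by omega) h

/-- The maximum is needed for the default `PSV[i] = 0`: the box then begins at `2`, not at `1`. Both
give the same comparison with a run break, which is at least `2`. -/
theorem boxLeft_eq {U : List A} {i : ℕ} (h1 : 2 ≤ i) (h2 : i ≤ U.length) :
    boxLeft U i = max 2 (PSV (LCP U) i + 1) := by
  have a1 := psv_lt (L := LCP U) h1
  have a2 := lt_nsv (L := LCP U) h2
  have : IsLeast (box U i : Set ℕ) (max 2 (PSV (LCP U) i + 1)) := by
    refine ⟨?_, fun j hj => ?_⟩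
    · rw [Finset.mem_coe, mem_box_iff h1 h2]; omega
    · rw [Finset.mem_coe, mem_box_iff h1 h2] at hj; omega
  exact this.csInf_eq

theorem boxRight_eq {U : List A} {i : ℕ} (h1 : 2 ≤ i) (h2 : i ≤ U.length) :
    boxRight U i + 1 = NSV U.length (LCP U) i := by
  have a1 := psv_lt (L := LCP U) h1
  have a2 := lt_nsv (L := LCP U) h2
  have : IsGreatest (box U i : Set ℕ) (NSV U.length (LCP U) i - 1) := by
    refine ⟨?_, fun j hj => ?_⟩
    · rw [Finset.mem_coe, mem_box_iff h1 h2]; omega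
    · rw [Finset.mem_coe, mem_box_iff h1 h2] at hj; omega
  rw [boxRight, this.csSup_eq]
  omega

theorem le_boxLeft_sub_one_iff {U : List A} {i j : ℕ} (h1 : 2 ≤ i) (h2 : i ≤ U.length)
    (hj : 2 ≤ j) : j ≤ boxLeft U i - 1 ↔ j ≤ PSV (LCP U) i := by
  rw [boxLeft_eq h1 h2]; omega

theorem exists_BWT_eq {U : List A} {i : ℕ} (h1 : 1 ≤ i) (h2 : i ≤ U.length) :
    ∃ a, BWT U i = some a := by
  have := SA_mem h1 h2
  rw [BWT, charAt]
  split_ifs with h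
  · rw [List.getLast?_eq_getElem?]
    exact ⟨_, List.getElem?_eq_getElem (by omega)⟩
  · exact ⟨_, List.getElem?_eq_getElem (by omega)⟩

/-- Values in the box are at least `LCP[i]`, so `i` attains the maximum only if all breaks in the
box have the same value as `i`. -/
theorem isLeftmostMaximum_iff {U : List A} {c : A} {i : ℕ} (hi : IsRunBreak U c i) :
    IsLeftmostMaximum U c i ↔ ∀ j, IsRunBreak U c j → PSV (LCP U) i < j →
      j < NSV U.length (LCP U) i → LCP U j ≤ LCP U i ∧ i ≤ j := by
  have hmem : i ∈ boxBreaks U i c :=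
    ⟨hi, (mem_box_iff hi.1 hi.2.1).2 ⟨hi.1, psv_lt hi.1, lt_nsv hi.2.1⟩⟩
  have hge : ∀ j ∈ boxBreaks U i c, LCP U i ≤ LCP U j := fun j hj => by
    have := hj.2
    simp only [box, Finset.mem_filter] at this
    exact this.2 j (by simp)
  constructor
  · rintro ⟨⟨-, h1⟩, h2⟩ j hj hl hr
    have hjm : j ∈ boxBreaks U i c := ⟨hj, (mem_box_iff hi.1 hi.2.1).2 ⟨hj.1, hl, hr⟩⟩
    have hle : LCP U j ≤ LCP U i := h1.2 ⟨j, hjm, rfl⟩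
    refine ⟨hle, h2 ⟨hjm, ?_⟩⟩
    rwa [le_antisymm hle (hge j hjm)]
  · intro h
    have key : ∀ j ∈ boxBreaks U i c, LCP U j ≤ LCP U i ∧ i ≤ j := fun j hj => by
      have := (mem_box_iff hi.1 hi.2.1).1 hj.2
      exact h j hj.1 this.2.1 this.2.2
    refine ⟨⟨hmem, ⟨i, hmem, rfl⟩, ?_⟩, fun j hj => (key j hj.1).2⟩
    rintro _ ⟨j, hj, rfl⟩
    exact (key j hj).1

/-! ### Transfer between letters and their codes -/

variable [Fintype A]

/-- The arrays of `U`, with coded letters. -/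
def scanData (U : List A) (h1 : 2 ≤ U.length) (h2 : Fintype.card A ≤ U.length) : ScanData where
  n := U.length
  σ := Fintype.card A
  bw i := (BWT U i).elim 0 code
  L := LCP U
  sa := SA U
  two_le := h1
  σ_le := h2
  bw_mem i hi hi' := by
    obtain ⟨a, ha⟩ := exists_BWT_eq hi hi'
    rw [ha]
    exact ⟨one_le_code a, code_le_card a⟩
  sa_mem i hi hi' := SA_mem hi hi'

theorem elim_code_eq_iff {o : Option A} {c : A} : o.elim 0 code = code c ↔ o = some c := by
  have := one_le_code c
  cases o with
  | none => simp; omega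
  | some b => simp [code_strictMono.injective.eq_iff]

theorem elim_code_injective : Function.Injective fun o : Option A => o.elim 0 code := by
  intro o o' h
  cases o' with
  | none =>
    cases o with
    | none => rfl
    | some a => have := one_le_code a; simp at h; omega
  | some c => exact elim_code_eq_iff.1 h

variable {U : List A} {h1 : 2 ≤ U.length} {h2 : Fintype.card A ≤ U.length}

theorem brk_iff {c : A} {i : ℕ} : (scanData U h1 h2).Brk (code c) i ↔ IsRunBreak U c i := by
  simp only [ScanData.Brk, IsRunBreak, scanData, elim_code_eq_iff, ne_eq,
    elim_code_injective.eq_iff]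

/-- If the preceding break lies to the left of the box, so do all earlier ones. -/
theorem cand_iff {c : A} {i : ℕ} :
    (scanData U h1 h2).Cand (code c) i ↔ IsFirstCandidate U c i := by
  rw [ScanData.Cand, IsFirstCandidate, brk_iff]
  refine and_congr_right fun hi => ?_
  simp only [brk_iff]
  constructor
  · intro h j hj
    rw [le_boxLeft_sub_one_iff hi.1 hi.2.1 hj.1.1.1]
    exact h j hj.1.1 hj.1.2
  · intro h j hj hji
    have hfin : {k | IsRunBreak U c k ∧ k < i}.Finite :=
      (Set.finite_lt_nat i).subset fun k hk => hk.2
    obtain ⟨g, hg⟩ := hfin.exists_maximalFor id _ ⟨j, hj, hji⟩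
    have hg' : IsGreatest {k | IsRunBreak U c k ∧ k < i} g := by
      refine ⟨hg.1, fun k hk => ?_⟩
      by_contra hlt
      exact hlt (hg.2 hk (by simpa using (not_le.1 hlt).le))
    have e1 := h g hg'
    rw [le_boxLeft_sub_one_iff hi.1 hi.2.1 hg.1.1.1] at e1
    exact (hg'.2 ⟨hj, hji⟩).trans e1

theorem max_iff_isFirstMaximum {c : A} {i : ℕ} :
    (scanData U h1 h2).Max (code c) i ↔ IsFirstMaximum U c i := by
  rw [ScanData.Max, IsFirstMaximum, cand_iff]
  refine and_congr_right fun hi => forall_congr' fun j => ?_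
  rw [brk_iff]
  refine forall_congr' fun hj => forall_congr' fun _ => ?_
  rw [le_boxLeft_sub_one_iff hj.1 hj.2.1 hi.1.1, boxRight_eq hi.1.1 hi.1.2.1]
  rfl

theorem isFirstMaximum_iff_isLeftmostMaximum (h1 : 2 ≤ U.length)
    (h2 : Fintype.card A ≤ U.length) {c : A} {i : ℕ} (hi : IsRunBreak U c i) :
    IsFirstMaximum U c i ↔ IsLeftmostMaximum U c i := by
  rw [← max_iff_isFirstMaximum (h1 := h1) (h2 := h2), ScanData.max_iff (brk_iff.2 hi),
    isLeftmostMaximum_iff hi]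
  simp only [brk_iff]
  rfl

theorem exists_max_out_iff {x : ℕ} :
    (∃ γ, 1 ≤ γ ∧ γ ≤ (scanData U h1 h2).σ ∧
      ∃ j, (scanData U h1 h2).Max γ j ∧ (scanData U h1 h2).Out γ j x) ↔
    ∃ (c : A) (i i' : ℕ), IsFirstMaximum U c i ∧ (i' = i - 1 ∨ i' = i) ∧
      BWT U i' = some c ∧ x = U.length - SA U i' + 1 := by
  constructor
  · rintro ⟨γ, -, -, j, hj, i', h3, h4, h5⟩
    have b1 := hj.1.1.1
    have b2 : j ≤ U.length := hj.1.1.2.1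
    obtain ⟨c, hc⟩ := exists_BWT_eq (U := U) (i := i') (by omega) (by omega)
    have hγ : γ = code c := by
      rw [← h4]; simp [scanData, hc]
    subst hγ
    exact ⟨c, j, i', max_iff_isFirstMaximum.1 hj, h3, hc, h5⟩
  · rintro ⟨c, i, i', hi, h3, h4, h5⟩
    exact ⟨code c, one_le_code c, code_le_card c, i, max_iff_isFirstMaximum.2 hi, i', h3,
      elim_code_eq_iff.2 h4, h5⟩

end Box

end Suffixient

namespace Suffixient

/-! ### Occurrences in the text and in the reversed text -/

section Occurrences

variable {A : Type*}

theorem concat_suffix_concat_iff {α β : List A} {a b : A} :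
    α ++ [a] <:+ β ++ [b] ↔ a = b ∧ α <:+ β := by
  rw [← List.reverse_prefix, ← List.reverse_prefix (l₁ := α)]
  simp [List.cons_prefix_cons]

theorem concat_suffix_take_iff {T α : List A} {c : A} {x : ℕ} (h : x < T.length) :
    α ++ [c] <:+ T.take (x + 1) ↔ T[x]? = some c ∧ α <:+ T.take x := by
  rw [List.take_add_one, List.getElem?_eq_getElem h, Option.toList_some, concat_suffix_concat_iff,
    Option.some_inj, eq_comm]

theorem infix_iff_suffix_take {T β : List A} :
    β <:+: T ↔ ∃ x ≤ T.length, β <:+ T.take x := by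
  rw [List.infix_iff_suffix_prefix]
  constructor
  · rintro ⟨t, h1, h2⟩
    exact ⟨t.length, h2.length_le, by rwa [← List.prefix_iff_eq_take.1 h2]⟩
  · rintro ⟨x, -, h⟩
    exact ⟨_, h, List.take_prefix _ _⟩

/-- The strings `α` with `αc` a substring do not contain the end marker. -/
theorem notMem_of_concat_infix {T W : List A} {d : A} (hW : T = W ++ [d]) (hd : d ∉ W)
    {α : List A} {c : A} (h : α ++ [c] <:+: T) : d ∉ α := by
  obtain ⟨x, hx, h⟩ := infix_iff_suffix_take.1 h
  obtain _ | x := x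
  · simp at h
  · rw [concat_suffix_take_iff hx] at h
    have h1 : α <:+ W.take x := by
      have : T.take x = W.take x := by
        rw [hW]; exact List.take_append_of_le_length (by rw [hW] at hx; simp at hx; omega)
      rw [← this]; exact h.2
    exact fun hα => hd (List.mem_of_mem_take (h1.subset hα))

variable [LinearOrder A]

/-- The suffix at `p` of the reversed text reverses the first `n - p` letters of the text, so the
letter before it is the next text letter. For `p = 1` the cyclic convention supplies the end marker.
-/
theorem BWT_revText {T : List A} (hT : IsText T) {i : ℕ} (h1 : 1 ≤ i) (h2 : i ≤ T.length) :
    BWT (revText T) i = T[T.length - SA (revText T) i]? := by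
  have hl := hT.length_revText
  have hs := SA_mem (U := revText T) h1 (by omega)
  obtain ⟨W, d, hW, hr, -⟩ := hT.exists_eq
  rw [hl] at hs
  rw [BWT]
  generalize SA (revText T) i = p at hs
  have hWl : T.length = W.length + 1 := by rw [hW]; simp
  rw [charAt, hr, hWl]
  split_ifs with h
  · rw [hW, show W.length + 1 - p = W.length by omega]
    simp
  · rw [List.getElem?_append_left (by simp; omega), List.getElem?_reverse (by omega), hW,
      List.getElem?_append_left (by omega)]
    congr 1
    omega

theorem concat_suffix_take_SA_iff {T W : List A} {d : A} (hT : IsText T) (hW : T = W ++ [d])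
    (hr : revText T = W.reverse ++ [d]) {α : List A} (hα : d ∉ α) {c : A} {i : ℕ} (h1 : 1 ≤ i)
    (h2 : i ≤ T.length) :
    α ++ [c] <:+ T.take (T.length - SA (revText T) i + 1) ↔
      BWT (revText T) i = some c ∧ α.reverse <+: (revText T).drop (SA (revText T) i - 1) := by
  have hl := hT.length_revText
  have hs := SA_mem (U := revText T) h1 (by omega)
  have hWl : T.length = W.length + 1 := by rw [hW]; simp
  rw [concat_suffix_take_iff (by omega), BWT_revText hT h1 h2]
  refine and_congr_right fun _ => ?_
  generalize SA (revText T) i = p at hs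
  have e1 : T.take (T.length - p) = W.take (T.length - p) := by
    conv_lhs => rw [hW]
    rw [List.take_append_of_le_length (by simp; omega), ← hW]
  rw [e1, ← List.reverse_prefix, List.reverse_take, hr,
    List.drop_append_of_le_length (by simp; omega), List.prefix_concat_iff,
    show W.length - (T.length - p) = p - 1 by omega]
  -- The other alternative would make the reversal of `α` a whole suffix of the reversed text, with
  -- the end marker in it.
  refine ⟨Or.inr, fun h => h.resolve_left fun he => hα ?_⟩
  rw [← List.mem_reverse, he]; simp

theorem concat_infix_iff {T W : List A} {d : A} (hT : IsText T) (hW : T = W ++ [d])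
    (hr : revText T = W.reverse ++ [d]) {α : List A} (hα : d ∉ α) {c : A} :
    α ++ [c] <:+: T ↔ ∃ i, 1 ≤ i ∧ i ≤ T.length ∧ BWT (revText T) i = some c ∧
      α.reverse <+: (revText T).drop (SA (revText T) i - 1) := by
  have hl := hT.length_revText
  rw [infix_iff_suffix_take]
  constructor
  · rintro ⟨x, hx, h⟩
    obtain _ | x := x
    · simp at h
    · obtain ⟨i, h1, h2, h3⟩ := exists_SA_eq (U := revText T) (p := T.length - x) (by omega)
        (by omega)
      refine ⟨i, h1, by omega, (concat_suffix_take_SA_iff hT hW hr hα h1 (by omega)).1 ?_⟩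
      rwa [h3, show T.length - (T.length - x) = x by omega]
  · rintro ⟨i, h1, h2, h⟩
    have hs := SA_mem (U := revText T) h1 (by omega)
    exact ⟨_, by omega, (concat_suffix_take_SA_iff hT hW hr hα h1 h2).2 h⟩

/-- A right-maximal string with the extension `c` has another extension. -/
theorem RightMaximal.exists_ne {T : List A} (hT : IsText T) (hn : 2 ≤ T.length) {α : List A}
    {c : A} (h : RightMaximal T α) (hc : α ++ [c] <:+: T) : ∃ b, b ≠ c ∧ α ++ [b] <:+: T := by
  rcases h with h | ⟨a, b, hab, ha, hb⟩
  · obtain ⟨W, d, hW, hr, hd, -⟩ := hT.exists_eq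
    have hα := notMem_of_concat_infix hW hd hc
    -- A nonempty suffix of the text contains the end marker, after which nothing follows. For the
    -- empty one, the first letter and the end marker are two different extensions because `n ≥ 2`.
    have h0 : α = [] := by
      rcases List.eq_nil_or_concat α with h0 | ⟨β, b, rfl⟩
      · exact h0
      · rw [List.concat_eq_append, hW, concat_suffix_concat_iff] at h
        simp [h.1] at hα
    subst h0
    by_cases hcd : c = d
    · obtain _ | ⟨e, W'⟩ := W
      · rw [hW] at hn; simp at hn
      · refine ⟨e, ?_, ?_⟩
        · rintro rfl; simp [hcd] at hd
        · rw [hW]; exact ⟨[], W' ++ [d], by simp⟩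
    · refine ⟨d, fun h => hcd h.symm, ?_⟩
      rw [hW]; exact ⟨W, [], by simp⟩
  · by_cases h : a = c
    · exact ⟨b, fun h' => hab (h.trans h'.symm), hb⟩
    · exact ⟨a, h, ha⟩

variable [Fintype A]

theorem prefix_drop_iff_agree {U β : List A} {p q : ℕ} (h : β <+: U.drop p) :
    β <+: U.drop q ↔ Agree (codeStr U) β.length p q := by
  have key : ∀ r, β <+: U.drop r ↔ ∀ j < β.length, U[r + j]? = β[j]? := by
    intro r
    rw [List.prefix_iff_getElem?]
    refine forall_congr' fun j => forall_congr' fun hj => ?_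
    rw [List.getElem?_drop, List.getElem?_eq_getElem hj]
  have hp := (key p).1 h
  rw [key]
  refine forall_congr' fun j => forall_congr' fun hj => ?_
  rw [codeStr_eq_iff, hp j hj, eq_comm]

/-- Suffixes agree on a prefix if and only if the LCP values between them are large. -/
theorem agree_SA_iff {U : List A} (hU : Fintype.card A ≤ U.length) {i j h : ℕ} (h1 : 1 ≤ i)
    (hij : i ≤ j) (h2 : j ≤ U.length) :
    Agree (codeStr U) h (SA U i - 1) (SA U j - 1) ↔ ∀ k, i < k → k ≤ j → h ≤ LCP U k := by
  constructor
  · intro ha k hk hkj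
    have key : ∀ m, i ≤ m → m ≤ j → Agree (codeStr U) h (SA U i - 1) (SA U m - 1) := by
      intro m hm hmj
      rcases hm.lt_or_eq with h3 | rfl
      · rcases hmj.lt_or_eq with h4 | rfl
        · exact ha.of_sLt_of_sLt (SA_sLt hU h1 h3 (by omega)) (SA_sLt hU (by omega) h4 h2)
        · exact ha
      · exact fun _ _ => rfl
    exact (LCP_isLcp hU (by omega) (by omega)).le_iff.2
      ((key (k - 1) (by omega) (by omega)).symm.trans (key k (by omega) hkj))
  · intro hk
    induction j, hij using Nat.le_induction with
    | base => exact fun _ _ => rfl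
    | succ j hj ih =>
      refine (ih (by omega) fun k h3 h4 => hk k h3 (by omega)).trans ?_
      have := (LCP_isLcp hU (i := j + 1) (by omega) h2).le_iff.1 (hk (j + 1) (by omega) le_rfl)
      simpa using this

end Occurrences

end Suffixient

namespace Suffixient

/-! ### The first maxima give a smallest suffixient set -/

theorem exists_switch {P : ℕ → Prop} {a b : ℕ} (hab : a ≤ b) (ha : P a) (hb : ¬ P b) :
    ∃ k, a < k ∧ k ≤ b ∧ P (k - 1) ∧ ¬ P k := by
  induction b, hab using Nat.le_induction with
  | base => exact absurd ha hb
  | succ b hab ih =>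
    by_cases h : P b
    · exact ⟨b + 1, by omega, le_rfl, h, hb⟩
    · obtain ⟨k, h1, h2, h3⟩ := ih h
      exact ⟨k, h1, by omega, h3⟩

section Smallest

variable {A : Type*} [LinearOrder A]

/-- Somewhere between an index with letter `c` and one without, the BWT switches. -/
theorem exists_runBreak {U : List A} {c : A} {i j : ℕ} (h1 : 1 ≤ i) (h2 : i ≤ U.length)
    (h3 : 1 ≤ j) (h4 : j ≤ U.length) (hi : BWT U i = some c) (hj : BWT U j ≠ some c) :
    ∃ k, IsRunBreak U c k ∧ min i j < k ∧ k ≤ max i j := by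
  rcases le_total i j with h | h
  · obtain ⟨k, b1, b2, b3, b4⟩ := exists_switch (P := fun k => BWT U k = some c) h hi hj
    exact ⟨k, ⟨by omega, by omega, fun e => b4 (e ▸ b3), Or.inl b3⟩, by omega, by omega⟩
  · obtain ⟨k, b1, b2, b3, b4⟩ := exists_switch (P := fun k => BWT U k ≠ some c) h hj
      (not_not.2 hi)
    rw [not_not] at b4
    exact ⟨k, ⟨by omega, by omega, fun e => b3 (e.trans b4), Or.inr b4⟩, by omega, by omega⟩

theorem mem_firstMaximumPositions_bounds {T : List A} (hT : IsText T) {x : ℕ}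
    (hx : x ∈ firstMaximumPositions T) : 1 ≤ x ∧ x ≤ T.length := by
  obtain ⟨c, i, i', hi, hi', -, rfl⟩ := hx
  have b1 := hi.1.1.1
  have b2 := hi.1.1.2.1
  have := SA_mem (U := revText T) (i := i') (by omega) (by omega)
  have := hT.length_revText
  omega

variable [Fintype A]

theorem isFirstMaximum_iff {U : List A} (h1 : 2 ≤ U.length) (h2 : Fintype.card A ≤ U.length)
    {c : A} {i : ℕ} (hi : IsRunBreak U c i) : IsFirstMaximum U c i ↔
      ∀ j, IsRunBreak U c j → (∀ k, min i j ≤ k → k ≤ max i j → LCP U i ≤ LCP U k) →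
        LCP U j ≤ LCP U i ∧ i ≤ j := by
  rw [isFirstMaximum_iff_isLeftmostMaximum h1 h2 hi, isLeftmostMaximum_iff hi]
  refine forall_congr' fun j => forall_congr' fun hj => ?_
  have := mem_box_iff (j := j) hi.1 hi.2.1
  simp only [box, Finset.mem_filter, Finset.mem_Icc, Finset.mem_uIcc, hj.1, hj.2.1, true_and,
    and_imp] at this
  rw [← and_imp, ← this]

/-- Among the `c`-run breaks with LCP at least `h` whose suffix shares `h` letters with suffix `k`,
take the leftmost of largest LCP. Its box stays within this class, so optimality in the class
implies optimality in the box. -/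
theorem exists_isFirstMaximum {U : List A} (h1 : 2 ≤ U.length) (h2 : Fintype.card A ≤ U.length)
    {c : A} {k h : ℕ} (hk : IsRunBreak U c k) (hkh : h ≤ LCP U k) :
    ∃ m, IsFirstMaximum U c m ∧ h ≤ LCP U m ∧
      Agree (codeStr U) h (SA U k - 1) (SA U m - 1) := by
  classical
  let Q : Finset ℕ := (Finset.Icc 2 U.length).filter fun m => IsRunBreak U c m ∧ h ≤ LCP U m ∧
      Agree (codeStr U) h (SA U k - 1) (SA U m - 1)
  have memQ : ∀ m, m ∈ Q ↔ IsRunBreak U c m ∧ h ≤ LCP U m ∧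
      Agree (codeStr U) h (SA U k - 1) (SA U m - 1) := fun m => by
    simp only [Q, Finset.mem_filter, Finset.mem_Icc, and_iff_right_iff_imp]
    exact fun hm => ⟨hm.1.1, hm.1.2.1⟩
  obtain ⟨m₀, hm₀, hmax⟩ := Q.exists_max_image (LCP U)
    ⟨k, (memQ k).2 ⟨hk, hkh, fun _ _ => rfl⟩⟩
  obtain ⟨m, hm, hmin⟩ := (Q.filter fun m => LCP U m = LCP U m₀).exists_min_image id
    ⟨m₀, Finset.mem_filter.2 ⟨hm₀, rfl⟩⟩
  rw [Finset.mem_filter] at hm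
  obtain ⟨hm, he⟩ := hm
  obtain ⟨b1, b2, b3⟩ := (memQ m).1 hm
  refine ⟨m, (isFirstMaximum_iff h1 h2 b1).2 fun j hj hbox => ?_, b2, b3⟩
  have hjQ : j ∈ Q := by
    refine (memQ j).2 ⟨hj, b2.trans (hbox j (by omega) (by omega)), b3.trans ?_⟩
    have c1 := b1.1
    have c2 := hj.1
    rcases le_total m j with h | h
    · exact (agree_SA_iff h2 (by omega) h hj.2.1).2 fun k h3 h4 =>
        b2.trans (hbox k (by omega) (by omega))
    · exact ((agree_SA_iff h2 (by omega) h b1.2.1).2 fun k h3 h4 =>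
        b2.trans (hbox k (by omega) (by omega))).symm
  have hle : LCP U j ≤ LCP U m := he ▸ hmax j hjQ
  refine ⟨hle, hmin j (Finset.mem_filter.2 ⟨hjQ, ?_⟩)⟩
  have := hbox j (by omega) (by omega)
  omega

theorem isSuffixient_of_coe_eq {T : List A} (hT : IsText T) (hn : 2 ≤ T.length)
    (hA : Fintype.card A ≤ T.length) {S : Finset ℕ} (hS : (S : Set ℕ) = firstMaximumPositions T) :
    IsSuffixient T S := by
  have hl := hT.length_revText
  obtain ⟨W, d, hW, hr, hd, -⟩ := hT.exists_eq
  have hS' : ∀ x, x ∈ S ↔ x ∈ firstMaximumPositions T := fun x => by rw [← hS, Finset.mem_coe]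
  refine ⟨fun x hx => ?_, fun α c hα hc => ?_⟩
  · rw [Finset.mem_Icc]
    exact mem_firstMaximumPositions_bounds hT ((hS' x).1 hx)
  · obtain ⟨b, hbc, hb⟩ := hα.exists_ne hT hn hc
    have hdα := notMem_of_concat_infix hW hd hc
    rw [concat_infix_iff hT hW hr hdα] at hc hb
    generalize hU : revText T = U at *
    rw [← hl] at hn hA hc hb
    obtain ⟨i, i1, i2, i3, i4⟩ := hc
    obtain ⟨j, j1, j2, j3, j4⟩ := hb
    obtain ⟨k, k1, k2, k3⟩ := exists_runBreak i1 i2 j1 j2 i3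
      (by rw [j3]; simpa using hbc)
    have hlo : α.reverse <+: U.drop (SA U (min i j) - 1) := by
      rcases min_choice i j with h | h <;> rwa [h]
    have hhi : α.reverse <+: U.drop (SA U (max i j) - 1) := by
      rcases max_choice i j with h | h <;> rwa [h]
    have hag := (agree_SA_iff hA (by omega) (min_le_max) (by omega)).1
      ((prefix_drop_iff_agree hlo).1 hhi)
    have hk : α.reverse <+: U.drop (SA U k - 1) :=
      (prefix_drop_iff_agree hlo).2 ((agree_SA_iff hA (by omega) k2.le (by omega)).2
        fun m h3 h4 => hag m h3 (by omega))
    obtain ⟨m, m1, m2, m3⟩ := exists_isFirstMaximum hn hA k1 (hag k k2 k3)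
    have hm := (prefix_drop_iff_agree hk).2 m3
    -- The suffix before `m` has the prefix as well, so it does not matter which side of the break
    -- carries `c`.
    have hm' : α.reverse <+: U.drop (SA U (m - 1) - 1) :=
      (prefix_drop_iff_agree hm).2
        ((LCP_isLcp hA m1.1.1.1 m1.1.1.2.1).le_iff.1 m2).symm
    have b1 := m1.1.1.1
    have b2 := m1.1.1.2.1
    obtain ⟨i', hi', hb', ho⟩ : ∃ i', (i' = m - 1 ∨ i' = m) ∧ BWT U i' = some c ∧
        α.reverse <+: U.drop (SA U i' - 1) := by
      rcases m1.1.1.2.2.2 with h | h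
      · exact ⟨m - 1, Or.inl rfl, h, hm'⟩
      · exact ⟨m, Or.inr rfl, h, hm⟩
    refine ⟨T.length - SA U i' + 1, (hS' _).2 ⟨c, m, i', ?_⟩, ?_⟩
    · rw [hU]; exact ⟨m1, hi', hb', rfl⟩
    · have := concat_suffix_take_SA_iff hT hW (hU.trans hr) hdα (c := c) (i := i') (by omega)
        (by omega)
      rw [hU] at this
      exact this.2 ⟨hb', ho⟩

/-- Every suffixient set has a position for each first maximum. -/
theorem IsFirstMaximum.exists_mem {T : List A} (hT : IsText T) (hA : Fintype.card A ≤ T.length)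
    {S : Finset ℕ} (hS : IsSuffixient T S) {c : A} {i : ℕ} (hi : IsFirstMaximum (revText T) c i) :
    ∃ m, 1 ≤ m ∧ m ≤ T.length ∧ T.length - SA (revText T) m + 1 ∈ S ∧
      BWT (revText T) m = some c ∧
      Agree (codeStr (revText T)) (LCP (revText T) i) (SA (revText T) i - 1)
        (SA (revText T) m - 1) := by
  have hl := hT.length_revText
  obtain ⟨W, d, hW, hr, hd, -⟩ := hT.exists_eq
  obtain ⟨b1, b2, b3, b4⟩ := hi.1.1
  have suf := fun α (hα : d ∉ α) c j => concat_suffix_take_SA_iff hT hW hr hα (c := c) (i := j)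
  have inf := fun α (hα : d ∉ α) c => concat_infix_iff hT hW hr hα (c := c)
  have hUd : ∀ q < T.length, (revText T)[q]? = some d → q = T.length - 1 := by
    intro q hq h
    have hWl : T.length = W.length + 1 := by rw [hW]; simp
    by_contra hne
    rw [hr, List.getElem?_append_left (by simp; omega)] at h
    exact hd (List.mem_reverse.1 (List.mem_of_getElem? h))
  generalize revText T = U at *
  rw [← hl] at hA
  have hX := isStr_codeStr hA
  have s1 := SA_mem (U := U) (i := i) (by omega) b2
  have s2 := SA_mem (U := U) (i := i - 1) (by omega) (by omega)
  have hlcp := LCP_isLcp hA b1 b2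
  have hne : SA U (i - 1) ≠ SA U i := fun h => by
    have := SA_inj hA (by omega) (by omega) (by omega) b2 h
    omega
  have hle := hX.agree_le (by omega) (by omega) (by omega) hlcp.1
  obtain ⟨β, hβ⟩ : ∃ β, β = (U.drop (SA U i - 1)).take (LCP U i) := ⟨_, rfl⟩
  have hβl : β.length = LCP U i := by
    rw [hβ, List.length_take, List.length_drop]; omega
  have p1 : β <+: U.drop (SA U i - 1) := hβ ▸ List.take_prefix _ _
  have p2 : β <+: U.drop (SA U (i - 1) - 1) :=
    (prefix_drop_iff_agree p1).2 (hβl ▸ hlcp.1.symm)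
  -- The end marker stands only at the end of the reversed text. In a common prefix of two suffixes
  -- it would sit at the same offset from different starting points.
  have hdβ : d ∉ β.reverse := by
    rw [List.mem_reverse]
    intro hmem
    obtain ⟨j, hj, e⟩ := List.mem_iff_getElem.1 hmem
    have e1 := List.prefix_iff_getElem?.1 p1 j hj
    have e2 := List.prefix_iff_getElem?.1 p2 j hj
    rw [List.getElem?_drop, e] at e1 e2
    have := hUd _ (by omega) e1
    have := hUd _ (by omega) e2
    omega
  obtain ⟨x, hx⟩ := exists_BWT_eq (U := U) (i := i - 1) (by omega) (by omega)
  obtain ⟨y, hy⟩ := exists_BWT_eq (U := U) (i := i) (by omega) b2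
  have inx : β.reverse ++ [x] <:+: T :=
    (inf _ hdβ x).2 ⟨i - 1, by omega, by omega, hx, by rwa [List.reverse_reverse]⟩
  have iny : β.reverse ++ [y] <:+: T :=
    (inf _ hdβ y).2 ⟨i, by omega, by omega, hy, by rwa [List.reverse_reverse]⟩
  have inc : β.reverse ++ [c] <:+: T := by
    rcases b4 with h | h
    · rw [hx, Option.some_inj] at h; rwa [← h]
    · rw [hy, Option.some_inj] at h; rwa [← h]
  -- The letters `x ≠ y` before the two suffixes make the reversal of `β` right-maximal.
  obtain ⟨z, hz, hsuf⟩ := hS.2 β.reverse c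
    (Or.inr ⟨x, y, fun h => b3 (by rw [hx, hy, h]), inx, iny⟩) inc
  have hz' := Finset.mem_Icc.1 (hS.1 hz)
  obtain ⟨m, m1, m2, m3⟩ := exists_SA_eq (U := U) (p := T.length - z + 1) (by omega) (by omega)
  have ez : T.length - SA U m + 1 = z := by omega
  rw [← ez] at hsuf hz
  obtain ⟨c1, c2⟩ := (suf _ hdβ c m m1 (by omega)).1 hsuf
  rw [List.reverse_reverse] at c2
  exact ⟨m, m1, by omega, hz, c1, hβl ▸ (prefix_drop_iff_agree p1).1 c2⟩

/-- A position determines the first maximum that it covers. -/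
theorem IsFirstMaximum.eq_of_agree {U : List A} (h1 : 2 ≤ U.length)
    (h2 : Fintype.card A ≤ U.length) {c : A} {i j m : ℕ} (hi : IsFirstMaximum U c i)
    (hj : IsFirstMaximum U c j)
    (ai : Agree (codeStr U) (LCP U i) (SA U i - 1) (SA U m - 1))
    (aj : Agree (codeStr U) (LCP U j) (SA U j - 1) (SA U m - 1)) : i = j := by
  have key : ∀ i j, IsRunBreak U c i → IsRunBreak U c j → LCP U i ≤ LCP U j →
      Agree (codeStr U) (LCP U i) (SA U i - 1) (SA U j - 1) →
      ∀ k, min i j ≤ k → k ≤ max i j → LCP U i ≤ LCP U k := by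
    intro i j hi hj hle ha k hk hk'
    have b1 := hi.1
    have b2 := hj.1
    rcases le_total i j with h | h
    · rcases (show i ≤ k by omega).lt_or_eq with h' | rfl
      · exact (agree_SA_iff h2 (by omega) h hj.2.1).1 ha k h' (by omega)
      · exact le_rfl
    · rcases (show j ≤ k by omega).lt_or_eq with h' | rfl
      · exact (agree_SA_iff h2 (by omega) h hi.2.1).1 ha.symm k h' (by omega)
      · exact hle
  wlog hle : LCP U i ≤ LCP U j generalizing i j
  · exact (this hj hi aj ai (by omega)).symm
  -- Through `m`, the suffixes `i` and `j` agree on the smaller of the two LCP values, so `j` lies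
  -- in the box of `i`.
  have ha := ai.trans (aj.mono hle).symm
  have e1 := (isFirstMaximum_iff h1 h2 hi.1.1).1 hi j hj.1.1 (key i j hi.1.1 hj.1.1 hle ha)
  have he : LCP U j = LCP U i := by omega
  have e2 := (isFirstMaximum_iff h1 h2 hj.1.1).1 hj i hi.1.1
    (key j i hj.1.1 hi.1.1 he.le (he ▸ ha.symm))
  omega

theorem isSmallestSuffixient_of_coe_eq {T : List A} (hT : IsText T) (hn : 2 ≤ T.length)
    (hA : Fintype.card A ≤ T.length) {S : Finset ℕ} (hS : (S : Set ℕ) = firstMaximumPositions T) :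
    IsSmallestSuffixient T S := by
  refine ⟨isSuffixient_of_coe_eq hT hn hA hS, fun S' hS' => ?_⟩
  have hl := hT.length_revText
  -- Relate a first-maximum position to the positions of `S'` that cover it. A position of `S'`
  -- determines its suffix, hence `c`, hence the first maximum, hence the side of the break.
  refine Finset.card_le_card_of_forall_subsingleton (fun x y =>
    ∃ (c : A) (i i' m : ℕ), (IsFirstMaximum (revText T) c i ∧ (i' = i - 1 ∨ i' = i) ∧
      BWT (revText T) i' = some c ∧ x = T.length - SA (revText T) i' + 1) ∧
      (1 ≤ m ∧ m ≤ T.length) ∧ y = T.length - SA (revText T) m + 1 ∧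
      BWT (revText T) m = some c ∧
      Agree (codeStr (revText T)) (LCP (revText T) i) (SA (revText T) i - 1)
        (SA (revText T) m - 1)) ?_ ?_
  · intro x hx
    rw [← Finset.mem_coe, hS] at hx
    obtain ⟨c, i, i', hi⟩ := hx
    obtain ⟨m, m1, m2, m3, m4, m5⟩ := hi.1.exists_mem hT hA hS'
    exact ⟨_, m3, c, i, i', m, hi, ⟨m1, m2⟩, rfl, m4, m5⟩
  · rintro y - x ⟨-, c, i, i', m, ⟨a1, a2, a3, rfl⟩, a5, a6, a7, a8⟩ x'
      ⟨-, c', j, j', m', ⟨b1, b2, b3, rfl⟩, b5, b6, b7, b8⟩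
    generalize revText T = U at *
    rw [← hl] at hn hA a5 a6 b5 b6
    have s1 := SA_mem (U := U) a5.1 a5.2
    have s2 := SA_mem (U := U) b5.1 b5.2
    have hm : m = m' := SA_inj hA a5.1 a5.2 b5.1 b5.2 (by omega)
    subst hm
    have hc : c = c' := Option.some_inj.1 (a7.symm.trans b7)
    subst hc
    have hij := a1.eq_of_agree hn hA b1 a8 b8
    subst hij
    have : i' = j' := by
      have hne := a1.1.1.2.2.1
      rcases a2 with rfl | rfl <;> rcases b2 with rfl | rfl
      · rfl
      · exact absurd (a3.trans b3.symm) hne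
      · exact absurd (b3.trans a3.symm) hne
      · rfl
    rw [this]

end Smallest

/-! ### The algorithm -/

theorem fmAlgorithm_run {A : Type*} [LinearOrder A] [Fintype A] {T : List A} (hT : IsText T)
    (hn : 2 ≤ T.length) (hA : Fintype.card A ≤ T.length) {M : Machine} {s : State}
    (hs : ArraysComputed T s) (hcap : 1000 * T.length + 1000 ≤ M.cap)
    (hlen : 40 * T.length + 40 ≤ M.len) :
    Run M (.block [clearS, initR, scanBWT, reportActive]) s (1000 * T.length)
      fun s' => (outputSet T.length s' : Set ℕ) = firstMaximumPositions T := by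
  have hl := hT.length_revText
  obtain ⟨h1, h2, h3, h4⟩ := hs
  have hn' : 2 ≤ (revText T).length := by omega
  have hA' : Fintype.card A ≤ (revText T).length := by omega
  have hL : (scanData (revText T) hn' hA').Loaded s :=
    { n := h1.trans hl.symm
      σ := h2
      bw := fun i hi hi' => by
        have := (h3 i (Finset.mem_Icc.2 ⟨hi, hi'.trans hl.le⟩)).2
        show _ = (BWT (revText T) i).elim 0 code
        cases hb : BWT (revText T) i with
        | none => rw [hb] at this; simp at this
        | some a => rw [hb] at this; simpa using this
      sa := fun i hi hi' => (h3 i (Finset.mem_Icc.2 ⟨hi, hi'.trans hl.le⟩)).1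
      psv := fun i hi hi' => (h4 i (Finset.mem_Icc.2 ⟨hi, hi'.trans hl.le⟩)).2.1
      nsv := fun i hi hi' => by
        rw [(h4 i (Finset.mem_Icc.2 ⟨hi, hi'.trans hl.le⟩)).2.2, ← hl]
        rfl }
  have hD : (scanData (revText T) hn' hA').n = T.length := hl
  refine (ScanData.scan_run hL (hD ▸ hcap) (hD ▸ hlen)).imp (Nat.mul_le_mul_left _ hl.le)
    fun s' hs' => Set.ext fun x => ?_
  have key : (1 ≤ x ∧ x ≤ T.length) → (s'.arr aS x = 1 ↔ x ∈ firstMaximumPositions T) := by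
    rintro ⟨hx, hx'⟩
    rw [hs' x hx (hx'.trans hl.ge), exists_max_out_iff, hl]
    rfl
  simp only [outputSet, Finset.coe_filter, Finset.mem_Icc, Set.mem_ofPred_eq]
  exact ⟨fun h => (key h.1).1 h.2, fun h =>
    have hb := mem_firstMaximumPositions_bounds hT h
    ⟨hb, (key hb).2 h⟩⟩

theorem words_le {p : Prog} {n C : ℕ} (hn : 2 ≤ n)
    (hC : p.varNames.card + p.arrNames.card * 60 ≤ C) : p.words (40 * n + 40) ≤ C * n := by
  refine le_trans ?_ (Nat.mul_le_mul_right n hC)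
  rw [Prog.words, add_mul, mul_assoc]
  exact Nat.add_le_add (Nat.le_mul_of_pos_right _ (by omega)) (Nat.mul_le_mul_left _ (by omega))

theorem le_pow_of_two_le {n C : ℕ} (hn : 2 ≤ n) (hC : 12 ≤ C) : 1000 * n + 1000 ≤ n ^ C := by
  -- Since `n ≥ 2`, the constant factor is absorbed by a power of `n`.
  calc 1000 * n + 1000 ≤ 2 ^ 11 * n := by omega
    _ ≤ n ^ 11 * n := Nat.mul_le_mul_right _ (Nat.pow_le_pow_left hn _)
    _ = n ^ 12 := (pow_succ n 11).symm
    _ ≤ n ^ C := Nat.pow_le_pow_right (by omega) hC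

end Suffixient

theorem mainTheorem10 :
    ∃ (arrays : Suffixient.Prog) (C : ℕ),
      ∀ (A : Type*) [LinearOrder A] [Fintype A] (T : List A),
        Suffixient.IsText T → 2 ≤ T.length → Fintype.card A ≤ T.length →
        ∃ s₀ s : Suffixient.State,
          Suffixient.RunsWithin arrays (T.length ^ C) (C * T.length) (C * T.length)
            (Suffixient.inputState T) s₀ ∧
          Suffixient.ArraysComputed T s₀ ∧
          Suffixient.RunsWithin (Suffixient.fmAlgorithm arrays)
            (T.length ^ C) (C * T.length) (C * T.length) (Suffixient.inputState T) s ∧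
          Suffixient.IsSmallestSuffixient T (Suffixient.outputSet T.length s) ∧
          (Suffixient.outputSet T.length s : Set ℕ) = Suffixient.firstMaximumPositions T ∧
          ∀ (c : A) (i : ℕ), Suffixient.IsRunBreak (Suffixient.revText T) c i →
            (Suffixient.IsFirstMaximum (Suffixient.revText T) c i ↔
              Suffixient.IsLeftmostMaximum (Suffixient.revText T) c i) := by
  open Suffixient in
  -- The programs' name counts enter the constant symbolically, so they never have to be computed.
  obtain ⟨F, hF⟩ : ∃ F, F = fmAlgorithm computeArrays := ⟨_, rfl⟩
  obtain ⟨w, hw⟩ : ∃ w, w = computeArrays.varNames.card + computeArrays.arrNames.card * 60 :=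
    ⟨_, rfl⟩
  obtain ⟨C, hC1, hC2, hC3⟩ : ∃ C, 32000 ≤ C ∧ w ≤ C ∧
      F.varNames.card + F.arrNames.card * 60 ≤ C :=
    ⟨32000 + w + (F.varNames.card + F.arrNames.card * 60), by omega, by omega, by omega⟩
  refine ⟨computeArrays, C, fun A _ _ T hT hn hA => ?_⟩
  have hl := hT.length_revText
  have hcap := le_pow_of_two_le (C := C) hn (by omega)
  have hCn : 32000 * T.length ≤ C * T.length := Nat.mul_le_mul_right _ hC1
  obtain ⟨t₀, s₀, e₀, ht₀, hs₀⟩ :=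
    arraysComputed_run (M := ⟨T.length ^ C, 40 * T.length + 40⟩) hT hn hA hcap le_rfl
  obtain ⟨t, s, e, ht, hs⟩ :=
    fmAlgorithm_run (M := ⟨T.length ^ C, 40 * T.length + 40⟩) hT hn hA hs₀ hcap le_rfl
  refine ⟨s₀, s, ⟨_, t₀, words_le hn (hw ▸ hC2), by omega, e₀⟩, hs₀, ?_,
    isSmallestSuffixient_of_coe_eq hT hn hA hs, hs, fun c i hi =>
      isFirstMaximum_iff_isLeftmostMaximum (by omega) (by omega) hi⟩
  rw [← hF]
  refine ⟨_, t₀ + t, words_le hn hC3, by omega, ?_⟩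
  rw [hF]
  exact .seq _ _ _ _ _ _ _ e₀ e
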